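/- Let $a>0$ and $m>0$. Consider the boundary value problem (BVP) on $\mathbb{R}_-=(-\infty,0]$ $$(\Phi''+\Phi\Phi')'=\frac{2m-1}{m}(\Phi')^2,\qquad \Phi(0)=0,$$ $$\lim_{\tau\to-\infty}e^{-\varepsilon\tau}\bigl(\Phi(\tau)+a\bigr)=\lim_{\tau\to-\infty}e^{-\varepsilon\tau}\Phi'(\tau)=\lim_{\tau\to-\infty}e^{-\varepsilon\tau}\Phi''(\tau)=0\quad\text{for all }0<\varepsilon<a .$$ Let $\Phi_{1/2}(\tau,a)=a\tanh(a\tau/2)$, and for $\tau\le 0$ let $\Phi_{1/3}(\tau,a)$ be the unique $y\in(-a,0]$ with $$\tau=\frac{\sqrt3\,\pi}{6a}-\frac1{2a}\ln\frac{a+\sqrt{-ay}-y}{(\sqrt a-\sqrt{-y})^2}-\frac{\sqrt3}{a}\arctan\frac{\sqrt a+2\sqrt{-y}}{\sqrt{3a}} .$$ (1) Let $1/3\le m\le 1/2$. The BVP has a unique strictly increasing solution $\Phi_m(\cdot,a)$. It is also the only solution with $\Phi'(0)\ge 0$, and for $m\in\{1/3,1/2\}$ it is the only solution. For $m=1/3$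 and $m=1/2$ it is the function $\Phi_{1/3}$, respectively $\Phi_{1/2}$, above. For some $d=d(a,m)>0$ it is represented, for all sufficiently negative $\tau$, by the convergent series $$\Phi_m(\tau,a)=-a+d\,e^{a\tau}+\sum_{l\ge2}h_l\,d^{\,l}e^{la\tau},$$ where $h_1=1$ and $$h_l=\frac{1}{a\,l^2(l-1)}\sum_{k=1}^{l-1}k\Bigl(\frac{(m-1)(l-k)}{m}-k\Bigr)h_kh_{l-k}\qquad(l\ge2).$$ Moreover $$\Phi_{1/2}(\tau,a)\le\Phi_m(\tau,a)\le\Phi_{1/3}(\tau,a)\qquad(\tau\le0).$$ (2) Let $1/3\le m<1/2$. Then $\Phi_m$ has exactly one inflection point $\tau_{\rm in}<0$: $\Phi_m''>0$ on $(-\infty,\tau_{\rm in})$, $\Phi_m''(\tau_{\rm in})=0$ and $\Phi_m''<0$ on $(\tau_{\rm in},0]$. It is the only $\tau_{\rm in}\le0$ with $$\Phi_m(\tau_{\rm in},a)\,\Phi_m'(\tau_{\rm in},a)=\frac{2m-1}{m}\int_{-\infty}^{\tau_{\rm in}}\bigl[\Phi_m'(s,a)\bigr]^2ds ,$$ where the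 integral converges. The continuation of $\Phi_m$ to the right as a solution of the differential equation does not exist on all of $\mathbb{R}$. It exists up to a finite point $\tau_p=\tau_p(a,m)>0$, at which it has a simple pole singularity, in the sense that $$\Phi_m(\tau)=\frac{6m}{(m+1)(\tau-\tau_p)}\,(1+o(1))\qquad(\tau\to\tau_p-0).$$ Here $\tau_p(a,1/3)=2\pi\sqrt3/(3a)$, and $\tau_p(a,m)>\tau_p(a,1/3)$ for $1/3<m<1/2$. (3) For $0<m<1/3$ the BVP has no solution. -/

import Mathlib

open Set Filter Topology MeasureTheory

noncomputable section

/-- `Φ` is a classical (`C³`) solution on the interval `I` of the equation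
`Φ''' + Φ Φ'' - ((m - 1) / m) (Φ')² = 0`, equivalently
`(Φ'' + Φ Φ')' = ((2 m - 1) / m) (Φ')²`.  Derivatives are taken within `I`, so the values of `Φ`
outside `I` play no role (at an end point of `I` they are one-sided). -/
def SolvesODE (m : ℝ) (I : Set ℝ) (Φ : ℝ → ℝ) : Prop :=
  ContDiffOn ℝ 3 Φ I ∧
    ∀ τ ∈ I, iteratedDerivWithin 3 Φ I τ + Φ τ * iteratedDerivWithin 2 Φ I τ
      - ((m - 1) / m) * (derivWithin Φ I τ) ^ 2 = 0

/-- The limit conditions at `-∞`: for every `0 < ε < a`, the functions `Φ + a`, `Φ'`, `Φ''`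
multiplied by `exp (-ε τ)` tend to `0` as `τ → -∞`. -/
def DecayCondition (a : ℝ) (Φ : ℝ → ℝ) : Prop :=
  ∀ ε : ℝ, 0 < ε → ε < a →
    Tendsto (fun τ => Real.exp (-ε * τ) * (Φ τ + a)) atBot (𝓝 0) ∧
    Tendsto (fun τ => Real.exp (-ε * τ) * derivWithin Φ (Iic 0) τ) atBot (𝓝 0) ∧
    Tendsto (fun τ => Real.exp (-ε * τ) * iteratedDerivWithin 2 Φ (Iic 0) τ) atBot (𝓝 0)

/-- `Φ` solves the singular nonlinear boundary value problem on `(-∞, 0]`. -/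
structure IsBVPSolution (m a : ℝ) (Φ : ℝ → ℝ) : Prop where
  ode : SolvesODE m (Iic 0) Φ
  decay : DecayCondition a Φ
  zero : Φ 0 = 0

/-- The coefficients `h_l` of the exponential Lyapunov series: `h_1 = 1` and, for `l ≥ 2`,
`h_l = (∑_{k=1}^{l-1} k ((m - 1) (l - k) / m - k) h_k h_{l-k}) / (a l² (l - 1))`
(the value at `l = 0` is not used). -/
def lyapunovCoeff (a m : ℝ) : ℕ → ℝ
  | 0 => 0
  | 1 => 1
  | l + 2 =>
    (∑ k : Fin (l + 1), ((k : ℕ) + 1 : ℝ)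
      * ((m - 1) * (((l + 2 : ℕ) : ℝ) - ((k : ℕ) + 1 : ℝ)) / m - ((k : ℕ) + 1 : ℝ))
      * lyapunovCoeff a m ((k : ℕ) + 1) * lyapunovCoeff a m (l + 1 - (k : ℕ)))
    / (a * ((l + 2 : ℕ) : ℝ) ^ 2 * (((l + 2 : ℕ) : ℝ) - 1))
  decreasing_by
    all_goals omega

/-- `Φ` is given near `-∞` by the Lyapunov series with parameter `d`:
`Φ(τ) = -a + d e^{aτ} + ∑_{l ≥ 2} h_l d^l e^{l a τ}` for all `τ ≤ τ₀`, for some `τ₀ ≤ 0`. -/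
def HasLyapunovSeries (m a d : ℝ) (Φ : ℝ → ℝ) : Prop :=
  ∃ τ₀ ≤ (0 : ℝ), ∀ τ ≤ τ₀,
    HasSum (fun l : ℕ => lyapunovCoeff a m (l + 1) * d ^ (l + 1)
      * Real.exp (((l + 1 : ℕ) : ℝ) * a * τ)) (Φ τ + a)

/-- The exact solution for `m = 1/2`. -/
def phiHalf (a τ : ℝ) : ℝ := a * Real.tanh (a * τ / 2)

/-- The inverse function `τ(Φ)`, `-a < Φ ≤ 0`, of the exact solution for `m = 1/3`. -/
def tauThird (a y : ℝ) : ℝ :=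
  √3 * Real.pi / (6 * a)
    - 1 / (2 * a) * Real.log ((a + √(-a * y) - y) / (√a - √(-y)) ^ 2)
    - √3 / a * Real.arctan ((√a + 2 * √(-y)) / √(3 * a))

/-- The exact solution for `m = 1/3` on `(-∞, 0]`: the value `y = phiThird a τ` is the number in
`(-a, 0]` with `tauThird a y = τ`. -/
def phiThird (a τ : ℝ) : ℝ := Function.invFunOn (tauThird a) (Ioc (-a) 0) τ

/-- `τᵢ < 0` is the point of inflection of `Φ` on `(-∞, 0]`: `Φ` changes there from strictly
convex to strictly concave, and `τᵢ` is the only point of the half-line at which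
`Φ(τ) Φ'(τ) = ((2 m - 1) / m) ∫_{-∞}^{τ} (Φ'(s))² ds`. -/
def IsInflectionOfBVP (m : ℝ) (Φ : ℝ → ℝ) (τᵢ : ℝ) : Prop :=
  τᵢ < 0 ∧
  iteratedDerivWithin 2 Φ (Iic 0) τᵢ = 0 ∧
  (∀ τ < τᵢ, 0 < iteratedDerivWithin 2 Φ (Iic 0) τ) ∧
  (∀ τ, τᵢ < τ → τ ≤ 0 → iteratedDerivWithin 2 Φ (Iic 0) τ < 0) ∧
  IntegrableOn (fun s => (derivWithin Φ (Iic 0) s) ^ 2) (Iic 0) ∧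
  ∀ τ ≤ (0 : ℝ), Φ τ * derivWithin Φ (Iic 0) τ
      = ((2 * m - 1) / m) * ∫ s in Iic τ, (derivWithin Φ (Iic 0) s) ^ 2 ↔ τ = τᵢ

/-- `Φ` has, from the left, a simple pole singularity at `τₚ`:
`Φ(τ) = 6 m / ((m + 1) (τ - τₚ)) * (1 + Y(τ - τₚ))` with `Y → 0`. -/
def HasSimplePole (m : ℝ) (Φ : ℝ → ℝ) (τₚ : ℝ) : Prop :=
  ∃ Y : ℝ → ℝ, Tendsto Y (𝓝[<] 0) (𝓝 0) ∧
    ∀ τ < τₚ, Φ τ = 6 * m / ((m + 1) * (τ - τₚ)) * (1 + Y (τ - τₚ))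

/-- The continuation of `Φ` to the right of `0` as a solution exists exactly up to `τₚ > 0`, where
it has a simple pole singularity. -/
def BlowsUpAt (m : ℝ) (Φ : ℝ → ℝ) (τₚ : ℝ) : Prop :=
  0 < τₚ ∧ ∃ Ψ : ℝ → ℝ, SolvesODE m (Iio τₚ) Ψ ∧ EqOn Ψ Φ (Iic 0) ∧ HasSimplePole m Ψ τₚ

lemma tauThird_strictMonoOn {a : ℝ} (ha : 0 < a) : StrictMonoOn (tauThird a) (Ioc (-a) 0) := by
  intro x hx y hy hxy
  have hsa : 0 < √a := Real.sqrt_pos.2 ha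
  have h3 : 0 < √(3 * a) := Real.sqrt_pos.2 (by linarith)
  have hw : √(-y) < √(-x) := Real.sqrt_lt_sqrt (by linarith [hy.2]) (by linarith)
  have hw0 : 0 ≤ √(-y) := Real.sqrt_nonneg _
  have hwx : √(-x) < √a := Real.sqrt_lt_sqrt (by linarith [hx.2]) (by linarith [hx.1])
  have e1 : √(-a * y) ≤ √(-a * x) := Real.sqrt_le_sqrt (by nlinarith)
  have e1' : 0 ≤ √(-a * y) := Real.sqrt_nonneg _
  have e2 : (√a + 2 * √(-y)) / √(3 * a) < (√a + 2 * √(-x)) / √(3 * a) := by gcongr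
  have e3 := Real.arctan_strictMono e2
  have hden : 0 < (√a - √(-x)) ^ 2 := by
    have : 0 < √a - √(-x) := by linarith
    positivity
  have hnum : 0 < a + √(-a * y) - y := by linarith [hy.2]
  have hden2 : (√a - √(-x)) ^ 2 ≤ (√a - √(-y)) ^ 2 := by
    apply pow_le_pow_left₀ <;> linarith
  have e4 : (a + √(-a * y) - y) / (√a - √(-y)) ^ 2 ≤ (a + √(-a * x) - x) / (√a - √(-x)) ^ 2 := by
    apply div_le_div₀ <;> linarith
  have e5 := Real.log_le_log (div_pos hnum (hden.trans_le hden2)) e4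
  have c1 : 0 < 1 / (2 * a) := by positivity
  have c2 : 0 < √3 / a := by positivity
  have := mul_le_mul_of_nonneg_left e5 c1.le
  have := mul_lt_mul_of_pos_left e3 c2
  unfold tauThird
  linarith

lemma tauThird_zero {a : ℝ} (ha : 0 < a) : tauThird a 0 = 0 := by
  have hsa : 0 < √a := Real.sqrt_pos.2 ha
  have h3 : (√a + 2 * √(-0)) / √(3 * a) = (√3)⁻¹ := by
    rw [Real.sqrt_mul (by norm_num)]
    simp
    field_simp
  unfold tauThird
  rw [h3, Real.arctan_inv_of_pos (by positivity), Real.arctan_sqrt_three]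
  have : a / √a ^ 2 = 1 := by rw [Real.sq_sqrt ha.le]; field_simp
  simp [this]
  field_simp
  ring

/-- The implicit formula does define a function: `tauThird a` is a bijection of `(-a, 0]` onto
`(-∞, 0]`. -/
lemma tauThird_bijOn {a : ℝ} (ha : 0 < a) : BijOn (tauThird a) (Ioc (-a) 0) (Iic 0) := by
  have hsa : 0 < √a := Real.sqrt_pos.2 ha
  refine ⟨?_, (tauThird_strictMonoOn ha).injOn, ?_⟩
  · intro x hx
    have := (tauThird_strictMonoOn ha).monotoneOn hx ⟨by linarith, le_refl _⟩ hx.2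
    rwa [tauThird_zero ha] at this
  · have hcont : ContinuousOn (tauThird a) (Ioc (-a) 0) := by
      unfold tauThird
      refine ContinuousOn.sub (ContinuousOn.sub continuousOn_const
        (continuousOn_const.mul (ContinuousOn.log (ContinuousOn.div ?_ ?_ ?_) ?_))) ?_
      · fun_prop
      · fun_prop
      · intro x hx
        have hwx : √(-x) < √a := Real.sqrt_lt_sqrt (by linarith [hx.2]) (by linarith [hx.1])
        have : 0 < √a - √(-x) := by linarith
        positivity
      · intro x hx
        have hwx : √(-x) < √a := Real.sqrt_lt_sqrt (by linarith [hx.2]) (by linarith [hx.1])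
        have h1 : 0 < √a - √(-x) := by linarith
        have h2 : 0 < a + √(-a * x) - x := by linarith [hx.2, Real.sqrt_nonneg (-a * x)]
        positivity
      · refine Continuous.continuousOn (continuous_const.mul (Real.continuous_arctan.comp ?_))
        fun_prop
    have hbot : Tendsto (tauThird a) (𝓝[>] (-a)) atBot := by
      have hmem : ∀ᶠ x in 𝓝[>] (-a), x ∈ Ioc (-a) 0 :=
        Ioc_mem_nhdsGT (by linarith)
      have hd : Tendsto (fun x : ℝ => (√a - √(-x)) ^ 2) (𝓝[>] (-a)) (𝓝[>] 0) := by
        rw [tendsto_nhdsWithin_iff]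
        constructor
        · have : Continuous (fun x : ℝ => (√a - √(-x)) ^ 2) := by fun_prop
          have h := this.tendsto (-a)
          simp only [neg_neg, sub_self, ne_eq, OfNat.ofNat_ne_zero, not_false_eq_true,
            zero_pow] at h
          exact h.mono_left nhdsWithin_le_nhds
        · filter_upwards [hmem] with x hx
          have hwx : √(-x) < √a := Real.sqrt_lt_sqrt (by linarith [hx.2]) (by linarith [hx.1])
          have : 0 < √a - √(-x) := by linarith
          simp only [mem_Ioi]
          positivity
      have hnum : ∀ᶠ x in 𝓝[>] (-a), a * ((√a - √(-x)) ^ 2)⁻¹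
          ≤ (a + √(-a * x) - x) / (√a - √(-x)) ^ 2 := by
        filter_upwards [hmem] with x hx
        rw [div_eq_mul_inv]
        apply mul_le_mul_of_nonneg_right _ (by positivity)
        linarith [hx.2, Real.sqrt_nonneg (-a * x)]
      have hq : Tendsto (fun x => (a + √(-a * x) - x) / (√a - √(-x)) ^ 2) (𝓝[>] (-a)) atTop :=
        tendsto_atTop_mono' _ hnum ((tendsto_inv_nhdsGT_zero.comp hd).const_mul_atTop ha)
      have hl := (Real.tendsto_log_atTop.comp hq).const_mul_atTop
        (show 0 < 1 / (2 * a) by positivity)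
      have hb : ∀ᶠ x in 𝓝[>] (-a), tauThird a x ≤ √3 * Real.pi / (6 * a)
          + -(1 / (2 * a) * (Real.log ∘ fun x => (a + √(-a * x) - x) / (√a - √(-x)) ^ 2) x) := by
        filter_upwards with x
        have h0 : 0 ≤ Real.arctan ((√a + 2 * √(-x)) / √(3 * a)) :=
          Real.arctan_nonneg.2 (by positivity)
        have : 0 ≤ √3 / a * Real.arctan ((√a + 2 * √(-x)) / √(3 * a)) := by positivity
        simp only [tauThird, Function.comp]
        linarith
      exact tendsto_atBot_mono' _ hb
        (tendsto_atBot_add_const_left _ _ (tendsto_neg_atTop_atBot.comp hl))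
    intro t ht
    have hev := (hbot.eventually (eventually_le_atBot t)).and
      (Ioc_mem_nhdsGT (show -a < 0 by linarith))
    obtain ⟨x, hxt, hx⟩ := hev.exists
    have hsub : Icc x 0 ⊆ Ioc (-a) 0 := fun z hz => ⟨hx.1.trans_le hz.1, hz.2⟩
    have hivt := intermediate_value_Icc hx.2 (hcont.mono hsub)
    rw [tauThird_zero ha] at hivt
    obtain ⟨z, hz, rfl⟩ := hivt ⟨hxt, ht⟩
    exact ⟨z, hsub hz, rfl⟩

lemma phiThird_mem {a τ : ℝ} (ha : 0 < a) (hτ : τ ≤ 0) : phiThird a τ ∈ Ioc (-a) 0 :=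
  Function.invFunOn_mem ((tauThird_bijOn ha).surjOn hτ)

lemma tauThird_phiThird {a τ : ℝ} (ha : 0 < a) (hτ : τ ≤ 0) : tauThird a (phiThird a τ) = τ :=
  Function.invFunOn_eq ((tauThird_bijOn ha).surjOn hτ)

end

/-! Put `α = (1 - m) / m`, so that `1/3 ≤ m ≤ 1/2` means `1 ≤ α ≤ 2` and the equation is the
first-order system `f' = p`, `p' = r`, `r' = -f r - α p²`. Everything rests on three quantities that
are monotone or constant along trajectories leaving `(-a, 0, 0)`: `E = r + f p` with `E' = (1 - α)
p²`, `F = p + f²/2` with `F' = E`, and `G = f r - p²/2 + f² p` with `G' = (2 - α) f p²`. For `α = 1`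
the first is zero and `p = (a² - f²)/2`, which gives the tanh profile. For `α = 2` the third is zero
and, with `w = √(-f)`, `p = (2w/3)(√a³ - w³)`, which gives the implicit profile. For `α` in between
these equalities become the inequalities `p_le` and `p_ge` (the latter while `f < 0`), which
integrate to the two-sided comparison of profiles.

Existence: the Lyapunov series with `d = 1` converges near `-∞` and is continued to the right. By
`p_ge` the solution increases as long as `f < 0` and can stay negative only for a bounded time,
hence it reaches zero; a time translation puts the zero at `0` and turns `1` into `d`. Uniqueness: a
decaying trajectory is determined by `d = lim e^{-at} (f + a)` (`eq_of_tendsto_exp_neg_mul`, a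
contraction at `-∞`); increasing profiles have `d > 0`, so two of them differ by a translation, and
the common zero makes it trivial.

Blow-up, for `α > 1`: `E` is negative and decreasing, so `F` falls at least linearly and a Riccati
inequality excludes a global solution; boundedness arguments then give `f → -∞` at the right end.
There `u = -p/f²`, in the time `dη = -f dt`, satisfies the damped oscillator `u'' + (7u - 1) u' +
6u² (u - s) = 0` with `s = (2 + α)/6`, and a Lyapunov function forces `u → s`, that is, a simple
pole.

Blow-up time: for `α = 2` it is read off the explicit solution continued past zero. For `1 < α < 2`,
with `a = 1`, the part after the positive maximum of `f` is compared with an `α = 2` solution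
started at rest from zero (`lt_of_critical`); the three quantities bound the state at the maximum
and the time to reach it, and an elementary inequality (`blowUp_numerics`) finishes.

Nonexistence, for `α > 2`: now `G` increases from `0` while `f < 0`, yet it equals `-p²/2 ≤ 0` at
the first zero of `f`. So `G` is constant and `p` vanishes, leaving only the equilibrium. -/

open Asymptotics

/-! ### Integral curves of autonomous fields: uniqueness and maximal continuation -/

section AutonomousODE

variable {E : Type*} [NormedAddCommGroup E] [NormedSpace ℝ E] {X : E → E}

/-- Integral curves of a `C¹` vector field on an open interval that meet at one time coincide. -/
lemma eqOn_Ioo_of_hasDerivAt (hX : ContDiff ℝ 1 X) {l T t₀ : ℝ} {γ η : ℝ → E}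
    (hγ : ∀ t ∈ Ioo l T, HasDerivAt γ (X (γ t)) t) (hη : ∀ t ∈ Ioo l T, HasDerivAt η (X (η t)) t)
    (ht₀ : t₀ ∈ Ioo l T) (h : γ t₀ = η t₀) : EqOn γ η (Ioo l T) := by
  intro t ht
  obtain ⟨b, hb, hbT⟩ := exists_between (max_lt ht₀.2 ht.2)
  obtain ⟨c, hlc, hc⟩ := exists_between (lt_min ht₀.1 ht.1)
  have hsub : Icc c b ⊆ Ioo l T := fun x hx => ⟨hlc.trans_le hx.1, hx.2.trans_lt hbT⟩
  have hcγ : ContinuousOn γ (Icc c b) := fun x hx => (hγ x (hsub hx)).continuousAt.continuousWithinAt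
  have hcη : ContinuousOn η (Icc c b) := fun x hx => (hη x (hsub hx)).continuousAt.continuousWithinAt
  have hK : IsCompact (γ '' Icc c b ∪ η '' Icc c b) :=
    (isCompact_Icc.image_of_continuousOn hcγ).union (isCompact_Icc.image_of_continuousOn hcη)
  obtain ⟨K, hKL⟩ := (hX.locallyLipschitz.locallyLipschitzOn
    (s := γ '' Icc c b ∪ η '' Icc c b)).exists_lipschitzOnWith_of_compact hK
  refine ODE_solution_unique_of_mem_Ioo (v := fun _ => X)
    (s := fun _ => γ '' Icc c b ∪ η '' Icc c b) (a := c) (b := b) (t₀ := t₀) (K := K)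
    (fun _ _ => hKL) ⟨?_, ?_⟩ (fun s hs => ⟨hγ s (hsub (Ioo_subset_Icc_self hs)), ?_⟩)
    (fun s hs => ⟨hη s (hsub (Ioo_subset_Icc_self hs)), ?_⟩) h ⟨?_, ?_⟩
  · exact hc.trans_le (min_le_left _ _)
  · exact (le_max_left _ _).trans_lt hb
  · exact Or.inl (mem_image_of_mem _ (Ioo_subset_Icc_self hs))
  · exact Or.inr (mem_image_of_mem _ (Ioo_subset_Icc_self hs))
  · exact hc.trans_le (min_le_right _ _)
  · exact (le_max_right _ _).trans_lt hb

/-- Integral curves of a `C¹` vector field on `(-∞, T)` that meet at one time coincide. -/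
lemma eqOn_Iio_of_hasDerivAt (hX : ContDiff ℝ 1 X) {T t₀ : ℝ} {γ η : ℝ → E}
    (hγ : ∀ t < T, HasDerivAt γ (X (γ t)) t) (hη : ∀ t < T, HasDerivAt η (X (η t)) t)
    (ht₀ : t₀ < T) (h : γ t₀ = η t₀) : EqOn γ η (Iio T) := by
  intro t ht
  obtain ⟨l, hl⟩ := exists_lt (min t₀ t)
  exact eqOn_Ioo_of_hasDerivAt hX (fun s hs => hγ s hs.2) (fun s hs => hη s hs.2)
    ⟨hl.trans_le (min_le_left _ _), ht₀⟩ h ⟨hl.trans_le (min_le_right _ _), ht⟩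

/-- An integral curve on `(-∞, T)` that stays bounded near `T` extends beyond `T`. -/
lemma exists_extension_of_bounded [ProperSpace E] (hX : ContDiff ℝ 1 X) {T t₀ B : ℝ} {γ : ℝ → E}
    (hγ : ∀ t < T, HasDerivAt γ (X (γ t)) t) (ht₀ : t₀ < T)
    (hB : ∀ t, t₀ ≤ t → t < T → ‖γ t‖ ≤ B) :
    ∃ T' > T, ∃ η : ℝ → E, (∀ t < T', HasDerivAt η (X (η t)) t) ∧ EqOn η γ (Iio T) := by
  have hev : ∀ᶠ t in 𝓝[<] T, γ t ∈ Metric.closedBall (0 : E) B := by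
    filter_upwards [Ioo_mem_nhdsLT ht₀] with t ht
    simpa using hB t ht.1.le ht.2
  -- The time of existence `ε` is uniform for initial values near a cluster point of `γ` at `T`, so
  -- restarting from a point of the curve less than `ε` before `T` passes `T`.
  obtain ⟨x₀, -, hx₀⟩ := (isCompact_closedBall (0 : E) B).exists_mapClusterPt
    (f := 𝓝[<] T) (u := γ) (by rw [Filter.le_principal_iff, Filter.mem_map]; exact hev)
  obtain ⟨r, hr, ε, hε, H⟩ :=
    (hX.contDiffAt (x := x₀)).exists_forall_mem_closedBall_exists_eq_forall_mem_Ioo_hasDerivAt 0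
  have hfr : ∃ᶠ t in 𝓝[<] T, γ t ∈ Metric.ball x₀ r :=
    hx₀.frequently (Metric.ball_mem_nhds _ hr)
  obtain ⟨t₁, ht₁b, ht₁⟩ := (hfr.and_eventually (Ioo_mem_nhdsLT (sub_lt_self T hε))).exists
  obtain ⟨β, hβ0, hβ⟩ := H (γ t₁) (Metric.ball_subset_closedBall ht₁b)
  have hβ' : ∀ t ∈ Ioo (t₁ - ε) (t₁ + ε),
      HasDerivAt (fun t => β (t - t₁)) (X (β (t - t₁))) t := by
    intro t ht
    have := hβ (t - t₁) ⟨by linarith [ht.1], by linarith [ht.2]⟩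
    exact HasDerivAt.comp_sub_const t t₁ this
  have heq : ∀ t ∈ Ioo (t₁ - ε) T, β (t - t₁) = γ t :=
    eqOn_Ioo_of_hasDerivAt hX (t₀ := t₁)
      (fun t ht => hβ' t ⟨ht.1, ht.2.trans (by linarith [ht₁.1])⟩) (fun t ht => hγ t ht.2)
      ⟨sub_lt_self t₁ hε, ht₁.2⟩ (by simp [hβ0])
  refine ⟨t₁ + ε, by linarith [ht₁.1], fun t => if t < t₁ then γ t else β (t - t₁), ?_, ?_⟩
  · intro t ht
    rcases lt_or_ge t t₁ with h | h
    · have hnear : (fun t => if t < t₁ then γ t else β (t - t₁)) =ᶠ[𝓝 t] γ := by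
        filter_upwards [Iio_mem_nhds h] with s hs
        simp [mem_Iio.1 hs]
      simpa [h] using (hγ t (h.trans ht₁.2)).congr_of_eventuallyEq hnear
    · have hnear : (fun t => if t < t₁ then γ t else β (t - t₁)) =ᶠ[𝓝 t]
          fun t => β (t - t₁) := by
        filter_upwards [Ioi_mem_nhds (show t₁ - ε < t by linarith)] with s hs
        split_ifs with hst
        · exact (heq s ⟨hs, hst.trans ht₁.2⟩).symm
        · rfl
      have := (hβ' t ⟨by linarith, ht⟩).congr_of_eventuallyEq hnear
      simpa [not_lt.2 h] using this
  · intro t ht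
    by_cases h : t < t₁
    · simp [h]
    · simp only [h, if_false]
      exact heq t ⟨by linarith, ht⟩

/-- Every integral curve on a left half-line has a maximal continuation to the right. -/
lemma exists_maximal_extension [ProperSpace E] (hX : ContDiff ℝ 1 X) {T₀ : ℝ} {γ₀ : ℝ → E}
    (hγ₀ : ∀ t < T₀, HasDerivAt γ₀ (X (γ₀ t)) t) :
    ∃ γ : ℝ → E, EqOn γ γ₀ (Iio T₀) ∧
      ((∀ t, HasDerivAt γ (X (γ t)) t) ∨
        ∃ T, T₀ ≤ T ∧ (∀ t < T, HasDerivAt γ (X (γ t)) t) ∧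
          ∀ B, ∀ t₀ < T, ∃ t, t₀ ≤ t ∧ t < T ∧ B < ‖γ t‖) := by
  classical
  -- `S` collects the right ends of all continuations. They all agree with `γ₀` before `T₀`, hence
  -- with one another, and can be glued; a bounded curve at `sSup S` would produce a larger element.
  set S : Set ℝ := {T | T₀ ≤ T ∧ ∃ η : ℝ → E, (∀ t < T, HasDerivAt η (X (η t)) t) ∧
    EqOn η γ₀ (Iio T₀)} with hS
  have hT₀ : T₀ ∈ S := ⟨le_rfl, γ₀, hγ₀, fun _ _ => rfl⟩
  have hch : ∀ T : S, ∃ η : ℝ → E, (∀ t < T.1, HasDerivAt η (X (η t)) t) ∧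
    EqOn η γ₀ (Iio T₀) := fun T => T.2.2
  choose η hη hη₀ using hch
  have hcompat : ∀ T T' : S, ∀ t, t < T.1 → t < T'.1 → η T t = η T' t := by
    intro T T' t h1 h2
    have hm : T₀ - 1 < min T.1 T'.1 := lt_min (by linarith [T.2.1]) (by linarith [T'.2.1])
    refine eqOn_Iio_of_hasDerivAt hX (T := min T.1 T'.1) (t₀ := T₀ - 1)
      (fun s hs => hη T s (hs.trans_le (min_le_left _ _)))
      (fun s hs => hη T' s (hs.trans_le (min_le_right _ _))) hm ?_ (lt_min h1 h2)
    rw [hη₀ T (by simp), hη₀ T' (by simp)]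
  set γ : ℝ → E := fun t => if h : ∃ T : S, t < T.1 then η h.choose t else 0 with hγdef
  have hγη : ∀ T : S, ∀ t < T.1, γ t = η T t := by
    intro T t ht
    have h : ∃ T : S, t < T.1 := ⟨T, ht⟩
    simp only [hγdef, h, dif_pos]
    exact hcompat _ _ _ h.choose_spec ht
  have hγd : ∀ T : S, ∀ t < T.1, HasDerivAt γ (X (γ t)) t := by
    intro T t ht
    have hnear : γ =ᶠ[𝓝 t] η T := by
      filter_upwards [Iio_mem_nhds ht] with s hs using hγη T s hs
    rw [hγη T t ht]
    exact (hη T t ht).congr_of_eventuallyEq hnear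
  have hγ₀' : EqOn γ γ₀ (Iio T₀) := fun t ht => by
    rw [hγη ⟨T₀, hT₀⟩ t ht, hη₀ ⟨T₀, hT₀⟩ ht]
  refine ⟨γ, hγ₀', ?_⟩
  by_cases hbdd : BddAbove S
  · right
    have hd : ∀ t < sSup S, HasDerivAt γ (X (γ t)) t := by
      intro t ht
      obtain ⟨T, hT, htT⟩ := exists_lt_of_lt_csSup ⟨T₀, hT₀⟩ ht
      exact hγd ⟨T, hT⟩ t htT
    have hle : T₀ ≤ sSup S := le_csSup hbdd hT₀
    refine ⟨sSup S, hle, hd, fun B t₀ ht₀ => ?_⟩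
    by_contra! hcon
    obtain ⟨T', hT', ζ, hζ, hζγ⟩ := exists_extension_of_bounded hX hd ht₀ hcon
    have : T' ∈ S := ⟨hle.trans hT'.le, ζ, hζ, fun t ht => by
      rw [hζγ (lt_of_lt_of_le ht hle), hγ₀' ht]⟩
    exact absurd (le_csSup hbdd this) (not_le.2 hT')
  · left
    intro t
    obtain ⟨T, hT, htT⟩ := not_bddAbove_iff.1 hbdd t
    exact hγd ⟨T, hT⟩ t htT

end AutonomousODE

/-! ### Monotonicity and integration of exponential bounds from `-∞` -/

section MonotoneOnHalfLine

variable {h h' : ℝ → ℝ} {T c : ℝ}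

lemma antitoneOn_Ioo_of_hasDerivAt {l : ℝ} (hd : ∀ t ∈ Ioo l T, HasDerivAt h (h' t) t)
    (hn : ∀ t ∈ Ioo l T, h' t ≤ 0) : AntitoneOn h (Ioo l T) := by
  refine antitoneOn_of_deriv_nonpos (convex_Ioo l T)
    (fun t ht => (hd t ht).continuousAt.continuousWithinAt) ?_ ?_
  · rw [interior_Ioo]
    exact fun t ht => (hd t ht).differentiableAt.differentiableWithinAt
  · rw [interior_Ioo]
    exact fun t ht => by rw [(hd t ht).deriv]; exact hn t ht

lemma antitoneOn_Iio_of_hasDerivAt (hd : ∀ t < T, HasDerivAt h (h' t) t)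
    (hn : ∀ t < T, h' t ≤ 0) : AntitoneOn h (Iio T) := by
  refine antitoneOn_of_deriv_nonpos (convex_Iio T)
    (fun t ht => (hd t ht).continuousAt.continuousWithinAt) ?_ ?_
  · rw [interior_Iio]
    exact fun t ht => (hd t ht).differentiableAt.differentiableWithinAt
  · rw [interior_Iio]
    exact fun t ht => by rw [(hd t ht).deriv]; exact hn t ht

lemma strictAntiOn_Iio_of_hasDerivAt (hd : ∀ t < T, HasDerivAt h (h' t) t)
    (hn : ∀ t < T, h' t < 0) : StrictAntiOn h (Iio T) := by
  refine strictAntiOn_of_deriv_neg (convex_Iio T)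
    (fun t ht => (hd t ht).continuousAt.continuousWithinAt) ?_
  rw [interior_Iio]
  exact fun t ht => by rw [(hd t ht).deriv]; exact hn t ht

lemma le_of_hasDerivAt_nonpos_of_tendsto (hd : ∀ t < T, HasDerivAt h (h' t) t)
    (hn : ∀ t < T, h' t ≤ 0) (hl : Tendsto h atBot (𝓝 c)) {t : ℝ} (ht : t < T) : h t ≤ c := by
  refine ge_of_tendsto hl ?_
  filter_upwards [eventually_le_atBot t] with s hs
  exact antitoneOn_Iio_of_hasDerivAt hd hn (hs.trans_lt ht) ht hs

lemma le_of_hasDerivAt_nonneg_of_tendsto (hd : ∀ t < T, HasDerivAt h (h' t) t)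
    (hn : ∀ t < T, 0 ≤ h' t) (hl : Tendsto h atBot (𝓝 c)) {t : ℝ} (ht : t < T) : c ≤ h t := by
  have := le_of_hasDerivAt_nonpos_of_tendsto (h := fun t => -h t) (h' := fun t => -h' t)
    (fun t ht => (hd t ht).neg) (fun t ht => neg_nonpos.2 (hn t ht)) hl.neg ht
  linarith

lemma eq_of_hasDerivAt_zero_of_tendsto (hd : ∀ t < T, HasDerivAt h (h' t) t)
    (hn : ∀ t < T, h' t = 0) (hl : Tendsto h atBot (𝓝 c)) {t : ℝ} (ht : t < T) : h t = c :=
  le_antisymm (le_of_hasDerivAt_nonpos_of_tendsto hd (fun t ht => (hn t ht).le) hl ht)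
    (le_of_hasDerivAt_nonneg_of_tendsto hd (fun t ht => (hn t ht).ge) hl ht)

/-- A bound `|h'| ≤ C e^{λ t}` integrates from `-∞`. -/
lemma abs_le_of_hasDerivAt_of_tendsto_zero {C l : ℝ} (hl : 0 < l)
    (hd : ∀ t < T, HasDerivAt h (h' t) t) (hb : ∀ t < T, |h' t| ≤ C * Real.exp (l * t))
    (h0 : Tendsto h atBot (𝓝 0)) {t : ℝ} (ht : t < T) : |h t| ≤ C / l * Real.exp (l * t) := by
  have he : ∀ t, HasDerivAt (fun t => C / l * Real.exp (l * t)) (C * Real.exp (l * t)) t := by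
    intro t
    refine ((((hasDerivAt_id t).const_mul l).exp).const_mul (C / l)).congr_deriv ?_
    simp only [id, mul_one]
    field_simp
  have hE : Tendsto (fun t => C / l * Real.exp (l * t)) atBot (𝓝 0) := by
    have : Tendsto (fun t : ℝ => Real.exp (l * t)) atBot (𝓝 0) :=
      Real.tendsto_exp_atBot.comp (tendsto_id.const_mul_atBot hl)
    simpa using this.const_mul (C / l)
  rw [abs_le]
  constructor
  · have := le_of_hasDerivAt_nonneg_of_tendsto (c := 0)
      (h := fun t => h t + C / l * Real.exp (l * t)) (fun t ht => (hd t ht).add (he t))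
      (fun t ht => by linarith [(abs_le.1 (hb t ht)).1]) (by simpa using h0.add hE) ht
    linarith
  · have := le_of_hasDerivAt_nonpos_of_tendsto (c := 0)
      (h := fun t => h t - C / l * Real.exp (l * t)) (fun t ht => (hd t ht).sub (he t))
      (fun t ht => by linarith [(abs_le.1 (hb t ht)).2]) (by simpa using h0.sub hE) ht
    linarith

lemma tendsto_exp_mul_atBot {l : ℝ} (hl : 0 < l) :
    Tendsto (fun t : ℝ => Real.exp (l * t)) atBot (𝓝 0) :=
  Real.tendsto_exp_atBot.comp (tendsto_id.const_mul_atBot hl)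

lemma isBigO_exp_of_hasDerivAt {l : ℝ} (hl : 0 < l) (hd : ∀ t < T, HasDerivAt h (h' t) t)
    (hb : h' =O[atBot] fun t => Real.exp (l * t)) (h0 : Tendsto h atBot (𝓝 0)) :
    h =O[atBot] fun t => Real.exp (l * t) := by
  obtain ⟨C, hC⟩ := hb.bound
  obtain ⟨S, hS⟩ := eventually_atBot.1 hC
  refine IsBigO.of_bound (C / l) ?_
  filter_upwards [eventually_lt_atBot (min S T)] with t ht
  have := abs_le_of_hasDerivAt_of_tendsto_zero (T := min S T) (C := C) hl
    (fun t ht => hd t (ht.trans_le (min_le_right _ _)))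
    (fun t ht => by simpa using hS t (ht.trans_le (min_le_left _ _)).le) h0 ht
  simpa using this

/-- A function whose derivative is `O(e^{λ t})` at `-∞` has a limit there. -/
lemma exists_tendsto_atBot_of_hasDerivAt {l : ℝ} (hl : 0 < l)
    (hd : ∀ t < T, HasDerivAt h (h' t) t) (hb : h' =O[atBot] fun t => Real.exp (l * t)) :
    ∃ c, Tendsto h atBot (𝓝 c) := by
  obtain ⟨C, hC⟩ := hb.bound
  obtain ⟨S, hS⟩ := eventually_atBot.1 hC
  set U := min S T with hU
  have he : ∀ t, HasDerivAt (fun t => C / l * Real.exp (l * t)) (C * Real.exp (l * t)) t := by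
    intro t
    refine ((((hasDerivAt_id t).const_mul l).exp).const_mul (C / l)).congr_deriv ?_
    simp only [id, mul_one]
    field_simp
  have hb' : ∀ t < U, |h' t| ≤ C * Real.exp (l * t) := fun t ht => by
    simpa using hS t (ht.trans_le (min_le_left _ _)).le
  have hd' : ∀ t < U, HasDerivAt h (h' t) t := fun t ht => hd t (ht.trans_le (min_le_right _ _))
  have hanti : AntitoneOn (fun t => h t - C / l * Real.exp (l * t)) (Iio U) :=
    antitoneOn_Iio_of_hasDerivAt (fun t ht => (hd' t ht).sub (he t))
      (fun t ht => by linarith [(abs_le.1 (hb' t ht)).2])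
  have hmono : AntitoneOn (fun t => -(h t + C / l * Real.exp (l * t))) (Iio U) :=
    antitoneOn_Iio_of_hasDerivAt (fun t ht => ((hd' t ht).add (he t)).neg)
      (fun t ht => by linarith [(abs_le.1 (hb' t ht)).1])
  obtain ⟨t₀, ht₀⟩ : ∃ t₀, t₀ < U := exists_lt U
  have hC0 : 0 ≤ C := by
    have := (abs_nonneg _).trans (hb' t₀ ht₀)
    exact nonneg_of_mul_nonneg_left this (Real.exp_pos _)
  -- Freezing the time at `t₀` makes the function antitone on the whole line, so that it has a limit
  -- at `-∞` as soon as it is bounded above.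
  set v : ℝ → ℝ := fun t => h (min t t₀) - C / l * Real.exp (l * min t t₀) with hv
  have hvanti : Antitone v := fun x y hxy => hanti ((min_le_right _ _).trans_lt ht₀)
    ((min_le_right _ _).trans_lt ht₀) (min_le_min_right _ hxy)
  have hvb : BddAbove (range v) := by
    refine ⟨h t₀ + C / l * Real.exp (l * t₀), ?_⟩
    rintro _ ⟨t, rfl⟩
    have h1 := hmono (show min t t₀ ∈ Iio U from (min_le_right _ _).trans_lt ht₀) ht₀
      (min_le_right _ _)
    have : 0 ≤ C / l * Real.exp (l * min t t₀) := by positivity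
    simp only [hv] at h1 ⊢
    linarith
  have hlim := tendsto_atBot_ciSup hvanti hvb
  refine ⟨(⨆ t, v t) + C / l * 0, ?_⟩
  have hE := (tendsto_exp_mul_atBot hl).const_mul (C / l)
  refine (hlim.add hE).congr' ?_
  filter_upwards [eventually_le_atBot t₀] with t ht
  simp [hv, min_eq_left ht]

end MonotoneOnHalfLine

/-! ### The first-order system and its monotone quantities -/

/-- `(f, p, r) = (f, f', f'')` solves `f''' + f f'' + α f'² = 0` on `(-∞, T)`. -/
structure IsTraj (α T : ℝ) (f p r : ℝ → ℝ) : Prop where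
  hf : ∀ t < T, HasDerivAt f (p t) t
  hp : ∀ t < T, HasDerivAt p (r t) t
  hr : ∀ t < T, HasDerivAt r (-(f t * r t) - α * p t ^ 2) t

/-- The vector field of the equation `f''' + f f'' + α f'² = 0`. -/
def trajField (α : ℝ) (x : ℝ × ℝ × ℝ) : ℝ × ℝ × ℝ :=
  (x.2.1, x.2.2, -(x.1 * x.2.2) - α * x.2.1 ^ 2)

lemma contDiff_trajField (α : ℝ) : ContDiff ℝ 1 (trajField α) := by
  unfold trajField
  fun_prop

namespace IsTraj

variable {α T : ℝ} {f p r f₂ p₂ r₂ : ℝ → ℝ}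

lemma hasDerivAt_prod (h : IsTraj α T f p r) {t : ℝ} (ht : t < T) :
    HasDerivAt (fun t => (f t, p t, r t)) (trajField α (f t, p t, r t)) t :=
  (h.hf t ht).prodMk ((h.hp t ht).prodMk (h.hr t ht))

lemma of_hasDerivAt {γ : ℝ → ℝ × ℝ × ℝ} (h : ∀ t < T, HasDerivAt γ (trajField α (γ t)) t) :
    IsTraj α T (fun t => (γ t).1) (fun t => (γ t).2.1) (fun t => (γ t).2.2) where
  hf t ht := (h t ht).fst
  hp t ht := (h t ht).snd.fst
  hr t ht := (h t ht).snd.snd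

lemma mono (h : IsTraj α T f p r) {T' : ℝ} (hT : T' ≤ T) : IsTraj α T' f p r where
  hf t ht := h.hf t (ht.trans_le hT)
  hp t ht := h.hp t (ht.trans_le hT)
  hr t ht := h.hr t (ht.trans_le hT)

lemma shift (h : IsTraj α T f p r) (s : ℝ) :
    IsTraj α (T - s) (fun t => f (t + s)) (fun t => p (t + s)) (fun t => r (t + s)) where
  hf t ht := (h.hf (t + s) (by linarith)).comp_add_const t s
  hp t ht := (h.hp (t + s) (by linarith)).comp_add_const t s
  hr t ht := (h.hr (t + s) (by linarith)).comp_add_const t s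

lemma scale (h : IsTraj α T f p r) {c : ℝ} (hc : 0 < c) :
    IsTraj α (T / c) (fun t => c * f (c * t)) (fun t => c ^ 2 * p (c * t))
      (fun t => c ^ 3 * r (c * t)) := by
  have hlt : ∀ t, t < T / c → c * t < T := fun t ht => by
    rw [lt_div_iff₀ hc] at ht
    linarith
  have hd : ∀ t, HasDerivAt (fun t => c * t) c t := fun t => by
    simpa using (hasDerivAt_id t).const_mul c
  refine ⟨fun t ht => ?_, fun t ht => ?_, fun t ht => ?_⟩
  · refine HasDerivAt.congr_deriv (((h.hf _ (hlt t ht)).comp t (hd t)).const_mul c) ?_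
    ring
  · refine HasDerivAt.congr_deriv (((h.hp _ (hlt t ht)).comp t (hd t)).const_mul (c ^ 2)) ?_
    ring
  · refine HasDerivAt.congr_deriv (((h.hr _ (hlt t ht)).comp t (hd t)).const_mul (c ^ 3)) ?_
    ring

lemma eqOn (h : IsTraj α T f p r) (h₂ : IsTraj α T f₂ p₂ r₂) {t₀ : ℝ} (ht₀ : t₀ < T)
    (e1 : f t₀ = f₂ t₀) (e2 : p t₀ = p₂ t₀) (e3 : r t₀ = r₂ t₀) {t : ℝ} (ht : t < T) :
    f t = f₂ t ∧ p t = p₂ t ∧ r t = r₂ t := by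
  have := eqOn_Iio_of_hasDerivAt (contDiff_trajField α) (fun t ht => h.hasDerivAt_prod ht)
    (fun t ht => h₂.hasDerivAt_prod ht) ht₀ (by simp [e1, e2, e3]) ht
  simpa using this

lemma exists_extension (h : IsTraj α T f p r) {t₀ B : ℝ} (ht₀ : t₀ < T)
    (hB : ∀ t, t₀ ≤ t → t < T → |f t| ≤ B ∧ |p t| ≤ B ∧ |r t| ≤ B) :
    ∃ T' > T, ∃ f₂ p₂ r₂ : ℝ → ℝ, IsTraj α T' f₂ p₂ r₂ ∧ EqOn f₂ f (Iio T) ∧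
      EqOn p₂ p (Iio T) ∧ EqOn r₂ r (Iio T) := by
  obtain ⟨T', hT', η, hη, hηe⟩ := exists_extension_of_bounded (contDiff_trajField α)
    (fun t ht => h.hasDerivAt_prod ht) ht₀ (B := B) (fun t h1 h2 => by
      obtain ⟨b1, b2, b3⟩ := hB t h1 h2
      simp [Prod.norm_def, b1, b2, b3])
  refine ⟨T', hT', _, _, _, of_hasDerivAt hη, ?_, ?_, ?_⟩ <;> intro t ht <;> simp [hηe ht]

lemma exists_maximal (h : IsTraj α T f p r) :
    ∃ f₂ p₂ r₂ : ℝ → ℝ, EqOn f₂ f (Iio T) ∧ EqOn p₂ p (Iio T) ∧ EqOn r₂ r (Iio T) ∧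
      ((∀ S, IsTraj α S f₂ p₂ r₂) ∨ ∃ S, T ≤ S ∧ IsTraj α S f₂ p₂ r₂ ∧
        ∀ B, ∀ t₀ < S, ∃ t, t₀ ≤ t ∧ t < S ∧ (B < |f₂ t| ∨ B < |p₂ t| ∨ B < |r₂ t|)) := by
  obtain ⟨η, hηe, hη⟩ := exists_maximal_extension (contDiff_trajField α)
    (fun t ht => h.hasDerivAt_prod ht)
  refine ⟨fun t => (η t).1, fun t => (η t).2.1, fun t => (η t).2.2, fun t ht => by simp [hηe ht],
    fun t ht => by simp [hηe ht], fun t ht => by simp [hηe ht], ?_⟩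
  rcases hη with hη | ⟨S, hTS, hη, hub⟩
  · exact Or.inl fun S => of_hasDerivAt fun t _ => hη t
  · refine Or.inr ⟨S, hTS, of_hasDerivAt hη, fun B t₀ ht₀ => ?_⟩
    obtain ⟨t, h1, h2, h3⟩ := hub B t₀ ht₀
    refine ⟨t, h1, h2, ?_⟩
    simpa [Prod.norm_def, lt_max_iff] using h3

lemma continuousAt (h : IsTraj α T f p r) {t : ℝ} (ht : t < T) :
    ContinuousAt f t ∧ ContinuousAt p t ∧ ContinuousAt r t :=
  ⟨(h.hf t ht).continuousAt, (h.hp t ht).continuousAt, (h.hr t ht).continuousAt⟩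

/-- The equation in divergence form. The sign of `1 - α` makes `E` monotone, and `E` is in turn the
derivative of `F = p + f² / 2`. -/
lemma hasDerivAt_E (h : IsTraj α T f p r) {t : ℝ} (ht : t < T) :
    HasDerivAt (fun t => r t + f t * p t) ((1 - α) * p t ^ 2) t := by
  refine HasDerivAt.congr_deriv ((h.hr t ht).add ((h.hf t ht).mul (h.hp t ht))) ?_
  ring

lemma hasDerivAt_F (h : IsTraj α T f p r) {t : ℝ} (ht : t < T) :
    HasDerivAt (fun t => p t + f t ^ 2 / 2) (r t + f t * p t) t := by
  refine HasDerivAt.congr_deriv ((h.hp t ht).add (((h.hf t ht).pow 2).div_const 2)) ?_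
  push_cast
  ring

/-- Multiplying the equation by `f` and integrating by parts leaves only a multiple of `f p²`, so
`G` is monotone wherever `f` has a sign and is conserved for `α = 2`. -/
lemma hasDerivAt_G (h : IsTraj α T f p r) {t : ℝ} (ht : t < T) :
    HasDerivAt (fun t => f t * r t - p t ^ 2 / 2 + f t ^ 2 * p t)
      ((2 - α) * f t * p t ^ 2) t := by
  refine HasDerivAt.congr_deriv ((((h.hf t ht).mul (h.hr t ht)).sub (((h.hp t ht).pow 2).div_const 2)).add
    (((h.hf t ht).pow 2).mul (h.hp t ht))) ?_
  push_cast
  simp only [Pi.pow_apply]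
  ring

lemma exists_antideriv (h : IsTraj α T f p r) :
    ∃ A : ℝ → ℝ, ∀ t < T, HasDerivAt A (f t) t := by
  obtain ⟨t₀, ht₀⟩ := exists_lt T
  have hcont : ContinuousOn f (Iio T) := fun t ht => (h.continuousAt ht).1.continuousWithinAt
  refine ⟨fun t => ∫ s in t₀..t, f s, fun t ht => ?_⟩
  have hsub : uIcc t₀ t ⊆ Iio T := fun x hx => hx.2.trans_lt (max_lt ht₀ ht)
  exact intervalIntegral.integral_hasDerivAt_right (hcont.mono hsub).intervalIntegrable
    (hcont.stronglyMeasurableAtFilter isOpen_Iio t ht) (h.continuousAt ht).1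

/-- With the integrating factor `exp (∫ f)` the signs of `E` and of `-α p²` control the monotonicity
of `p` and of `r` respectively; this is how signs of `p` and `r` are propagated in time. -/
lemma hasDerivAt_mul_exp (h : IsTraj α T f p r) {A : ℝ → ℝ} {t : ℝ} (ht : t < T)
    (hA : HasDerivAt A (f t) t) :
    HasDerivAt (fun t => p t * Real.exp (A t)) ((r t + f t * p t) * Real.exp (A t)) t ∧
    HasDerivAt (fun t => r t * Real.exp (A t)) (-(α * p t ^ 2 * Real.exp (A t))) t := by
  constructor
  · refine HasDerivAt.congr_deriv ((h.hp t ht).mul hA.exp) ?_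
    ring
  · refine HasDerivAt.congr_deriv ((h.hr t ht).mul hA.exp) ?_
    ring

end IsTraj

/-! ### Exponential approach to the equilibrium -/

/-- The state `(f, p, r)` approaches `(-a, 0, 0)` at `-∞` at the exponential rate `l`. -/
structure ExpDecay (a l : ℝ) (f p r : ℝ → ℝ) : Prop where
  pos : 0 < l
  hf : (fun t => f t + a) =O[atBot] fun t => Real.exp (l * t)
  hp : p =O[atBot] fun t => Real.exp (l * t)
  hr : r =O[atBot] fun t => Real.exp (l * t)

namespace ExpDecay

variable {a l : ℝ} {f p r : ℝ → ℝ}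

lemma tendsto_f (h : ExpDecay a l f p r) : Tendsto f atBot (𝓝 (-a)) := by
  have := (h.hf.trans_tendsto (tendsto_exp_mul_atBot h.pos)).sub_const a
  simpa using this

lemma tendsto_p (h : ExpDecay a l f p r) : Tendsto p atBot (𝓝 0) :=
  h.hp.trans_tendsto (tendsto_exp_mul_atBot h.pos)

lemma tendsto_r (h : ExpDecay a l f p r) : Tendsto r atBot (𝓝 0) :=
  h.hr.trans_tendsto (tendsto_exp_mul_atBot h.pos)

lemma tendsto_E (h : ExpDecay a l f p r) : Tendsto (fun t => r t + f t * p t) atBot (𝓝 0) := by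
  simpa using h.tendsto_r.add (h.tendsto_f.mul h.tendsto_p)

lemma tendsto_F (h : ExpDecay a l f p r) :
    Tendsto (fun t => p t + f t ^ 2 / 2) atBot (𝓝 (a ^ 2 / 2)) := by
  simpa using h.tendsto_p.add ((h.tendsto_f.pow 2).div_const 2)

lemma tendsto_G (h : ExpDecay a l f p r) :
    Tendsto (fun t => f t * r t - p t ^ 2 / 2 + f t ^ 2 * p t) atBot (𝓝 0) := by
  simpa using ((h.tendsto_f.mul h.tendsto_r).sub ((h.tendsto_p.pow 2).div_const 2)).add
    ((h.tendsto_f.pow 2).mul h.tendsto_p)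

lemma mono (h : ExpDecay a l f p r) {l' : ℝ} (hl' : 0 < l') (hle : l' ≤ l) :
    ExpDecay a l' f p r := by
  have hO : (fun t : ℝ => Real.exp (l * t)) =O[atBot] fun t => Real.exp (l' * t) := by
    refine IsBigO.of_bound 1 ?_
    filter_upwards [eventually_le_atBot 0] with t ht
    rw [Real.norm_of_nonneg (Real.exp_pos _).le, Real.norm_of_nonneg (Real.exp_pos _).le, one_mul]
    exact Real.exp_le_exp.2 (by nlinarith)
  exact ⟨hl', h.hf.trans hO, h.hp.trans hO, h.hr.trans hO⟩

lemma congr (h : ExpDecay a l f p r) {f₂ p₂ r₂ : ℝ → ℝ} (hf : f₂ =ᶠ[atBot] f)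
    (hp : p₂ =ᶠ[atBot] p) (hr : r₂ =ᶠ[atBot] r) : ExpDecay a l f₂ p₂ r₂ where
  pos := h.pos
  hf := h.hf.congr' (by filter_upwards [hf] with t ht; rw [ht]) EventuallyEq.rfl
  hp := h.hp.congr' hp.symm EventuallyEq.rfl
  hr := h.hr.congr' hr.symm EventuallyEq.rfl

lemma shift (h : ExpDecay a l f p r) (s : ℝ) :
    ExpDecay a l (fun t => f (t + s)) (fun t => p (t + s)) (fun t => r (t + s)) := by
  have hO : (fun t : ℝ => Real.exp (l * (t + s))) =O[atBot] fun t => Real.exp (l * t) := by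
    have : (fun t : ℝ => Real.exp (l * (t + s))) = fun t => Real.exp (l * s) * Real.exp (l * t) := by
      ext t
      rw [← Real.exp_add]
      ring_nf
    rw [this]
    exact (isBigO_refl _ _).const_mul_left _
  have ht : Tendsto (fun t : ℝ => t + s) atBot atBot := tendsto_atBot_add_const_right _ _ tendsto_id
  exact ⟨h.pos, (h.hf.comp_tendsto ht).trans hO, (h.hp.comp_tendsto ht).trans hO,
    (h.hr.comp_tendsto ht).trans hO⟩

end ExpDecay

/-! ### The Lyapunov series: convergence and the equation -/

noncomputable section

lemma lyapunovCoeff_one (a m : ℝ) : lyapunovCoeff a m 1 = 1 := by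
  rw [lyapunovCoeff]

/-- The recursion for the coefficients, as a sum over an antidiagonal. -/
lemma lyapunovCoeff_add_two {a m : ℝ} (ha : 0 < a) (n : ℕ) :
    a * ((n : ℝ) + 2) ^ 2 * ((n : ℝ) + 1) * lyapunovCoeff a m (n + 1 + 1) =
      ∑ ij ∈ Finset.HasAntidiagonal.antidiagonal n, ((ij.1 : ℝ) + 1) *
        ((m - 1) / m * ((ij.2 : ℝ) + 1) - ((ij.1 : ℝ) + 1)) *
        (lyapunovCoeff a m (ij.1 + 1) * lyapunovCoeff a m (ij.2 + 1)) := by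
  rw [Finset.Nat.sum_antidiagonal_eq_sum_range_succ_mk, Finset.sum_range, lyapunovCoeff]
  have h1 : ((n + 2 : ℕ) : ℝ) = (n : ℝ) + 2 := by push_cast; ring
  have hne : a * ((n : ℝ) + 2) ^ 2 * ((n : ℝ) + 1) ≠ 0 := by positivity
  rw [h1, show (n : ℝ) + 2 - 1 = n + 1 by ring, mul_div_cancel₀ _ hne]
  refine Finset.sum_congr rfl fun k _ => ?_
  have hk : (k : ℕ) ≤ n := Nat.lt_succ_iff.1 k.2
  have h2 : n + 1 - (k : ℕ) = n - k + 1 := by omega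
  rw [h2]
  push_cast [Nat.cast_sub hk]
  ring

/-- Strong induction: the recursion sums `n + 1` terms, each at most `2 (n + 2)² (3 / a)^n`, and the
divisor `a (n + 2)² (n + 1)` leaves `(2 / a) (3 / a)^n`. The larger base `3` is slack; with `e^{at}
< a / 4` it gives the geometric ratio `3 / 4`. -/
lemma abs_lyapunovCoeff_le {a m : ℝ} (ha : 0 < a) (hm : |(m - 1) / m| ≤ 2) (l : ℕ) :
    |lyapunovCoeff a m (l + 1)| ≤ (3 / a) ^ l := by
  induction l using Nat.strong_induction_on with
  | _ l ih =>
    rcases l with _ | n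
    · simp [lyapunovCoeff_one]
    · have hpos : 0 < a * ((n : ℝ) + 2) ^ 2 * ((n : ℝ) + 1) := by positivity
      have hrec := lyapunovCoeff_add_two (m := m) ha n
      have hb : |a * ((n : ℝ) + 2) ^ 2 * ((n : ℝ) + 1) * lyapunovCoeff a m (n + 1 + 1)| ≤
          ∑ _ij ∈ Finset.HasAntidiagonal.antidiagonal n, ((n : ℝ) + 2) * (2 * ((n : ℝ) + 2)) * (3 / a) ^ n := by
        rw [hrec]
        refine (Finset.abs_sum_le_sum_abs _ _).trans (Finset.sum_le_sum fun ij hij => ?_)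
        have hs : ij.1 + ij.2 = n := Finset.HasAntidiagonal.mem_antidiagonal.1 hij
        have hsR : (ij.1 : ℝ) + ij.2 = n := by exact_mod_cast hs
        have i0 : (0 : ℝ) ≤ ij.1 := Nat.cast_nonneg _
        have j0 : (0 : ℝ) ≤ ij.2 := Nat.cast_nonneg _
        have b1 := ih ij.1 (by omega)
        have b2 := ih ij.2 (by omega)
        rw [abs_mul, abs_mul, abs_mul]
        have c1 : |((ij.1 : ℝ) + 1)| ≤ (n : ℝ) + 2 := by
          rw [abs_of_nonneg (by positivity)]
          linarith
        have c2 : |(m - 1) / m * ((ij.2 : ℝ) + 1) - ((ij.1 : ℝ) + 1)| ≤ 2 * ((n : ℝ) + 2) := by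
          rw [abs_le] at hm ⊢
          constructor <;> nlinarith [hm.1, hm.2]
        have c3 : |lyapunovCoeff a m (ij.1 + 1)| * |lyapunovCoeff a m (ij.2 + 1)| ≤
            (3 / a) ^ n := by
          rw [← hs, pow_add]
          gcongr
        gcongr
      rw [Finset.sum_const, Finset.Nat.card_antidiagonal, abs_mul, abs_of_pos hpos, nsmul_eq_mul]
        at hb
      have h2 : |lyapunovCoeff a m (n + 1 + 1)| ≤ 2 / a * (3 / a) ^ n := by
        refine le_of_mul_le_mul_left (hb.trans (le_of_eq ?_)) hpos
        push_cast
        field_simp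
      refine h2.trans ?_
      rw [pow_succ, mul_comm ((3 / a) ^ n)]
      gcongr
      norm_num

/-- The `n`-th derivative, term by term, of the Lyapunov series with `d = 1`. -/
def lyapunovTerm (a m : ℝ) (n l : ℕ) (t : ℝ) : ℝ :=
  (((l : ℝ) + 1) * a) ^ n * lyapunovCoeff a m (l + 1) * Real.exp (((l : ℝ) + 1) * a * t)

/-- A majorant of the series. -/
def lyapunovMajorant (a : ℝ) (n l : ℕ) : ℝ := (((l : ℝ) + 1) * a) ^ n * (3 / 4) ^ l

lemma lyapunovMajorant_nonneg {a : ℝ} (ha : 0 < a) (n l : ℕ) : 0 ≤ lyapunovMajorant a n l := by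
  unfold lyapunovMajorant
  positivity

lemma summable_lyapunovMajorant (a : ℝ) (n : ℕ) : Summable (lyapunovMajorant a n) := by
  have h := (summable_nat_add_iff 1).2
    (summable_pow_mul_geometric_of_norm_lt_one (R := ℝ) n (r := 3 / 4) (by norm_num))
  refine (h.mul_left (a ^ n * (4 / 3))).congr fun l => ?_
  unfold lyapunovMajorant
  rw [mul_pow, pow_succ]
  push_cast
  ring

variable {a m : ℝ}

/-- The right end of a half-line on which the Lyapunov series with `d = 1` converges. -/
def lyapunovRadius (a : ℝ) : ℝ := Real.log (a / 4) / a

lemma exp_lt_of_lt_lyapunovRadius (ha : 0 < a) {t : ℝ} (ht : t < lyapunovRadius a) :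
    Real.exp (a * t) < a / 4 := by
  rw [lyapunovRadius, lt_div_iff₀ ha] at ht
  calc Real.exp (a * t) < Real.exp (Real.log (a / 4)) := Real.exp_lt_exp.2 (by linarith)
    _ = a / 4 := Real.exp_log (by positivity)

lemma abs_lyapunovTerm_le (ha : 0 < a) (hm : |(m - 1) / m| ≤ 2) {t : ℝ}
    (ht : t < lyapunovRadius a) (n l : ℕ) :
    |lyapunovTerm a m n l t| ≤ lyapunovMajorant a n l * Real.exp (a * t) := by
  have he := exp_lt_of_lt_lyapunovRadius ha ht
  have hexp : Real.exp (((l : ℝ) + 1) * a * t) = Real.exp (a * t) ^ l * Real.exp (a * t) := by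
    rw [← Real.exp_nat_mul, ← Real.exp_add]
    ring_nf
  unfold lyapunovTerm lyapunovMajorant
  rw [abs_mul, abs_mul, abs_of_nonneg (show 0 ≤ (((l : ℝ) + 1) * a) ^ n by positivity),
    Real.abs_exp, hexp, ← mul_assoc]
  have : |lyapunovCoeff a m (l + 1)| * Real.exp (a * t) ^ l ≤ (3 / 4) ^ l := by
    calc |lyapunovCoeff a m (l + 1)| * Real.exp (a * t) ^ l ≤ (3 / a) ^ l * (a / 4) ^ l := by
          gcongr
          exact abs_lyapunovCoeff_le ha hm l
      _ = (3 / 4) ^ l := by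
          rw [← mul_pow]
          congr 1
          field_simp
  have hp : 0 ≤ (((l : ℝ) + 1) * a) ^ n := by positivity
  rw [mul_assoc (_ ^ n) |_|]
  gcongr

lemma abs_lyapunovTerm_le_const (ha : 0 < a) (hm : |(m - 1) / m| ≤ 2) {t : ℝ}
    (ht : t < lyapunovRadius a) (n l : ℕ) :
    |lyapunovTerm a m n l t| ≤ lyapunovMajorant a n l * (a / 4) :=
  (abs_lyapunovTerm_le ha hm ht n l).trans
    (mul_le_mul_of_nonneg_left (exp_lt_of_lt_lyapunovRadius ha ht).le
      (lyapunovMajorant_nonneg ha n l))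

lemma summable_norm_lyapunovTerm (ha : 0 < a) (hm : |(m - 1) / m| ≤ 2) {t : ℝ}
    (ht : t < lyapunovRadius a) (n : ℕ) : Summable fun l => ‖lyapunovTerm a m n l t‖ :=
  Summable.of_nonneg_of_le (fun _ => norm_nonneg _)
    (fun l => abs_lyapunovTerm_le_const ha hm ht n l)
    ((summable_lyapunovMajorant a n).mul_right _)

/-- The `n`-th derivative of the Lyapunov series with `d = 1`. -/
def lyapunovSum (a m : ℝ) (n : ℕ) (t : ℝ) : ℝ := ∑' l, lyapunovTerm a m n l t

lemma hasSum_lyapunovSum (ha : 0 < a) (hm : |(m - 1) / m| ≤ 2) {t : ℝ}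
    (ht : t < lyapunovRadius a) (n : ℕ) :
    HasSum (fun l => lyapunovTerm a m n l t) (lyapunovSum a m n t) :=
  (summable_norm_lyapunovTerm ha hm ht n).of_norm.hasSum

lemma hasDerivAt_lyapunovSum (ha : 0 < a) (hm : |(m - 1) / m| ≤ 2) {t : ℝ}
    (ht : t < lyapunovRadius a) (n : ℕ) :
    HasDerivAt (lyapunovSum a m n) (lyapunovSum a m (n + 1) t) t := by
  refine hasDerivAt_tsum_of_isPreconnected
    (u := fun l => lyapunovMajorant a (n + 1) l * (a / 4))
    ((summable_lyapunovMajorant a (n + 1)).mul_right _) isOpen_Iio isPreconnected_Iio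
    (fun l s _ => ?_) (fun l s hs => abs_lyapunovTerm_le_const ha hm hs (n + 1) l) ht
    (summable_norm_lyapunovTerm ha hm ht n).of_norm ht
  unfold lyapunovTerm
  refine ((((hasDerivAt_id s).const_mul (((l : ℝ) + 1) * a)).exp).const_mul _).congr_deriv ?_
  simp only [id, mul_one]
  ring

/-- The tail from the second term on carries a factor `e^{2at}`, so the first term decides the sign
of the slope near `-∞`. -/
lemma abs_lyapunovSum_sub_le (ha : 0 < a) (hm : |(m - 1) / m| ≤ 2) (n : ℕ) :
    ∃ C, ∀ t < lyapunovRadius a,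
      |lyapunovSum a m n t - a ^ n * Real.exp (a * t)| ≤ C * Real.exp (2 * a * t) := by
  have hsum := ((summable_nat_add_iff 1).2 (summable_lyapunovMajorant a n)).mul_right (4 / a)
  refine ⟨∑' l, lyapunovMajorant a n (l + 1) * (4 / a), fun t ht => ?_⟩
  have h1 := (summable_norm_lyapunovTerm ha hm ht n).of_norm.tsum_eq_zero_add
  have h0 : lyapunovTerm a m n 0 t = a ^ n * Real.exp (a * t) := by
    simp [lyapunovTerm, lyapunovCoeff_one]
  rw [lyapunovSum, h1, h0, add_sub_cancel_left]
  rw [← tsum_mul_right]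
  refine tsum_of_norm_bounded (E := ℝ) ((hsum.mul_right _).hasSum) fun l => ?_
  have he := exp_lt_of_lt_lyapunovRadius ha ht
  have hexp : Real.exp ((((l + 1 : ℕ) : ℝ) + 1) * a * t) =
      Real.exp (a * t) ^ l * Real.exp (2 * a * t) := by
    rw [← Real.exp_nat_mul, ← Real.exp_add]
    push_cast
    ring_nf
  have hc : |lyapunovCoeff a m (l + 1 + 1)| * Real.exp (a * t) ^ l ≤ (3 / 4) ^ (l + 1) * (4 / a) := by
    calc |lyapunovCoeff a m (l + 1 + 1)| * Real.exp (a * t) ^ l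
        ≤ (3 / a) ^ (l + 1) * (a / 4) ^ l := by
          gcongr
          exact abs_lyapunovCoeff_le ha hm (l + 1)
      _ = (3 / 4) ^ (l + 1) * (4 / a) := by
          rw [div_pow, div_pow, div_pow, pow_succ a, pow_succ (4 : ℝ)]
          field_simp
  rw [Real.norm_eq_abs]
  unfold lyapunovTerm lyapunovMajorant
  rw [abs_mul, abs_mul, abs_of_nonneg (show 0 ≤ ((((l + 1 : ℕ) : ℝ) + 1) * a) ^ n by positivity),
    Real.abs_exp, hexp, ← mul_assoc, mul_assoc (_ ^ n) |_|,
    mul_assoc _ _ (4 / a)]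
  gcongr

/-- Cauchy products turn the equation into an identity between coefficients of `e^{(n+2)at}`, which
is the defining recursion. The coefficient of `e^{at}` drops out because `a³ - a · a² = 0`; this is
why `d` is free. -/
lemma lyapunovSum_ode (ha : 0 < a) (hm : |(m - 1) / m| ≤ 2) {t : ℝ} (ht : t < lyapunovRadius a) :
    lyapunovSum a m 3 t + (-a + lyapunovSum a m 0 t) * lyapunovSum a m 2 t
      - (m - 1) / m * lyapunovSum a m 1 t ^ 2 = 0 := by
  have s0 := summable_norm_lyapunovTerm ha hm ht 0
  have s1 := summable_norm_lyapunovTerm ha hm ht 1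
  have s2 := summable_norm_lyapunovTerm ha hm ht 2
  have s3 := summable_norm_lyapunovTerm ha hm ht 3
  have e1 : lyapunovSum a m 3 t - a * lyapunovSum a m 2 t =
      ∑' n : ℕ, (lyapunovTerm a m 3 (n + 1) t - a * lyapunovTerm a m 2 (n + 1) t) := by
    have hs := s3.of_norm.sub (s2.of_norm.mul_left a)
    have := hs.tsum_eq_zero_add
    rw [s3.of_norm.tsum_sub (s2.of_norm.mul_left a), tsum_mul_left] at this
    rw [lyapunovSum, lyapunovSum, this]
    have : lyapunovTerm a m 3 0 t - a * lyapunovTerm a m 2 0 t = 0 := by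
      unfold lyapunovTerm
      push_cast
      ring
    rw [this, zero_add]
  have e2 := tsum_mul_tsum_eq_tsum_sum_antidiagonal_of_summable_norm s2 s0
  have e3 := tsum_mul_tsum_eq_tsum_sum_antidiagonal_of_summable_norm s1 s1
  have h2 := summable_norm_sum_mul_antidiagonal_of_summable_norm s2 s0
  have h3 := summable_norm_sum_mul_antidiagonal_of_summable_norm s1 s1
  have e4 : lyapunovSum a m 3 t - a * lyapunovSum a m 2 t =
      (m - 1) / m * lyapunovSum a m 1 t ^ 2 - lyapunovSum a m 2 t * lyapunovSum a m 0 t := by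
    rw [e1, pow_two]
    unfold lyapunovSum
    rw [e2, e3, ← tsum_mul_left, ← (h3.of_norm.mul_left _).tsum_sub h2.of_norm]
    refine tsum_congr fun n => ?_
    have hrec := lyapunovCoeff_add_two (m := m) ha n
    rw [Finset.mul_sum, ← Finset.sum_sub_distrib]
    have hexp : ∀ ij ∈ Finset.HasAntidiagonal.antidiagonal n, Real.exp (((ij.1 : ℝ) + 1) * a * t) *
        Real.exp (((ij.2 : ℝ) + 1) * a * t) = Real.exp (((n : ℝ) + 2) * a * t) := by
      intro ij hij
      have hs : (ij.1 : ℝ) + ij.2 = n := by exact_mod_cast Finset.HasAntidiagonal.mem_antidiagonal.1 hij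
      rw [← Real.exp_add, ← hs]
      ring_nf
    calc lyapunovTerm a m 3 (n + 1) t - a * lyapunovTerm a m 2 (n + 1) t
        = a ^ 2 * (a * ((n : ℝ) + 2) ^ 2 * ((n : ℝ) + 1) * lyapunovCoeff a m (n + 1 + 1)) *
          Real.exp (((n : ℝ) + 2) * a * t) := by
          unfold lyapunovTerm
          push_cast
          rw [show (n : ℝ) + 1 + 1 = n + 2 by ring]
          ring
      _ = _ := by
          rw [hrec, Finset.mul_sum, Finset.sum_mul]
          refine Finset.sum_congr rfl fun ij hij => ?_
          rw [← hexp ij hij]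
          unfold lyapunovTerm
          ring
  linarith

/-- The Lyapunov series with `d = 1` is a trajectory near `-∞`. -/
lemma isTraj_lyapunovSum (ha : 0 < a) (hm : |(m - 1) / m| ≤ 2) :
    IsTraj (-((m - 1) / m)) (lyapunovRadius a) (fun t => -a + lyapunovSum a m 0 t)
      (lyapunovSum a m 1) (lyapunovSum a m 2) where
  hf t ht := (hasDerivAt_lyapunovSum ha hm ht 0).const_add _
  hp t ht := hasDerivAt_lyapunovSum ha hm ht 1
  hr t ht := (hasDerivAt_lyapunovSum ha hm ht 2).congr_deriv
    (by linarith [lyapunovSum_ode ha hm ht])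

lemma isBigO_lyapunovSum (ha : 0 < a) (hm : |(m - 1) / m| ≤ 2) (n : ℕ) :
    lyapunovSum a m n =O[atBot] fun t => Real.exp (a * t) := by
  refine IsBigO.of_bound (∑' l, lyapunovMajorant a n l) ?_
  filter_upwards [eventually_lt_atBot (lyapunovRadius a)] with t ht
  rw [Real.norm_of_nonneg (Real.exp_pos (a * t)).le, ← tsum_mul_right]
  exact tsum_of_norm_bounded (((summable_lyapunovMajorant a n).mul_right _).hasSum)
    fun l => abs_lyapunovTerm_le ha hm ht n l

lemma expDecay_lyapunovSum (ha : 0 < a) (hm : |(m - 1) / m| ≤ 2) :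
    ExpDecay a a (fun t => -a + lyapunovSum a m 0 t) (lyapunovSum a m 1) (lyapunovSum a m 2) where
  pos := ha
  hf := by simpa using isBigO_lyapunovSum ha hm 0
  hp := isBigO_lyapunovSum ha hm 1
  hr := isBigO_lyapunovSum ha hm 2

lemma eventually_lyapunovSum_one_pos (ha : 0 < a) (hm : |(m - 1) / m| ≤ 2) :
    ∀ᶠ t in atBot, 0 < lyapunovSum a m 1 t := by
  obtain ⟨C, hC⟩ := abs_lyapunovSum_sub_le ha hm 1
  have hlim : Tendsto (fun t => C * Real.exp (a * t)) atBot (𝓝 0) := by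
    simpa using (tendsto_exp_mul_atBot ha).const_mul C
  filter_upwards [eventually_lt_atBot (lyapunovRadius a), hlim.eventually_lt_const ha] with t ht h
  have h1 := (abs_le.1 (hC t ht)).1
  have h2 : Real.exp (2 * a * t) = Real.exp (a * t) * Real.exp (a * t) := by
    rw [← Real.exp_add]
    ring_nf
  have := Real.exp_pos (a * t)
  rw [h2] at h1
  nlinarith

end

/-! ### Uniqueness at `-∞` for a given leading coefficient -/

namespace IsTraj

variable {α T a l : ℝ} {f p r f₂ p₂ r₂ : ℝ → ℝ}

/-- The derivative of `E` is quadratic in `p`, so integrating twice from `-∞` doubles the decay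
rate. This improvement is what makes `e^{-at} (f + a)` converge. -/
lemma isBigO_F (h : IsTraj α T f p r) (hd : ExpDecay a l f p r) :
    (fun t => p t + f t ^ 2 / 2 - a ^ 2 / 2) =O[atBot] fun t => Real.exp (2 * l * t) := by
  have hl := hd.pos
  have hp2 : (fun t => (1 - α) * p t ^ 2) =O[atBot] fun t => Real.exp (2 * l * t) := by
    have := (hd.hp.mul hd.hp).const_mul_left (1 - α)
    refine this.congr (fun t => by ring) (fun t => ?_)
    rw [← Real.exp_add]
    ring_nf
  have hE := isBigO_exp_of_hasDerivAt (T := T) (by linarith) (fun t ht => h.hasDerivAt_E ht) hp2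
    hd.tendsto_E
  exact isBigO_exp_of_hasDerivAt (T := T) (by linarith)
    (fun t ht => (h.hasDerivAt_F ht).sub_const _) hE (sub_self (a ^ 2 / 2) ▸ hd.tendsto_F.sub_const (a ^ 2 / 2))

/-- With `g = f + a` one has `g' = a g + (F - a²/2) - g²/2`; the exponential weight removes the
linear term and only fast decaying ones remain. -/
lemma hasDerivAt_exp_neg_mul (h : IsTraj α T f p r) (a : ℝ) {t : ℝ} (ht : t < T) :
    HasDerivAt (fun t => Real.exp (-a * t) * (f t + a))
      (Real.exp (-a * t) * (p t + f t ^ 2 / 2 - a ^ 2 / 2 - (f t + a) ^ 2 / 2)) t := by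
  refine ((((hasDerivAt_id t).const_mul (-a)).exp).mul ((h.hf t ht).add_const a)).congr_deriv ?_
  simp only [id, mul_one]
  ring

/-- The leading coefficient of `f + a` at `-∞`. -/
lemma exists_tendsto_exp_neg_mul (h : IsTraj α T f p r) (hd : ExpDecay a l f p r)
    (hl : a < 2 * l) :
    ∃ d, Tendsto (fun t => Real.exp (-a * t) * (f t + a)) atBot (𝓝 d) := by
  refine exists_tendsto_atBot_of_hasDerivAt (l := 2 * l - a) (by linarith)
    (fun t ht => h.hasDerivAt_exp_neg_mul a ht) ?_
  have hg : (fun t => (f t + a) ^ 2 / 2) =O[atBot] fun t => Real.exp (2 * l * t) := by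
    have := (hd.hf.mul hd.hf).const_mul_left (1 / 2)
    refine this.congr (fun t => by ring) (fun t => ?_)
    rw [← Real.exp_add]
    ring_nf
  refine ((isBigO_refl (fun t => Real.exp (-a * t)) atBot).mul
    ((h.isBigO_F hd).sub hg)).congr (fun t => rfl) (fun t => ?_)
  rw [← Real.exp_add]
  ring_nf

/-- One step of the contraction that proves uniqueness at `-∞`. -/
lemma contraction_estimate (h : IsTraj α T f p r) (h₂ : IsTraj α T f₂ p₂ r₂) (ha : 0 < a) {C : ℝ}
    (hC : 0 ≤ C) (hT : T ≤ 0)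
    (b1 : ∀ t < T, |f t + a| ≤ C * Real.exp (a / 2 * t) ∧ |p t| ≤ C * Real.exp (a / 2 * t))
    (b2 : ∀ t < T, |f₂ t + a| ≤ C * Real.exp (a / 2 * t) ∧ |p₂ t| ≤ C * Real.exp (a / 2 * t))
    (l1 : Tendsto (fun t => Real.exp (-a * t) * (f t - f₂ t)) atBot (𝓝 0))
    (l2 : Tendsto (fun t => (r t + f t * p t) - (r₂ t + f₂ t * p₂ t)) atBot (𝓝 0))
    (l3 : Tendsto (fun t => (p t + f t ^ 2 / 2) - (p₂ t + f₂ t ^ 2 / 2)) atBot (𝓝 0))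
    {K : ℝ} (_hK : 0 ≤ K)
    (k1 : ∀ t < T, |f t - f₂ t| ≤ K * Real.exp (a * t))
    (k2 : ∀ t < T, |(p t + f t ^ 2 / 2) - (p₂ t + f₂ t ^ 2 / 2)| ≤ K * Real.exp (a * t))
    (t : ℝ) (ht : t < T) :
    |(p t + f t ^ 2 / 2) - (p₂ t + f₂ t ^ 2 / 2)| ≤
      |1 - α| * (2 * C) * (a + C + 1) / (a * 3 / 2) / (a * 3 / 2) *
        Real.exp (a / 2 * t) * K * Real.exp (a * t) ∧
    |f t - f₂ t| ≤ (|1 - α| * (2 * C) * (a + C + 1) / (a * 3 / 2) / (a * 3 / 2) + C) / (a / 2) *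
        Real.exp (a / 2 * t) * K * Real.exp (a * t) := by
  set C₁ := |1 - α| * (2 * C) * (a + C + 1) with hC₁
  have hC₁0 : 0 ≤ C₁ := by positivity
  have hee : ∀ t, Real.exp (a / 2 * t) * Real.exp (a * t) = Real.exp (a * 3 / 2 * t) := fun t => by
    rw [← Real.exp_add]
    ring_nf
  have hsum : ∀ t < T, |(f t + a) + (f₂ t + a)| / 2 ≤ C * Real.exp (a / 2 * t) := fun t ht => by
    have := abs_add_le (f t + a) (f₂ t + a)
    linarith [(b1 t ht).1, (b2 t ht).1]
  -- The difference of slopes is recovered from the differences of `f` and of `F = p + f²/2`, so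
  -- these two are the only unknowns of the iteration.
  have hdp : ∀ t < T, |p t - p₂ t| ≤ (a + C + 1) * K * Real.exp (a * t) := by
    intro t ht
    have he1 : Real.exp (a / 2 * t) ≤ 1 := Real.exp_le_one_iff.2 (by nlinarith)
    have hid : p t - p₂ t = a * (f t - f₂ t) - ((f t + a) + (f₂ t + a)) / 2 * (f t - f₂ t)
        + ((p t + f t ^ 2 / 2) - (p₂ t + f₂ t ^ 2 / 2)) := by ring
    rw [hid]
    have h1 : |a * (f t - f₂ t)| ≤ a * (K * Real.exp (a * t)) := by
      rw [abs_mul, abs_of_pos ha]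
      exact mul_le_mul_of_nonneg_left (k1 t ht) ha.le
    have h2 : |((f t + a) + (f₂ t + a)) / 2 * (f t - f₂ t)| ≤ C * (K * Real.exp (a * t)) := by
      rw [abs_mul, abs_div, abs_of_pos (two_pos : (0 : ℝ) < 2)]
      refine mul_le_mul ((hsum t ht).trans ?_) (k1 t ht) (abs_nonneg _) hC
      nlinarith
    have h3 := k2 t ht
    calc _ ≤ |a * (f t - f₂ t)| + |((f t + a) + (f₂ t + a)) / 2 * (f t - f₂ t)|
          + |(p t + f t ^ 2 / 2) - (p₂ t + f₂ t ^ 2 / 2)| :=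
          (abs_add_le _ _).trans (add_le_add (abs_sub _ _) le_rfl)
      _ ≤ _ := by nlinarith
  -- The difference `p² - p₂²` gains the factor `p + p₂ = O(e^{at/2})` over `p - p₂`; integration
  -- gives the gain to `E` and then to `F`.
  have hE : ∀ t < T, |(r t + f t * p t) - (r₂ t + f₂ t * p₂ t)| ≤
      C₁ * K / (a * 3 / 2) * Real.exp (a * 3 / 2 * t) := by
    intro t ht
    refine abs_le_of_hasDerivAt_of_tendsto_zero (by positivity)
      (fun t ht => (h.hasDerivAt_E ht).sub (h₂.hasDerivAt_E ht)) (fun t ht => ?_) l2 ht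
    have hid : (1 - α) * p t ^ 2 - (1 - α) * p₂ t ^ 2 = (1 - α) * (p t + p₂ t) * (p t - p₂ t) := by
      ring
    rw [hid, abs_mul, abs_mul, ← hee]
    have h1 : |p t + p₂ t| ≤ 2 * C * Real.exp (a / 2 * t) := by
      have := abs_add_le (p t) (p₂ t)
      linarith [(b1 t ht).2, (b2 t ht).2]
    calc |1 - α| * |p t + p₂ t| * |p t - p₂ t|
        ≤ |1 - α| * (2 * C * Real.exp (a / 2 * t)) * ((a + C + 1) * K * Real.exp (a * t)) := by
          gcongr
          exact hdp t ht
      _ = _ := by rw [hC₁]; ring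
  have hF : ∀ t < T, |(p t + f t ^ 2 / 2) - (p₂ t + f₂ t ^ 2 / 2)| ≤
      C₁ * K / (a * 3 / 2) / (a * 3 / 2) * Real.exp (a * 3 / 2 * t) := by
    intro t ht
    exact abs_le_of_hasDerivAt_of_tendsto_zero (by positivity)
      (fun t ht => (h.hasDerivAt_F ht).sub (h₂.hasDerivAt_F ht)) hE l3 ht
  refine ⟨(hF t ht).trans (le_of_eq ?_), ?_⟩
  · rw [← hee]
    ring
  -- The weighted difference starts from the limit `0` because both leading coefficients agree; the
  -- equality of the `d`'s enters only here.
  · have hδ : |Real.exp (-a * t) * (f t - f₂ t)| ≤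
        (C₁ * K / (a * 3 / 2) / (a * 3 / 2) + C * K) / (a / 2) * Real.exp (a / 2 * t) := by
      refine abs_le_of_hasDerivAt_of_tendsto_zero (by positivity)
        (h' := fun t => Real.exp (-a * t) * ((p t + f t ^ 2 / 2) - (p₂ t + f₂ t ^ 2 / 2)
          - ((f t + a) + (f₂ t + a)) / 2 * (f t - f₂ t)))
        (fun t ht => ?_) (fun t ht => ?_) l1 ht
      · have := (h.hasDerivAt_exp_neg_mul a ht).sub (h₂.hasDerivAt_exp_neg_mul a ht)
        refine (this.congr_deriv ?_).congr_of_eventuallyEq (Eventually.of_forall fun s => ?_)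
        · ring
        · simp only [Pi.sub_apply]
          ring
      · have hneg : Real.exp (-a * t) * Real.exp (a * t) = 1 := by
          rw [← Real.exp_add]
          simp
        have h1 := hF t ht
        have h2 : |((f t + a) + (f₂ t + a)) / 2 * (f t - f₂ t)| ≤
            C * K * Real.exp (a * 3 / 2 * t) := by
          rw [abs_mul, abs_div, abs_of_pos (two_pos : (0 : ℝ) < 2), ← hee]
          calc _ ≤ C * Real.exp (a / 2 * t) * (K * Real.exp (a * t)) :=
                mul_le_mul (hsum t ht) (k1 t ht) (abs_nonneg _) (by positivity)
            _ = _ := by ring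
        rw [abs_mul, Real.abs_exp]
        calc _ ≤ Real.exp (-a * t) * (C₁ * K / (a * 3 / 2) / (a * 3 / 2)
              * Real.exp (a * 3 / 2 * t) + C * K * Real.exp (a * 3 / 2 * t)) := by
              gcongr
              exact (abs_sub _ _).trans (add_le_add h1 h2)
          _ = (C₁ * K / (a * 3 / 2) / (a * 3 / 2) + C * K) * Real.exp (a / 2 * t) *
              (Real.exp (-a * t) * Real.exp (a * t)) := by
              rw [← hee]
              ring
          _ = _ := by rw [hneg, mul_one]
    rw [abs_mul, Real.abs_exp] at hδ
    have hneg : Real.exp (a * t) * Real.exp (-a * t) = 1 := by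
      rw [← Real.exp_add]
      simp
    calc |f t - f₂ t| = Real.exp (a * t) * (Real.exp (-a * t) * |f t - f₂ t|) := by
          rw [← mul_assoc, hneg, one_mul]
      _ ≤ Real.exp (a * t) * ((C₁ * K / (a * 3 / 2) / (a * 3 / 2) + C * K) / (a / 2) *
          Real.exp (a / 2 * t)) := by gcongr
      _ = _ := by ring

/-- Trajectories that tend to `(-a, 0, 0)` fast enough are determined by the leading coefficient
of `f + a`. -/
lemma eq_of_tendsto_exp_neg_mul (h : IsTraj α T f p r) (h₂ : IsTraj α T f₂ p₂ r₂) (ha : 0 < a)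
    (hd : ExpDecay a l f p r) (hd₂ : ExpDecay a l f₂ p₂ r₂) (hl : a < 2 * l) {d : ℝ}
    (l1 : Tendsto (fun t => Real.exp (-a * t) * (f t + a)) atBot (𝓝 d))
    (l2 : Tendsto (fun t => Real.exp (-a * t) * (f₂ t + a)) atBot (𝓝 d)) {t : ℝ} (ht : t < T) :
    f t = f₂ t ∧ p t = p₂ t ∧ r t = r₂ t := by
  have hda := hd.mono (half_pos ha) (by linarith)
  have hda₂ := hd₂.mono (half_pos ha) (by linarith)
  obtain ⟨c1, hc1⟩ := hda.hf.bound
  obtain ⟨c2, hc2⟩ := hda.hp.bound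
  obtain ⟨c3, hc3⟩ := hda₂.hf.bound
  obtain ⟨c4, hc4⟩ := hda₂.hp.bound
  set C := max 0 (max (max c1 c2) (max c3 c4)) with hC
  have hC0 : 0 ≤ C := le_max_left _ _
  have m1 : c1 ≤ C := le_trans (le_trans (le_max_left _ _) (le_max_left _ _)) (le_max_right _ _)
  have m2 : c2 ≤ C := le_trans (le_trans (le_max_right _ _) (le_max_left _ _)) (le_max_right _ _)
  have m3 : c3 ≤ C := le_trans (le_trans (le_max_left _ _) (le_max_right _ _)) (le_max_right _ _)
  have m4 : c4 ≤ C := le_trans (le_trans (le_max_right _ _) (le_max_right _ _)) (le_max_right _ _)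
  set Q := |1 - α| * (2 * C) * (a + C + 1) / (a * 3 / 2) / (a * 3 / 2) with hQ
  have hQ0 : 0 ≤ Q := by positivity
  set Q' := Q + (Q + C) / (a / 2) with hQ'
  have hQ'0 : 0 ≤ (Q + C) / (a / 2) := by positivity
  -- Far enough to the left each step of the iteration halves the bound `K`, so the differences
  -- vanish there and uniqueness for the system carries this up to `T`.
  have hsmall : ∀ᶠ t in atBot, Q' * Real.exp (a / 2 * t) < 1 / 2 := by
    have := (tendsto_exp_mul_atBot (half_pos ha)).const_mul Q'
    rw [mul_zero] at this
    exact this.eventually_lt_const (by norm_num)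
  have l0 : Tendsto (fun t => Real.exp (-a * t) * (f t - f₂ t)) atBot (𝓝 0) := by
    have := l1.sub l2
    rw [sub_self] at this
    refine this.congr fun t => by ring
  have hδ : ∀ᶠ t in atBot, |Real.exp (-a * t) * (f t - f₂ t)| < 1 := by
    have := l0.abs
    rw [abs_zero] at this
    exact this.eventually_lt_const one_pos
  have hFO : (fun t => (p t + f t ^ 2 / 2) - (p₂ t + f₂ t ^ 2 / 2)) =O[atBot]
      fun t => Real.exp (2 * l * t) :=
    ((h.isBigO_F hd).sub (h₂.isBigO_F hd₂)).congr_left fun t => by ring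
  obtain ⟨c5, hc5⟩ := hFO.bound
  obtain ⟨S, hS⟩ := eventually_atBot.1 ((((hc1.and hc2).and (hc3.and hc4)).and
    (hsmall.and hδ)).and (hc5.and (eventually_lt_atBot (min 0 T))))
  have hST : S < min 0 T := (hS S le_rfl).2.2
  have hS0 : S ≤ 0 := hST.le.trans (min_le_left _ _)
  have hST' : S < T := hST.trans_le (min_le_right _ _)
  have g := h.mono hST'.le
  have g₂ := h₂.mono hST'.le
  set K := max 1 c5 with hK
  have key : ∀ n : ℕ, ∀ t < S, |f t - f₂ t| ≤ K * (1 / 2) ^ n * Real.exp (a * t) ∧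
      |(p t + f t ^ 2 / 2) - (p₂ t + f₂ t ^ 2 / 2)| ≤ K * (1 / 2) ^ n * Real.exp (a * t) := by
    intro n
    induction n with
    | zero =>
      intro t ht
      obtain ⟨⟨-, -, hδt⟩, h5, -⟩ := hS t ht.le
      rw [pow_zero, mul_one]
      constructor
      · rw [abs_mul, Real.abs_exp] at hδt
        have hneg : Real.exp (a * t) * Real.exp (-a * t) = 1 := by
          rw [← Real.exp_add]
          simp
        have : |f t - f₂ t| = Real.exp (a * t) * (Real.exp (-a * t) * |f t - f₂ t|) := by
          rw [← mul_assoc, hneg, one_mul]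
        rw [this, mul_comm K]
        gcongr
        exact hδt.le.trans (le_max_left _ _)
      · rw [Real.norm_eq_abs, Real.norm_of_nonneg (Real.exp_pos _).le] at h5
        refine h5.trans (mul_le_mul (le_max_right _ _) ?_ (Real.exp_pos _).le (by positivity))
        exact Real.exp_le_exp.2 (by nlinarith)
    | succ n ih =>
      intro t ht
      have hst := g.contraction_estimate g₂ ha hC0 hS0 (fun t ht => ?_) (fun t ht => ?_) l0
        (by simpa using hd.tendsto_E.sub hd₂.tendsto_E)
        (by simpa using hd.tendsto_F.sub hd₂.tendsto_F)
        (K := K * (1 / 2) ^ n) (by positivity) (fun t ht => (ih t ht).1) (fun t ht => (ih t ht).2)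
        t ht
      · obtain ⟨⟨-, hsm, -⟩, -⟩ := hS t ht.le
        rw [← hQ] at hst
        have he := Real.exp_pos (a / 2 * t)
        have hKn : 0 ≤ K * (1 / 2) ^ n := by positivity
        have he' := Real.exp_pos (a * t)
        rw [pow_succ]
        constructor
        · refine hst.2.trans ?_
          have : (Q + C) / (a / 2) * Real.exp (a / 2 * t) ≤ 1 / 2 := by nlinarith
          calc _ ≤ 1 / 2 * (K * (1 / 2) ^ n) * Real.exp (a * t) := by gcongr
            _ = _ := by ring
        · refine hst.1.trans ?_
          have : Q * Real.exp (a / 2 * t) ≤ 1 / 2 := by nlinarith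
          calc _ ≤ 1 / 2 * (K * (1 / 2) ^ n) * Real.exp (a * t) := by gcongr
            _ = _ := by ring
      · obtain ⟨⟨⟨⟨h1, h2⟩, -⟩, -⟩, -⟩ := hS t ht.le
        rw [Real.norm_eq_abs, Real.norm_of_nonneg (Real.exp_pos _).le] at h1 h2
        exact ⟨h1.trans (by gcongr), h2.trans (by gcongr)⟩
      · obtain ⟨⟨⟨-, h1, h2⟩, -⟩, -⟩ := hS t ht.le
        rw [Real.norm_eq_abs, Real.norm_of_nonneg (Real.exp_pos _).le] at h1 h2
        exact ⟨h1.trans (by gcongr), h2.trans (by gcongr)⟩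
  have hfe : EqOn f f₂ (Iio S) := by
    intro t ht
    have hlim : Tendsto (fun n : ℕ => K * (1 / 2) ^ n * Real.exp (a * t)) atTop (𝓝 0) := by
      simpa using ((tendsto_pow_atTop_nhds_zero_of_lt_one (r := (1 / 2 : ℝ)) (by norm_num)
        (by norm_num)).const_mul K).mul_const (Real.exp (a * t))
    have := ge_of_tendsto' hlim fun n => (key n t ht).1
    exact sub_eq_zero.1 (abs_nonpos_iff.1 this)
  have hpe : EqOn p p₂ (Iio S) := fun t ht =>
    (g.hf t ht).unique ((g₂.hf t ht).congr_of_eventuallyEq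
      (eventuallyEq_of_mem (Iio_mem_nhds ht) hfe))
  have hre : EqOn r r₂ (Iio S) := fun t ht =>
    (g.hp t ht).unique ((g₂.hp t ht).congr_of_eventuallyEq
      (eventuallyEq_of_mem (Iio_mem_nhds ht) hpe))
  obtain ⟨t₀, ht₀⟩ := exists_lt S
  exact h.eqOn h₂ (ht₀.trans hST') (hfe ht₀) (hpe ht₀) (hre ht₀) ht

end IsTraj

/-! ### Signs, bounds and continuation of decaying trajectories -/

/-- The first zero of a continuous function that changes from negative to nonnegative. -/
lemma exists_first_zero {h : ℝ → ℝ} {t₀ t₁ : ℝ} (hle : t₀ ≤ t₁) (hc : ContinuousOn h (Icc t₀ t₁))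
    (h0 : h t₀ < 0) (h1 : 0 ≤ h t₁) :
    ∃ s, t₀ < s ∧ s ≤ t₁ ∧ h s = 0 ∧ ∀ t, t₀ ≤ t → t < s → h t < 0 := by
  have hcl : IsCompact (Icc t₀ t₁ ∩ h ⁻¹' Ici 0) :=
    isCompact_Icc.of_isClosed_subset (hc.preimage_isClosed_of_isClosed isClosed_Icc isClosed_Ici)
      inter_subset_left
  obtain ⟨s, ⟨hs, hs0⟩, hmin⟩ := hcl.exists_isLeast ⟨t₁, ⟨hle, le_rfl⟩, h1⟩
  have hneg : ∀ t, t₀ ≤ t → t < s → h t < 0 := by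
    intro t ht hts
    by_contra! hcon
    exact absurd (hmin ⟨⟨ht, hts.le.trans hs.2⟩, hcon⟩) (not_le.2 hts)
  have hlt : t₀ < s := lt_of_le_of_ne hs.1 fun e => by
    rw [← e] at hs0
    exact absurd h0 (not_lt.2 hs0)
  refine ⟨s, hlt, hs.2, le_antisymm ?_ hs0, hneg⟩
  by_contra! hcon
  obtain ⟨c, ⟨hc1, hc2⟩, hc3⟩ := intermediate_value_Ioo hs.1
    (hc.mono (Icc_subset_Icc_right hs.2)) (show h s / 2 ∈ Ioo (h t₀) (h s) from
      ⟨by linarith, by linarith⟩)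
  linarith [hneg c hc1.le hc2]

namespace IsTraj

variable {α T a l : ℝ} {f p r : ℝ → ℝ}

lemma E_antitone (h : IsTraj α T f p r) (hα : 1 ≤ α) :
    AntitoneOn (fun t => r t + f t * p t) (Iio T) :=
  antitoneOn_Iio_of_hasDerivAt (fun _ ht => h.hasDerivAt_E ht)
    (fun t _ => mul_nonpos_of_nonpos_of_nonneg (by linarith) (sq_nonneg (p t)))

lemma E_nonpos (h : IsTraj α T f p r) (hd : ExpDecay a l f p r) (hα : 1 ≤ α) {t : ℝ} (ht : t < T) :
    r t + f t * p t ≤ 0 :=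
  le_of_hasDerivAt_nonpos_of_tendsto (fun _ ht => h.hasDerivAt_E ht)
    (fun t _ => mul_nonpos_of_nonpos_of_nonneg (by linarith) (sq_nonneg (p t))) hd.tendsto_E ht

/-- For `α ≥ 1`, `E` decreases from `0`, so `F` decreases from `a² / 2`. -/
lemma p_le (h : IsTraj α T f p r) (hd : ExpDecay a l f p r) (hα : 1 ≤ α) {t : ℝ} (ht : t < T) :
    p t ≤ (a ^ 2 - f t ^ 2) / 2 := by
  have := le_of_hasDerivAt_nonpos_of_tendsto (fun _ ht => h.hasDerivAt_F ht)
    (fun _ ht => h.E_nonpos hd hα ht) hd.tendsto_F ht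
  linarith

lemma E_eq_zero (h : IsTraj 1 T f p r) (hd : ExpDecay a l f p r) {t : ℝ} (ht : t < T) :
    r t + f t * p t = 0 :=
  eq_of_hasDerivAt_zero_of_tendsto (fun _ ht => h.hasDerivAt_E ht) (fun _ _ => by ring)
    hd.tendsto_E ht

lemma p_eq (h : IsTraj 1 T f p r) (hd : ExpDecay a l f p r) {t : ℝ} (ht : t < T) :
    p t = (a ^ 2 - f t ^ 2) / 2 := by
  have := eq_of_hasDerivAt_zero_of_tendsto (fun _ ht => h.hasDerivAt_F ht)
    (fun _ ht => h.E_eq_zero hd ht) hd.tendsto_F ht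
  linarith

lemma const_of_p_eq_zero (h : IsTraj α T f p r) (hd : ExpDecay a l f p r) {s : ℝ} (hs : s ≤ T)
    (hp : ∀ t < s, p t = 0) {t : ℝ} (ht : t < T) : f t = -a := by
  have hf : ∀ t < s, f t = -a := fun t ht =>
    eq_of_hasDerivAt_zero_of_tendsto (fun t ht => h.hf t (ht.trans_le hs)) hp hd.tendsto_f ht
  have hr : ∀ t < s, r t = 0 := fun t ht =>
    (h.hp t (ht.trans_le hs)).unique ((hasDerivAt_const t (0 : ℝ)).congr_of_eventuallyEq
      (eventuallyEq_of_mem (Iio_mem_nhds ht) hp))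
  have hconst : IsTraj α T (fun _ => -a) (fun _ => 0) (fun _ => 0) :=
    ⟨fun t _ => hasDerivAt_const t _, fun t _ => hasDerivAt_const t _, fun t _ => by
      simpa using hasDerivAt_const t (0 : ℝ)⟩
  obtain ⟨t₀, ht₀⟩ := exists_lt s
  exact (h.eqOn hconst (ht₀.trans_le hs) (hf _ ht₀) (hp _ ht₀) (hr _ ht₀) ht).1

/-- If `E` vanished at some time it would vanish at all earlier times, hence so would `E' = (1 - α)
p²`, and the trajectory would be the equilibrium. -/
lemma E_neg (h : IsTraj α T f p r) (hd : ExpDecay a l f p r) (hα : 1 < α) {t₁ : ℝ} (ht₁ : t₁ < T)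
    (hne : f t₁ ≠ -a) {t : ℝ} (ht : t < T) : r t + f t * p t < 0 := by
  refine lt_of_le_of_ne (h.E_nonpos hd hα.le ht) fun h0 => hne ?_
  have hE : ∀ s < t, r s + f s * p s = 0 := fun s hs =>
    le_antisymm (h.E_nonpos hd hα.le (hs.trans ht))
      (h0.symm.le.trans (h.E_antitone hα.le (hs.trans ht) ht hs.le))
  refine h.const_of_p_eq_zero hd ht.le (fun s hs => ?_) ht₁
  have := (h.hasDerivAt_E (hs.trans ht)).unique ((hasDerivAt_const s (0 : ℝ)).congr_of_eventuallyEq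
    (eventuallyEq_of_mem (Iio_mem_nhds hs) hE))
  rcases mul_eq_zero.1 this with h1 | h1
  · linarith
  · exact pow_eq_zero_iff (two_ne_zero) |>.1 h1

/-- Since `E ≤ 0`, the product `p · exp (∫ f)` is antitone, so a positive slope was positive at all
earlier times. -/
lemma p_pos_of_pos (h : IsTraj α T f p r) (hd : ExpDecay a l f p r) (hα : 1 ≤ α) {s t : ℝ}
    (hs : s < T) (hps : 0 < p s) (hts : t ≤ s) : 0 < p t := by
  obtain ⟨A, hA⟩ := h.exists_antideriv
  have := antitoneOn_Iio_of_hasDerivAt (fun t ht => (h.hasDerivAt_mul_exp ht (hA t ht)).1)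
    (fun t ht => mul_nonpos_of_nonpos_of_nonneg (h.E_nonpos hd hα ht) (Real.exp_pos _).le)
    (hts.trans_lt hs) hs hts
  have h2 : 0 < p s * Real.exp (A s) := by positivity
  exact pos_of_mul_pos_left (h2.trans_le this) (Real.exp_pos _).le

lemma strictAntiOn_p_mul_exp (h : IsTraj α T f p r) (hd : ExpDecay a l f p r) (hα : 1 < α)
    {t₁ : ℝ} (ht₁ : t₁ < T) (hne : f t₁ ≠ -a) :
    ∃ A : ℝ → ℝ, StrictAntiOn (fun t => p t * Real.exp (A t)) (Iio T) := by
  obtain ⟨A, hA⟩ := h.exists_antideriv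
  exact ⟨A, strictAntiOn_Iio_of_hasDerivAt (fun t ht => (h.hasDerivAt_mul_exp ht (hA t ht)).1)
    (fun t ht => mul_neg_of_neg_of_pos (h.E_neg hd hα ht₁ hne ht) (Real.exp_pos _))⟩

lemma p_pos_of_nonneg (h : IsTraj α T f p r) (hd : ExpDecay a l f p r) (hα : 1 < α) {t₁ : ℝ}
    (ht₁ : t₁ < T) (hne : f t₁ ≠ -a) {s t : ℝ} (hs : s < T) (hps : 0 ≤ p s) (hts : t < s) :
    0 < p t := by
  obtain ⟨A, hA⟩ := h.strictAntiOn_p_mul_exp hd hα ht₁ hne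
  have := hA (hts.trans hs) hs hts
  have h2 : 0 ≤ p s * Real.exp (A s) := by positivity
  exact pos_of_mul_pos_left (h2.trans_lt this) (Real.exp_pos _).le

lemma p_neg_of_nonpos (h : IsTraj α T f p r) (hd : ExpDecay a l f p r) (hα : 1 < α) {t₁ : ℝ}
    (ht₁ : t₁ < T) (hne : f t₁ ≠ -a) {s t : ℝ} (ht : t < T) (hps : p s ≤ 0) (hst : s < t) :
    p t < 0 := by
  by_contra! hcon
  exact absurd (h.p_pos_of_nonneg hd hα ht₁ hne ht hcon hst) (not_lt.2 hps)

lemma strictMonoOn_of_p_pos (h : IsTraj α T f p r) {s : ℝ} (hs : s < T) (hp : ∀ t < s, 0 < p t) :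
    StrictMonoOn f (Iic s) := by
  refine strictMonoOn_of_deriv_pos (convex_Iic s)
    (fun t ht => (h.continuousAt (lt_of_le_of_lt ht hs)).1.continuousWithinAt) ?_
  rw [interior_Iic]
  exact fun t ht => by rw [(h.hf t (ht.trans hs)).deriv]; exact hp t ht

lemma neg_lt_of_p_pos (h : IsTraj α T f p r) (hd : ExpDecay a l f p r) {s : ℝ} (hs : s < T)
    (hp : ∀ t < s, 0 < p t) {t : ℝ} (ht : t ≤ s) : -a < f t := by
  have hm := h.strictMonoOn_of_p_pos hs hp
  obtain ⟨t', ht'⟩ := exists_lt t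
  have h1 : f t' < f t := hm (ht'.le.trans ht) ht ht'
  refine lt_of_le_of_lt (le_of_tendsto hd.tendsto_f ?_) h1
  filter_upwards [eventually_le_atBot t'] with x hx
  exact hm.monotoneOn (hx.trans (ht'.le.trans ht)) (ht'.le.trans ht) hx

lemma G_nonpos (h : IsTraj α T f p r) (hd : ExpDecay a l f p r) (hα : α ≤ 2) {s : ℝ} (hs : s ≤ T)
    (hf : ∀ t < s, f t < 0) {t : ℝ} (ht : t < s) :
    f t * r t - p t ^ 2 / 2 + f t ^ 2 * p t ≤ 0 :=
  le_of_hasDerivAt_nonpos_of_tendsto (fun _ ht => h.hasDerivAt_G (ht.trans_le hs))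
    (fun t ht => mul_nonpos_of_nonpos_of_nonneg
      (mul_nonpos_of_nonneg_of_nonpos (by linarith) (hf t ht).le) (sq_nonneg _)) hd.tendsto_G ht

lemma hasDerivAt_sqrt_neg (h : IsTraj α T f p r) {t : ℝ} (ht : t < T) (hf : f t < 0) :
    HasDerivAt (fun t => √(-f t)) (-p t / (2 * √(-f t))) t :=
  (h.hf t ht).neg.sqrt (neg_ne_zero.2 hf.ne)

/-- The derivative of `p / (2 w) + w³ / 3`, where `w = √(-f)`. -/
lemma hasDerivAt_X (h : IsTraj α T f p r) {t : ℝ} (ht : t < T) (hf : f t < 0) :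
    HasDerivAt (fun t => p t / (2 * √(-f t)) + √(-f t) ^ 3 / 3)
      (-(f t * r t - p t ^ 2 / 2 + f t ^ 2 * p t) / (2 * √(-f t) ^ 3)) t := by
  have hw := h.hasDerivAt_sqrt_neg ht hf
  have hw0 : 0 < √(-f t) := Real.sqrt_pos.2 (by linarith)
  have hsq : f t = -√(-f t) ^ 2 := by rw [Real.sq_sqrt (by linarith)]; ring
  refine (((h.hp t ht).div (hw.const_mul 2) (by positivity)).add
    ((hw.pow 3).div_const 3)).congr_deriv ?_
  set w := √(-f t) with hwdef
  rw [hsq]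
  field_simp
  push_cast
  ring

lemma tendsto_X (hd : ExpDecay a l f p r) (ha : 0 < a) :
    Tendsto (fun t => p t / (2 * √(-f t)) + √(-f t) ^ 3 / 3) atBot (𝓝 (√a ^ 3 / 3)) := by
  have hw : Tendsto (fun t => √(-f t)) atBot (𝓝 (√a)) := by
    have := hd.tendsto_f.neg
    rw [neg_neg] at this
    exact (Real.continuous_sqrt.tendsto a).comp this
  have ha' : 0 < √a := Real.sqrt_pos.2 ha
  have := (hd.tendsto_p.div (hw.const_mul 2) (by positivity)).add ((hw.pow 3).div_const 3)
  simpa using this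

lemma le_X (h : IsTraj α T f p r) (hd : ExpDecay a l f p r) (ha : 0 < a) (hα : α ≤ 2) {s : ℝ}
    (hs : s ≤ T) (hf : ∀ t < s, f t < 0) {t : ℝ} (ht : t < s) :
    √a ^ 3 / 3 ≤ p t / (2 * √(-f t)) + √(-f t) ^ 3 / 3 := by
  refine le_of_hasDerivAt_nonneg_of_tendsto (fun t ht => h.hasDerivAt_X (ht.trans_le hs) (hf t ht))
    (fun t ht => ?_) (tendsto_X hd ha) ht
  have := h.G_nonpos hd hα hs hf ht
  have hw0 : 0 < √(-f t) := Real.sqrt_pos.2 (by linarith [hf t ht])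
  exact div_nonneg (by linarith) (by positivity)

/-- `G ≤ 0` while `f < 0`, so `p / (2w) + w³ / 3` increases from its limit `√a³ / 3`. The bound is
the slope of the exact solution for `α = 2`. -/
lemma p_ge (h : IsTraj α T f p r) (hd : ExpDecay a l f p r) (ha : 0 < a) (hα : α ≤ 2) {s : ℝ}
    (hs : s ≤ T) (hf : ∀ t < s, f t < 0) {t : ℝ} (ht : t < s) :
    2 * √(-f t) / 3 * (√a ^ 3 - √(-f t) ^ 3) ≤ p t := by
  have h1 := h.le_X hd ha hα hs hf ht
  have hw0 : 0 < √(-f t) := Real.sqrt_pos.2 (by linarith [hf t ht])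
  have h2 : (√a ^ 3 - √(-f t) ^ 3) / 3 ≤ p t / (2 * √(-f t)) := by linarith
  rw [le_div_iff₀ (by positivity)] at h2
  linarith

/-- At a first zero of `p` one would have `-a < f < 0`, where the bound `p_ge` is strictly positive.
-/
lemma p_pos_of_f_neg (h : IsTraj α T f p r) (hd : ExpDecay a l f p r) (ha : 0 < a) (hα : α ≤ 2)
    (hf : ∀ t < T, f t < 0) (hev : ∀ᶠ t in atBot, 0 < p t) {t : ℝ} (ht : t < T) : 0 < p t := by
  obtain ⟨t₀, ht₀⟩ := eventually_atBot.1 hev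
  rcases le_or_gt t t₀ with htt | htt
  · exact ht₀ t htt
  by_contra! hcon
  have hc : ContinuousOn (fun t => -p t) (Icc t₀ t) := fun x hx =>
    (h.continuousAt (hx.2.trans_lt ht)).2.1.neg.continuousWithinAt
  obtain ⟨s, hs1, hs2, hs3, hs4⟩ := exists_first_zero htt.le hc (neg_neg_of_pos (ht₀ t₀ le_rfl))
    (neg_nonneg.2 hcon)
  have hsT := hs2.trans_lt ht
  have hpos : ∀ x < s, 0 < p x := fun x hx => by
    rcases le_or_gt x t₀ with h1 | h1
    · exact ht₀ x h1
    · exact neg_neg_iff_pos.1 (hs4 x h1.le hx)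
  have hfs := h.neg_lt_of_p_pos hd hsT hpos le_rfl
  have h1 := h.p_ge hd ha hα le_rfl hf hsT
  have hw0 : 0 < √(-f s) := Real.sqrt_pos.2 (by linarith [hf s hsT])
  have hwa : √(-f s) < √a := Real.sqrt_lt_sqrt (by linarith [hf s hsT]) (by linarith)
  have h2 : √(-f s) ^ 3 < √a ^ 3 := pow_lt_pow_left₀ hwa hw0.le (by norm_num)
  have h3 : 0 < 2 * √(-f s) / 3 * (√a ^ 3 - √(-f s) ^ 3) :=
    mul_pos (by positivity) (by linarith)
  simp only [neg_eq_zero] at hs3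
  linarith

/-- As long as `f < 0`, an increasing trajectory lives on a bounded time interval. -/
lemma exists_time_bound (ha : 0 < a) (hα : α ≤ 2) (hd : ExpDecay a l f p r) {t₀ : ℝ}
    (h₀ : ∀ t ≤ t₀, 0 < p t) (hlt : -a < f t₀) :
    ∃ S > t₀, ∀ T, t₀ < T → IsTraj α T f p r → (∀ t < T, f t < 0) → T ≤ S := by
  set w₀ := √(-f t₀)
  -- Since `w = √(-f)` decreases from `w₀`, the bound on `p / (2w)` gives `w' ≤ -c`, so `w` would be
  -- exhausted within the time `w₀ / c`.
  set c := (√a ^ 3 - w₀ ^ 3) / 3 with hc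
  by_cases hf0 : f t₀ < 0
  swap
  · exact ⟨t₀ + 1, by linarith, fun T hT _ hf => absurd (hf t₀ hT) hf0⟩
  have hw₀ : 0 < w₀ := Real.sqrt_pos.2 (by linarith)
  have hw₀a : w₀ < √a := Real.sqrt_lt_sqrt (by linarith) (by linarith)
  have hc0 : 0 < c := by
    have : w₀ ^ 3 < √a ^ 3 := pow_lt_pow_left₀ hw₀a hw₀.le (by norm_num)
    rw [hc]
    linarith
  refine ⟨t₀ + w₀ / c, by linarith [div_pos hw₀ hc0], fun T hT h hf => ?_⟩
  by_contra! hcon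
  have hp : ∀ t < T, 0 < p t := fun t ht => h.p_pos_of_f_neg hd ha hα hf
    (by filter_upwards [eventually_le_atBot t₀] with t ht using h₀ t ht) ht
  have hmono : ∀ t, t₀ ≤ t → t < T → √(-f t) ≤ w₀ := by
    intro t h1 h2
    refine Real.sqrt_le_sqrt ?_
    have := (h.strictMonoOn_of_p_pos h2 (fun x hx => hp x (hx.trans h2))).monotoneOn h1 self_mem_Iic h1
    linarith
  have hsub : Icc t₀ (t₀ + w₀ / c) ⊆ Iio T := fun x hx => hx.2.trans_lt hcon
  have hanti : AntitoneOn (fun t => √(-f t) + c * t) (Icc t₀ (t₀ + w₀ / c)) := by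
    have hder : ∀ t < T, HasDerivAt (fun t => √(-f t) + c * t) (-p t / (2 * √(-f t)) + c) t :=
      fun t ht => ((h.hasDerivAt_sqrt_neg ht (hf t ht)).add
        ((hasDerivAt_id t).const_mul c)).congr_deriv (by simp)
    refine antitoneOn_of_deriv_nonpos (convex_Icc _ _)
      (fun t ht => (hder t (hsub ht)).continuousAt.continuousWithinAt)
      (fun t ht => (hder t (hsub (interior_subset ht))).differentiableAt.differentiableWithinAt)
      (fun t ht => ?_)
    have htT := hsub (interior_subset ht)
    rw [(hder t htT).deriv]
    have h1 := h.le_X hd ha hα le_rfl hf htT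
    have h2 := hmono t (interior_subset ht).1 htT
    have h3 : √(-f t) ^ 3 ≤ w₀ ^ 3 := pow_le_pow_left₀ (Real.sqrt_nonneg _) h2 3
    rw [neg_div, hc]
    linarith
  have hle : t₀ ≤ t₀ + w₀ / c := by linarith [div_pos hw₀ hc0]
  have := hanti ⟨le_rfl, hle⟩ ⟨hle, le_rfl⟩ hle
  have h1 : c * (t₀ + w₀ / c) = c * t₀ + w₀ := by field_simp
  simp only [h1] at this
  have h2 : 0 < √(-f (t₀ + w₀ / c)) := Real.sqrt_pos.2 (by linarith [hf _ hcon])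
  linarith

/-- While the trajectory increases, its state stays bounded on bounded time intervals. -/
lemma bounded_of_p_pos (h : IsTraj α T f p r) (hd : ExpDecay a l f p r) (ha : 0 < a) (hα : 1 ≤ α)
    (hp : ∀ t < T, 0 < p t) {t₀ : ℝ} (ht₀ : t₀ < T) :
    ∃ B, ∀ t, t₀ ≤ t → t < T → |f t| ≤ B ∧ |p t| ≤ B ∧ |r t| ≤ B := by
  have hpb : ∀ t < T, p t ≤ a ^ 2 / 2 := fun t ht => by
    linarith [h.p_le hd hα ht, sq_nonneg (f t)]
  have hfb : ∀ t < T, |f t| ≤ a := fun t ht => by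
    refine abs_le_of_sq_le_sq ?_ ha.le
    linarith [h.p_le hd hα ht, hp t ht]
  -- `D` bounds `-E'` because `0 < p ≤ a² / 2`; on a bounded interval `E` is then bounded below, and
  -- it is nonpositive anyway.
  set D := (α - 1) * (a ^ 2 / 2) ^ 2 with hD
  have hD0 : 0 ≤ D := mul_nonneg (by linarith) (sq_nonneg _)
  set E₀ := -(r t₀ + f t₀ * p t₀) + D * (T - t₀) with hE₀
  have hE : ∀ t, t₀ ≤ t → t < T → -E₀ ≤ r t + f t * p t := by
    intro t h1 h2
    have := antitoneOn_Iio_of_hasDerivAt (T := T) (h := fun t => -(r t + f t * p t) - D * t)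
      (fun t ht => (h.hasDerivAt_E ht).neg.sub ((hasDerivAt_id t).const_mul D))
      (fun t ht => by
        have : p t ^ 2 ≤ (a ^ 2 / 2) ^ 2 := pow_le_pow_left₀ (hp t ht).le (hpb t ht) 2
        rw [hD]
        nlinarith) ht₀ h2 h1
    have h3 : D * t ≤ D * T := mul_le_mul_of_nonneg_left h2.le hD0
    simp only at this
    rw [hE₀]
    linarith
  have hEpos : 0 ≤ E₀ := by linarith [hE t₀ le_rfl ht₀, h.E_nonpos hd hα ht₀]
  refine ⟨a + a ^ 2 / 2 + (E₀ + a * (a ^ 2 / 2)), fun t h1 h2 => ⟨?_, ?_, ?_⟩⟩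
  · linarith [hfb t h2, show 0 ≤ a ^ 2 / 2 + (E₀ + a * (a ^ 2 / 2)) by positivity]
  · rw [abs_of_pos (hp t h2)]
    linarith [hpb t h2, show 0 ≤ a + (E₀ + a * (a ^ 2 / 2)) by positivity]
  · have hfp : |f t * p t| ≤ a * (a ^ 2 / 2) := by
      rw [abs_mul, abs_of_pos (hp t h2)]
      exact mul_le_mul (hfb t h2) (hpb t h2) (hp t h2).le ha.le
    have h3 := abs_le.1 hfp
    have h4 := hE t h1 h2
    have h5 := h.E_nonpos hd hα h2
    have h6 : 0 ≤ a + a ^ 2 / 2 := by positivity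
    rw [abs_le]
    constructor <;> linarith

/-- For `α > 1` a trajectory cannot be continued to the whole line. -/
lemma not_global (h : ∀ T, IsTraj α T f p r) (hd : ExpDecay a l f p r) (hα : 1 < α) {t₁ : ℝ}
    (hne : f t₁ ≠ -a) : False := by
  have hE : ∀ t, r t + f t * p t < 0 := fun t =>
    (h (max t t₁ + 1)).E_neg hd hα (by linarith [le_max_right t t₁]) hne
      (by linarith [le_max_left t t₁])
  have hEa : Antitone fun t => r t + f t * p t := fun x y hxy =>
    (h (y + 1)).E_antitone hα.le (show x < y + 1 by linarith) (show y < y + 1 by linarith) hxy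
  set e := -(r 0 + f 0 * p 0) with he
  have he0 : 0 < e := by linarith [hE 0]
  have hF : ∀ t, 0 < t → p t + f t ^ 2 / 2 ≤ p 0 + f 0 ^ 2 / 2 - e * t := by
    intro t ht
    have hder : ∀ s, HasDerivAt (fun t => p t + f t ^ 2 / 2 + e * t) (r s + f s * p s + e * 1) s :=
      fun s => ((h (s + 1)).hasDerivAt_F (by linarith)).add ((hasDerivAt_id s).const_mul e)
    have hanti : AntitoneOn (fun t => p t + f t ^ 2 / 2 + e * t) (Ici 0) := by
      refine antitoneOn_of_deriv_nonpos (convex_Ici 0)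
        (fun s _ => (hder s).continuousAt.continuousWithinAt)
        (fun s _ => (hder s).differentiableAt.differentiableWithinAt) (fun s hs => ?_)
      rw [(hder s).deriv]
      have := hEa (show 0 ≤ s from interior_subset hs)
      simp only at this
      linarith
    have := hanti self_mem_Ici ht.le ht.le
    simp only [mul_zero, add_zero] at this
    linarith
  -- From `t₂` on `p + f²/2 ≤ -1/2`, that is, `f' ≤ -(1 + f²) / 2`. Then `arctan f` has slope at
  -- most `-1/2`, impossible over a length `2π` because its values stay strictly within an interval
  -- of length `π`.
  obtain ⟨t₂, ht₂, ht₂'⟩ : ∃ t₂ : ℝ, 0 < t₂ ∧ p 0 + f 0 ^ 2 / 2 - e * t₂ ≤ -(1 / 2) := by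
    refine ⟨max 1 ((p 0 + f 0 ^ 2 / 2 + 1 / 2) / e), lt_max_of_lt_left one_pos, ?_⟩
    have := le_max_right 1 ((p 0 + f 0 ^ 2 / 2 + 1 / 2) / e)
    rw [div_le_iff₀ he0] at this
    linarith
  have hR : ∀ t, t₂ ≤ t → p t / (1 + f t ^ 2) ≤ -(1 / 2) := by
    intro t ht
    rw [div_le_iff₀ (by positivity)]
    have := hF t (ht₂.trans_le ht)
    nlinarith [mul_le_mul_of_nonneg_left ht he0.le]
  have hder : ∀ s, HasDerivAt (fun t => Real.arctan (f t) + 1 / 2 * t)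
      (1 / (1 + f s ^ 2) * p s + 1 / 2 * 1) s :=
    fun s => (((h (s + 1)).hf s (by linarith)).arctan).add ((hasDerivAt_id s).const_mul (1 / 2))
  have hanti : AntitoneOn (fun t => Real.arctan (f t) + 1 / 2 * t) (Ici t₂) := by
    refine antitoneOn_of_deriv_nonpos (convex_Ici t₂)
      (fun s _ => (hder s).continuousAt.continuousWithinAt)
      (fun s _ => (hder s).differentiableAt.differentiableWithinAt) (fun s hs => ?_)
    rw [(hder s).deriv]
    have := hR s (interior_subset hs)
    rw [one_div_mul_eq_div]
    linarith
  have hpi := Real.pi_pos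
  have h3 := hanti (self_mem_Ici (a := t₂)) (show t₂ + 2 * Real.pi ∈ Ici t₂ by
    simp only [mem_Ici]; linarith) (by linarith)
  simp only at h3
  linarith [Real.neg_pi_div_two_lt_arctan (f (t₂ + 2 * Real.pi)), Real.arctan_lt_pi_div_two (f t₂)]

/-- Once the trajectory decreases, its state is bounded as long as `f` is bounded below. -/
lemma bounded_of_p_neg (h : IsTraj α T f p r) (hd : ExpDecay a l f p r) (hα : 1 ≤ α) {t₀ B : ℝ}
    (ht₀ : t₀ < T) (hp : ∀ t, t₀ ≤ t → t < T → p t ≤ 0) (hB : 0 ≤ B)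
    (hfB : ∀ t, t₀ ≤ t → t < T → |f t| ≤ B) :
    ∃ B, ∀ t, t₀ ≤ t → t < T → |f t| ≤ B ∧ |p t| ≤ B ∧ |r t| ≤ B := by
  -- `W` grows at most at the rate `(α + B) |p| = -(α + B) f'`, so `W exp ((α + B) f)` is antitone;
  -- since `f` is bounded, so is `W`, and `W` dominates `-E` and `p²`.
  set W : ℝ → ℝ := fun t => -(r t + f t * p t) + 1 + p t ^ 2 / 2 with hW
  have hWpos : ∀ t, t < T → 1 + p t ^ 2 / 2 ≤ W t := fun t ht => by
    have := h.E_nonpos hd hα ht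
    simp only [hW]
    linarith
  have hWd : ∀ t < T, HasDerivAt (fun t => W t * Real.exp ((α + B) * f t))
      ((-((1 - α) * p t ^ 2) + p t * r t) * Real.exp ((α + B) * f t) +
        W t * (Real.exp ((α + B) * f t) * ((α + B) * p t))) t := by
    intro t ht
    refine HasDerivAt.mul ?_ (((h.hf t ht).const_mul (α + B)).exp)
    refine (((h.hasDerivAt_E ht).neg.add_const 1).add
      (((h.hp t ht).pow 2).div_const 2)).congr_deriv ?_
    push_cast
    ring
  have hle : ∀ t, t₀ ≤ t → t < T →
      W t * Real.exp ((α + B) * f t) ≤ W t₀ * Real.exp ((α + B) * f t₀) := by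
    intro t h1 h2
    have hsub : Icc t₀ t ⊆ Iio T := fun x hx => hx.2.trans_lt h2
    have : AntitoneOn (fun t => W t * Real.exp ((α + B) * f t)) (Icc t₀ t) := by
      refine antitoneOn_of_deriv_nonpos (convex_Icc _ _)
        (fun s hs => (hWd s (hsub hs)).continuousAt.continuousWithinAt)
        (fun s hs => (hWd s (hsub (interior_subset hs))).differentiableAt.differentiableWithinAt)
        (fun s hs => ?_)
      have hs' := interior_subset hs
      rw [(hWd s (hsub hs')).deriv]
      have hE := h.E_nonpos hd hα (hsub hs')
      have hps := hp s hs'.1 (hsub hs')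
      have hfs := abs_le.1 (hfB s hs'.1 (hsub hs'))
      set P := -p s with hP
      set e := -(r s + f s * p s) with he
      have hps' : p s = -P := by rw [hP]; ring
      have hrs : r s = -e + f s * P := by rw [he, hP]; ring
      have hP0 : 0 ≤ P := by linarith
      have he0 : 0 ≤ e := by linarith
      have hWs : W s = e + 1 + P ^ 2 / 2 := by
        simp only [hW, he, hP]
        ring
      have key : (α - 1) * P + e - f s * P ≤ (α + B) * W s := by
        rw [hWs]
        nlinarith [sq_nonneg (P - 1), mul_nonneg hP0 (show 0 ≤ B + f s by linarith),
          mul_nonneg hB (sq_nonneg (P - 1)), mul_nonneg (show 0 ≤ α - 1 by linarith)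
          (sq_nonneg (P - 1)), mul_nonneg hB he0, mul_nonneg (show 0 ≤ α - 1 by linarith) he0]
      have hx := Real.exp_pos ((α + B) * f s)
      have : (-((1 - α) * p s ^ 2) + p s * r s) * Real.exp ((α + B) * f s) +
          W s * (Real.exp ((α + B) * f s) * ((α + B) * p s)) =
          Real.exp ((α + B) * f s) * P * ((α - 1) * P + e - f s * P - (α + B) * W s) := by
        rw [hps', hrs]
        ring
      rw [this]
      exact mul_nonpos_of_nonneg_of_nonpos (by positivity) (by linarith)
    exact this ⟨le_rfl, h1⟩ ⟨h1, le_rfl⟩ h1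
  set M := W t₀ * Real.exp ((α + B) * (B + B)) with hM
  have hWM : ∀ t, t₀ ≤ t → t < T → W t ≤ M := by
    intro t h1 h2
    have h3 := hle t h1 h2
    have h4 : W t₀ * Real.exp ((α + B) * f t₀) ≤ W t₀ * (Real.exp ((α + B) * (B + B))
        * Real.exp ((α + B) * f t)) := by
      rw [← Real.exp_add]
      refine mul_le_mul_of_nonneg_left (Real.exp_le_exp.2 ?_) (by
        linarith [hWpos t₀ ht₀, sq_nonneg (p t₀)])
      have := (abs_le.1 (hfB t h1 h2)).1
      have := (abs_le.1 (hfB t₀ le_rfl ht₀)).2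
      nlinarith
    exact le_of_mul_le_mul_right (h3.trans (h4.trans (le_of_eq (by rw [hM]; ring))))
      (Real.exp_pos ((α + B) * f t))
  refine ⟨B + 2 * M + B * (2 * M), fun t h1 h2 => ?_⟩
  have h3 := hWM t h1 h2
  have h4 := hWpos t h2
  have hM0 : 0 ≤ M := by linarith [sq_nonneg (p t)]
  have hpM : |p t| ≤ 2 * M := by
    rw [abs_le]
    constructor <;> nlinarith [sq_nonneg (p t - 1), sq_nonneg (p t + 1)]
  have hfpM : |f t * p t| ≤ B * (2 * M) := by
    rw [abs_mul]
    exact mul_le_mul (hfB t h1 h2) hpM (abs_nonneg _) hB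
  have hBM : 0 ≤ B * (2 * M) := by positivity
  refine ⟨by linarith [hfB t h1 h2], by linarith, ?_⟩
  have h5 := abs_le.1 hfpM
  have h6 := h.E_nonpos hd hα h2
  have h7 : -(r t + f t * p t) ≤ M := by
    simp only [hW] at h3
    linarith [sq_nonneg (p t)]
  rw [abs_le]
  constructor <;> linarith

/-- At the end of its maximal interval of existence the trajectory tends to `-∞`. -/
lemma tendsto_atBot_of_maximal (h : IsTraj α T f p r) (hd : ExpDecay a l f p r) (ha : 0 < a)
    (hα : 1 < α) {t₁ : ℝ} (ht₁ : t₁ < T) (hne : f t₁ ≠ -a)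
    (hmax : ∀ B, ∀ t₀ < T, ∃ t, t₀ ≤ t ∧ t < T ∧ (B < |f t| ∨ B < |p t| ∨ B < |r t|)) :
    (∃ t₂ < T, ∀ t, t₂ ≤ t → t < T → p t < 0) ∧ Tendsto f (𝓝[<] T) atBot := by
  have hunb : ∀ t₀ < T, ¬ ∃ B, ∀ t, t₀ ≤ t → t < T → |f t| ≤ B ∧ |p t| ≤ B ∧ |r t| ≤ B := by
    rintro t₀ ht₀ ⟨B, hB⟩
    obtain ⟨t, h1, h2, h3⟩ := hmax B t₀ ht₀
    obtain ⟨b1, b2, b3⟩ := hB t h1 h2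
    rcases h3 with h3 | h3 | h3 <;> linarith
  obtain ⟨s, hsT, hps⟩ : ∃ s < T, p s ≤ 0 := by
    by_contra! hcon
    exact hunb t₁ ht₁ (h.bounded_of_p_pos hd ha hα.le hcon ht₁)
  -- Once `p ≤ 0` it is negative afterwards, so `f` is eventually monotone; a lower bound for `f`
  -- would bound the whole state and contradict maximality.
  have hpn : ∀ t, s < t → t < T → p t < 0 := fun t h1 h2 =>
    h.p_neg_of_nonpos hd hα ht₁ hne h2 hps h1
  obtain ⟨t₂, hst₂, ht₂T⟩ := exists_between hsT
  have hanti : AntitoneOn f (Ioo s T) := antitoneOn_Ioo_of_hasDerivAt (fun t ht => h.hf t ht.2)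
    (fun t ht => (hpn t ht.1 ht.2).le)
  refine ⟨⟨t₂, ht₂T, fun t h1 h2 => hpn t (hst₂.trans_le h1) h2⟩, ?_⟩
  rw [tendsto_atBot]
  intro b
  obtain ⟨t₃, h1, h2, h3⟩ : ∃ t, t₂ ≤ t ∧ t < T ∧ f t < b := by
    by_contra! hcon
    refine hunb t₂ ht₂T (h.bounded_of_p_neg hd hα.le (B := |b| + |f t₂|) ht₂T
      (fun t h1 h2 => (hpn t (hst₂.trans_le h1) h2).le) (by positivity) fun t h1 h2 => ?_)
    have h3 := hcon t h1 h2
    have h4 := hanti ⟨hst₂, ht₂T⟩ ⟨hst₂.trans_le h1, h2⟩ h1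
    rw [abs_le]
    constructor
    · linarith [neg_abs_le b, abs_nonneg (f t₂)]
    · linarith [le_abs_self (f t₂), abs_nonneg b]
  filter_upwards [Ioo_mem_nhdsLT h2] with t ht
  exact (hanti ⟨hst₂.trans_le h1, h2⟩ ⟨(hst₂.trans_le h1).trans ht.1, ht.2⟩ ht.1.le).trans h3.le

end IsTraj

/-! ### Existence of the increasing profile -/

/-- The increasing solution of the boundary value problem, continued to the right. -/
theorem exists_profile {a m : ℝ} (ha : 0 < a) (h1 : 1 ≤ -((m - 1) / m)) (h2 : -((m - 1) / m) ≤ 2) :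
    ∃ (T d : ℝ) (f p r : ℝ → ℝ), 0 < T ∧ IsTraj (-((m - 1) / m)) T f p r ∧ ExpDecay a a f p r ∧
      f 0 = 0 ∧ (∀ t < 0, f t < 0) ∧ (∀ t < 0, 0 < p t) ∧ 0 ≤ p 0 ∧
      0 < d ∧ HasLyapunovSeries m a d f ∧
      (1 < -((m - 1) / m) →
        ∀ B, ∀ t₀ < T, ∃ t, t₀ ≤ t ∧ t < T ∧ (B < |f t| ∨ B < |p t| ∨ B < |r t|)) := by
  set α := -((m - 1) / m) with hα
  have hm : |(m - 1) / m| ≤ 2 := by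
    rw [abs_le]
    constructor <;> linarith
  set R := lyapunovRadius a with hR
  obtain ⟨f, p, r, hfe, hpe, hre, hcase⟩ := (isTraj_lyapunovSum ha hm).exists_maximal
  have hd : ExpDecay a a f p r := (expDecay_lyapunovSum ha hm).congr
    (eventuallyEq_of_mem (Iio_mem_atBot R) hfe) (eventuallyEq_of_mem (Iio_mem_atBot R) hpe)
    (eventuallyEq_of_mem (Iio_mem_atBot R) hre)
  have hppos : ∀ᶠ t in atBot, 0 < p t := by
    filter_upwards [eventually_lyapunovSum_one_pos ha hm, Iio_mem_atBot R] with t ht htR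
    rwa [hpe htR]
  have hfneg : ∀ᶠ t in atBot, f t < 0 := hd.tendsto_f.eventually_lt_const (by linarith)
  obtain ⟨t₀, ht₀⟩ := eventually_atBot.1 ((hppos.and hfneg).and (eventually_lt_atBot R))
  -- A global trajectory must reach zero by the bound on the time spent below it; a maximal one on a
  -- bounded interval must too, since otherwise it would increase forever and stay bounded.
  obtain ⟨T, hTmax, htraj, ht₀T, t₁, ht₁T, ht₁⟩ : ∃ T, ((∀ S, IsTraj α S f p r) ∨
      ∀ B, ∀ t₀ < T, ∃ t, t₀ ≤ t ∧ t < T ∧ (B < |f t| ∨ B < |p t| ∨ B < |r t|)) ∧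
      IsTraj α T f p r ∧ t₀ < T ∧ ∃ t₁ < T, 0 ≤ f t₁ := by
    rcases hcase with hg | ⟨T, hRT, htr, hmax⟩
    · obtain ⟨S, hS, hS'⟩ := IsTraj.exists_time_bound (α := α) (r := r) ha h2 hd
        (fun t ht => (ht₀ t ht).1.1)
        ((hg (t₀ + 1)).neg_lt_of_p_pos hd (by linarith) (fun t ht => (ht₀ t ht.le).1.1) le_rfl)
      refine ⟨S + 1, Or.inl hg, hg _, by linarith, ?_⟩
      by_contra! hcon
      linarith [hS' (S + 1) (by linarith) (hg _) hcon]
    · have ht₀T : t₀ < T := (ht₀ t₀ le_rfl).2.trans_le hRT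
      refine ⟨T, Or.inr hmax, htr, ht₀T, ?_⟩
      by_contra! hcon
      obtain ⟨B, hB⟩ := htr.bounded_of_p_pos hd ha h1
        (fun t ht => htr.p_pos_of_f_neg hd ha h2 hcon hppos ht) ht₀T
      obtain ⟨t, h3, h4, h5⟩ := hmax B t₀ ht₀T
      obtain ⟨b1, b2, b3⟩ := hB t h3 h4
      rcases h5 with h5 | h5 | h5 <;> linarith
  have ht01 : t₀ ≤ t₁ := by
    by_contra! hcon
    linarith [(ht₀ t₁ hcon.le).1.2]
  obtain ⟨s, hs1, hs2, hs3, hs4⟩ := exists_first_zero ht01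
    (fun x hx => (htraj.continuousAt (hx.2.trans_lt ht₁T)).1.continuousWithinAt)
    (ht₀ t₀ le_rfl).1.2 ht₁
  have hsT : s < T := hs2.trans_lt ht₁T
  have hfs : ∀ t < s, f t < 0 := fun t ht => by
    rcases le_or_gt t t₀ with h | h
    · exact (ht₀ t h).1.2
    · exact hs4 t h.le ht
  have hps : ∀ t < s, 0 < p t := fun t ht =>
    (htraj.mono hsT.le).p_pos_of_f_neg hd ha h2 hfs hppos ht
  have hps0 : 0 ≤ p s := by
    refine ge_of_tendsto ((htraj.continuousAt hsT).2.1.tendsto.mono_left nhdsWithin_le_nhds) ?_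
      (x := 𝓝[<] s)
    filter_upwards [self_mem_nhdsWithin] with t ht using (hps t ht).le
  -- Translating the first zero `s` to the origin replaces `e^{lat}` by `e^{las} e^{lat}`, so the
  -- free parameter becomes `d = e^{as}`.
  refine ⟨T - s, Real.exp (a * s), fun t => f (t + s), fun t => p (t + s), fun t => r (t + s),
    by linarith, htraj.shift s, hd.shift s, by simpa using hs3, fun t ht => hfs _ (by linarith),
    fun t ht => hps _ (by linarith), by simpa using hps0, Real.exp_pos _, ?_, fun h1α => ?_⟩
  · refine ⟨min 0 (R - s - 1), min_le_left _ _, fun t ht => ?_⟩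
    have htR : t + s < R := by linarith [min_le_right 0 (R - s - 1)]
    have hsum := hasSum_lyapunovSum ha hm htR 0
    have he : f (t + s) + a = lyapunovSum a m 0 (t + s) := by
      rw [hfe htR]
      ring
    rw [he]
    refine hsum.congr_fun ?_
    intro l
    unfold lyapunovTerm
    rw [← Real.exp_nat_mul, pow_zero, one_mul, mul_assoc, ← Real.exp_add]
    push_cast
    ring_nf
  · rcases hTmax with hg | hmax
    · exact (IsTraj.not_global hg hd h1α (t₁ := s) (by rw [hs3]; linarith)).elim
    · intro B t₂ ht₂
      obtain ⟨t, h3, h4, h5⟩ := hmax B (t₂ + s) (by linarith)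
      exact ⟨t - s, by linarith, by linarith, by simpa using h5⟩

/-! ### The simple pole: self-similar variables and their Lyapunov function -/

/-- The Lyapunov function of the self-similar equilibrium `u = s`, with `z` the derivative of `u`. -/
noncomputable def poleEnergy (s u z : ℝ) : ℝ :=
  z ^ 2 / 2 + (u - s) * z + (u - s) ^ 2 * (3 / 2 * u ^ 2 + s * u + s ^ 2 / 2)

lemma le_poleEnergy {s u : ℝ} (z : ℝ) (hs : 1 / 2 ≤ s) (hu : 9 / 20 ≤ u) :
    3 / 20 * (u - s) ^ 2 ≤ poleEnergy s u z := by
  have h1 : 0 ≤ 3 / 2 * u ^ 2 + s * u + s ^ 2 / 2 - 13 / 20 := by nlinarith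
  unfold poleEnergy
  nlinarith [sq_nonneg (z + (u - s)), mul_nonneg (sq_nonneg (u - s)) h1]

/-- The difference of the two sides is a quadratic form in `z` and `u - s`. Its discriminant
condition, after replacing `s` by the worst case `2 / 3`, is a polynomial in `u - 9/20` with
nonnegative coefficients. -/
lemma poleEnergy_le_dissipation {s u : ℝ} (z : ℝ) (hs : 1 / 2 ≤ s) (hs' : s ≤ 2 / 3)
    (hu : 9 / 20 ≤ u) :
    poleEnergy s u z / 10 ≤
      (7 * u - 2) * z ^ 2 + (7 * u - 1) * (u - s) * z + 6 * u ^ 2 * (u - s) ^ 2 := by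
  set P := u - s
  have hA : 0 < 7 * u - 41 / 20 := by linarith
  set c := 117 / 20 * u ^ 2 - s * u / 10 - s ^ 2 / 20 with hc
  have hc' : 117 / 20 * u ^ 2 - u / 15 - 1 / 45 ≤ c := by
    rw [hc]
    nlinarith
  have hdisc : 0 ≤ 4 * (7 * u - 41 / 20) * c - (7 * u - 11 / 10) ^ 2 := by
    have h1 : (7 * u - 41 / 20) * (117 / 20 * u ^ 2 - u / 15 - 1 / 45) ≤ (7 * u - 41 / 20) * c :=
      mul_le_mul_of_nonneg_left hc' hA.le
    obtain ⟨x, rfl⟩ : ∃ x, u = 9 / 20 + x := ⟨u - 9 / 20, by ring⟩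
    have hx : 0 ≤ x := by linarith
    have h2 : 0 ≤ 4 * ((7 * (9 / 20 + x) - 41 / 20) *
        (117 / 20 * (9 / 20 + x) ^ 2 - (9 / 20 + x) / 15 - 1 / 45))
        - (7 * (9 / 20 + x) - 11 / 10) ^ 2 := by
      ring_nf
      positivity
    linarith
  have key : 0 ≤ (7 * u - 41 / 20) * z ^ 2 + (7 * u - 11 / 10) * P * z + c * P ^ 2 := by
    have h4 : 4 * (7 * u - 41 / 20) *
        ((7 * u - 41 / 20) * z ^ 2 + (7 * u - 11 / 10) * P * z + c * P ^ 2) =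
        (2 * (7 * u - 41 / 20) * z + (7 * u - 11 / 10) * P) ^ 2 +
        (4 * (7 * u - 41 / 20) * c - (7 * u - 11 / 10) ^ 2) * P ^ 2 := by ring
    have h5 : 0 ≤ 4 * (7 * u - 41 / 20) *
        ((7 * u - 41 / 20) * z ^ 2 + (7 * u - 11 / 10) * P * z + c * P ^ 2) := by
      rw [h4]
      positivity
    exact nonneg_of_mul_nonneg_right h5 (by linarith)
  have hid : (7 * u - 2) * z ^ 2 + (7 * u - 1) * P * z + 6 * u ^ 2 * P ^ 2 - poleEnergy s u z / 10 =
      (7 * u - 41 / 20) * z ^ 2 + (7 * u - 11 / 10) * P * z + c * P ^ 2 := by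
    unfold poleEnergy
    rw [hc]
    ring
  linarith

namespace IsTraj

variable {α T a l : ℝ} {f p r : ℝ → ℝ}

/-- In the time `dη = -f dt` the scale-invariant variables `u = -p/f²` and `v = r/f³` satisfy an
autonomous planar system; `z = v - 2u²` is `du/dη`. -/
lemma hasDerivAt_u (h : IsTraj α T f p r) {t : ℝ} (ht : t < T) (hf : f t ≠ 0) :
    HasDerivAt (fun t => -p t / f t ^ 2)
      (-f t * (r t / f t ^ 3 - 2 * (-p t / f t ^ 2) ^ 2)) t := by
  refine ((h.hp t ht).neg.div ((h.hf t ht).pow 2) (pow_ne_zero 2 hf)).congr_deriv ?_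
  simp only [Pi.pow_apply, Pi.neg_apply]
  field_simp
  push_cast
  ring

lemma hasDerivAt_v (h : IsTraj α T f p r) {t : ℝ} (ht : t < T) (hf : f t ≠ 0) :
    HasDerivAt (fun t => r t / f t ^ 3)
      (-f t * (r t / f t ^ 3 + α * (-p t / f t ^ 2) ^ 2
        - 3 * (-p t / f t ^ 2) * (r t / f t ^ 3))) t := by
  refine ((h.hr t ht).div ((h.hf t ht).pow 3) (pow_ne_zero 3 hf)).congr_deriv ?_
  simp only [Pi.pow_apply]
  field_simp
  push_cast
  ring

/-- Eliminating `v` gives `dz/dη = (1 - 7u) z - 6u² (u - s)`. The energy is kinetic plus potential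
plus the cross term `(u - s) z`, which makes the dissipation control `u - s` as well as `z`. -/
lemma hasDerivAt_poleEnergy (h : IsTraj α T f p r) {t : ℝ} (ht : t < T) (hf : f t ≠ 0) {s : ℝ}
    (hs : s = (2 + α) / 6) :
    HasDerivAt (fun t => poleEnergy s (-p t / f t ^ 2) (r t / f t ^ 3 - 2 * (-p t / f t ^ 2) ^ 2))
      (-(-f t) * ((7 * (-p t / f t ^ 2) - 2) * (r t / f t ^ 3 - 2 * (-p t / f t ^ 2) ^ 2) ^ 2
        + (7 * (-p t / f t ^ 2) - 1) * (-p t / f t ^ 2 - s) *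
          (r t / f t ^ 3 - 2 * (-p t / f t ^ 2) ^ 2)
        + 6 * (-p t / f t ^ 2) ^ 2 * (-p t / f t ^ 2 - s) ^ 2)) t := by
  have hu := h.hasDerivAt_u ht hf
  have hv := h.hasDerivAt_v ht hf
  set U : ℝ → ℝ := fun t => -p t / f t ^ 2 with hU
  set W : ℝ → ℝ := fun t => r t / f t ^ 3 with hW
  have hu' : HasDerivAt U (-f t * (W t - 2 * U t ^ 2)) t := hu
  have hv' : HasDerivAt W (-f t * (W t + α * U t ^ 2 - 3 * U t * W t)) t := hv
  have hz := hv'.sub ((hu'.pow 2).const_mul 2)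
  have hP := hu'.sub_const s
  have hα : α = 6 * s - 2 := by linarith
  refine ((((hz.pow 2).div_const 2).add (hP.mul hz)).add ((hP.pow 2).mul
    ((((hu'.pow 2).const_mul (3 / 2)).add (hu'.const_mul s)).add_const (s ^ 2 / 2)))).congr_deriv ?_
  show _ = -(-f t) * ((7 * U t - 2) * (W t - 2 * U t ^ 2) ^ 2
        + (7 * U t - 1) * (U t - s) * (W t - 2 * U t ^ 2) + 6 * U t ^ 2 * (U t - s) ^ 2)
  simp only [Pi.pow_apply, Pi.sub_apply, Pi.add_apply]
  rw [hα]
  push_cast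
  ring

/-- If `f → -∞` at `T`, then `f` has a simple pole there. -/
theorem tendsto_mul_sub_of_tendsto_atBot (h : IsTraj α T f p r) (hd : ExpDecay a l f p r)
    (hα : 1 ≤ α) (hα' : α ≤ 2) (hlim : Tendsto f (𝓝[<] T) atBot) :
    Tendsto (fun t => f t * (t - T)) (𝓝[<] T) (𝓝 (6 / (2 + α))) := by
  set s := (2 + α) / 6 with hs
  have hs1 : 1 / 2 ≤ s := by rw [hs]; linarith
  have hs2 : s ≤ 2 / 3 := by rw [hs]; linarith
  obtain ⟨t₀, ht₀T, ht₀⟩ : ∃ t₀ < T, ∀ t, t₀ < t → t < T → f t < -(4 * |a| + 1) := by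
    have := hlim.eventually (eventually_lt_atBot (-(4 * |a| + 1)))
    obtain ⟨t₀, h1, h2⟩ := (mem_nhdsLT_iff_exists_Ioo_subset).1 this
    exact ⟨t₀, h1, fun t h3 h4 => h2 ⟨h3, h4⟩⟩
  set u : ℝ → ℝ := fun t => -p t / f t ^ 2 with hu
  set V : ℝ → ℝ := fun t => poleEnergy s (u t) (r t / f t ^ 3 - 2 * u t ^ 2) with hV
  have hfneg : ∀ t ∈ Ioo t₀ T, f t < 0 := fun t ht =>
    (ht₀ t ht.1 ht.2).trans (by linarith [abs_nonneg a])
  -- `p ≤ (a² - f²) / 2` gives `u ≥ 1/2 - a² / (2f²)`, and `f² ≥ 10 a²` makes this at least `1/2 -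
  -- 1/20`.
  have hu45 : ∀ t ∈ Ioo t₀ T, 9 / 20 ≤ u t := by
    intro t ht
    have h1 := h.p_le hd hα ht.2
    have h2 := ht₀ t ht.1 ht.2
    have h3 : 0 < f t ^ 2 := by nlinarith [hfneg t ht]
    have h4 : 10 * a ^ 2 ≤ f t ^ 2 := by
      rw [← sq_abs a]
      nlinarith [abs_nonneg a]
    simp only [hu]
    rw [le_div_iff₀ h3]
    linarith
  have hVnonneg : ∀ t ∈ Ioo t₀ T, 3 / 20 * (u t - s) ^ 2 ≤ V t := fun t ht =>
    le_poleEnergy _ hs1 (hu45 t ht)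
  have hVd : ∀ t ∈ Ioo t₀ T, ∃ D, V t / 10 ≤ D ∧ HasDerivAt V (-(-f t) * D) t := fun t ht =>
    ⟨_, poleEnergy_le_dissipation _ hs1 hs2 (hu45 t ht),
      h.hasDerivAt_poleEnergy ht.2 (hfneg t ht).ne hs⟩
  choose! D hD hVD using hVd
  have hV0 : ∀ t ∈ Ioo t₀ T, 0 ≤ V t := fun t ht =>
    le_trans (by positivity) (hVnonneg t ht)
  have hVanti : AntitoneOn V (Ioo t₀ T) := antitoneOn_Ioo_of_hasDerivAt hVD fun t ht => by
    have h1 := hD t ht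
    have h2 := hV0 t ht
    nlinarith [hfneg t ht]
  obtain ⟨t₁, ht₁⟩ := exists_between ht₀T
  have hsub : Ioo t₁ T ⊆ Ioo t₀ T := Ioo_subset_Ioo_left ht₁.1.le
  set Q := V t₁ with hQ
  have hQ0 : 0 ≤ Q := hV0 t₁ ht₁
  -- `V` decays at least at the rate `-f / 10` in `t`, while `log (-f)` grows at the rate `u · (-f)`
  -- with `u ≤ 2 + 10 Q`. Hence `V · (-f)^k` is antitone for this `k`, and `f → -∞` forces `V → 0`.
  set k := 1 / (10 * (2 + 10 * Q)) with hk
  have hk0 : 0 < k := by positivity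
  have huU : ∀ t ∈ Ioo t₁ T, u t ≤ 2 + 10 * Q := by
    intro t ht
    have h1 := hVnonneg t (hsub ht)
    have h2 : V t ≤ Q := hVanti ht₁ (hsub ht) ht.1.le
    nlinarith [sq_nonneg (u t - s - 1)]
  have hWd : ∀ t ∈ Ioo t₁ T, HasDerivAt (fun t => V t * Real.exp (k * Real.log (-f t)))
      (-(-f t) * D t * Real.exp (k * Real.log (-f t)) +
        V t * (Real.exp (k * Real.log (-f t)) * (k * (-p t / -f t)))) t := fun t ht =>
    (hVD t (hsub ht)).mul ((((h.hf t ht.2).neg.log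
      (neg_ne_zero.2 (hfneg t (hsub ht)).ne)).const_mul k).exp)
  have hWanti := antitoneOn_Ioo_of_hasDerivAt hWd fun t ht => by
    have hf := hfneg t (hsub ht)
    have h1 : -p t / -f t = u t * -f t := by
      simp only [hu]
      field_simp
    rw [h1]
    have hx := Real.exp_pos (k * Real.log (-f t))
    have h2 : k * u t * V t ≤ V t / 10 := by
      have : k * u t ≤ 1 / 10 := by
        rw [hk, div_mul_eq_mul_div, div_le_div_iff₀ (by positivity) (by norm_num)]
        linarith [huU t ht]
      nlinarith [hV0 t (hsub ht)]
    have h3 := hD t (hsub ht)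
    have h4 : -(-f t) * D t * Real.exp (k * Real.log (-f t)) +
        V t * (Real.exp (k * Real.log (-f t)) * (k * (u t * -f t))) =
        Real.exp (k * Real.log (-f t)) * (-f t) * (k * u t * V t - D t) := by ring
    rw [h4]
    exact mul_nonpos_of_nonneg_of_nonpos (mul_nonneg hx.le (by linarith)) (by linarith)
  obtain ⟨t₂, ht₂⟩ := exists_between ht₁.2
  set C := V t₂ * Real.exp (k * Real.log (-f t₂)) with hC
  have hlog : Tendsto (fun t => k * Real.log (-f t)) (𝓝[<] T) atTop :=
    (Real.tendsto_log_atTop.comp (tendsto_neg_atBot_atTop.comp hlim)).const_mul_atTop hk0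
  have hV_lim : Tendsto V (𝓝[<] T) (𝓝 0) := by
    have hlim0 : Tendsto (fun t => C * Real.exp (-(k * Real.log (-f t)))) (𝓝[<] T) (𝓝 0) := by
      simpa using (Real.tendsto_exp_neg_atTop_nhds_zero.comp hlog).const_mul C
    refine squeeze_zero' ?_ ?_ hlim0
    · filter_upwards [Ioo_mem_nhdsLT ht₀T] with t ht using hV0 t ht
    · filter_upwards [Ioo_mem_nhdsLT ht₂.2] with t ht
      have := hWanti ht₂ ⟨ht₂.1.trans ht.1, ht.2⟩ ht.1.le
      rw [Real.exp_neg, ← div_eq_mul_inv, le_div_iff₀ (Real.exp_pos _)]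
      exact this
  have hu_lim : Tendsto u (𝓝[<] T) (𝓝 s) := by
    have hsq : Tendsto (fun t => (u t - s) ^ 2) (𝓝[<] T) (𝓝 0) := by
      have h20 : Tendsto (fun t => 20 / 3 * V t) (𝓝[<] T) (𝓝 0) := by
        simpa using hV_lim.const_mul (20 / 3)
      refine squeeze_zero' (Eventually.of_forall fun t => sq_nonneg _) ?_ h20
      filter_upwards [Ioo_mem_nhdsLT ht₀T] with t ht
      linarith [hVnonneg t ht]
    have habs : Tendsto (fun t => |u t - s|) (𝓝[<] T) (𝓝 0) := by
      have := (Real.continuous_sqrt.tendsto 0).comp hsq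
      simpa [Function.comp_def, Real.sqrt_sq_eq_abs] using this
    have := (tendsto_zero_iff_abs_tendsto_zero _).2 habs
    simpa using this.add_const s
  -- By l'Hôpital: `(1 / (-f))' = -u → -s`, against `(T - t)' = -1`.
  have hquot : Tendsto (fun t => (-f t)⁻¹ / (T - t)) (𝓝[<] T) (𝓝 s) := by
    refine HasDerivAt.lhopital_zero_left_on_Ioo (f' := fun t => -u t) (g' := fun _ => -1) ht₀T
      (fun t ht => ?_) (fun t _ => ?_) (fun _ _ => by norm_num) ?_ ?_ ?_
    · refine (((h.hf t ht.2).neg).fun_inv (neg_ne_zero.2 (hfneg t ht).ne)).congr_deriv ?_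
      simp [hu, neg_div]
    · simpa using (hasDerivAt_id t).const_sub T
    · exact tendsto_inv_atTop_zero.comp (tendsto_neg_atBot_atTop.comp hlim)
    · have : Tendsto (fun t => T - t) (𝓝 T) (𝓝 (T - T)) := (continuous_const.sub continuous_id).tendsto T
      rw [sub_self] at this
      exact this.mono_left nhdsWithin_le_nhds
    · simpa using hu_lim
  have := hquot.inv₀ (by linarith)
  have he : s⁻¹ = 6 / (2 + α) := by rw [hs, inv_div]
  rw [he] at this
  refine this.congr fun t => ?_
  rw [inv_div, div_inv_eq_mul]
  ring

end IsTraj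

/-! ### The explicit solution for `α = 2` and the upper comparison -/

/-- The time at which the exact solution for `α = 2` passes through `-w |w|`, where `c² = a`. -/
noncomputable def timeThird (c w : ℝ) : ℝ :=
  √3 * Real.pi / (6 * c ^ 2)
    - 1 / (2 * c ^ 2) * Real.log ((c ^ 2 + c * w + w ^ 2) / (c - w) ^ 2)
    - √3 / c ^ 2 * Real.arctan ((c + 2 * w) / (√3 * c))

lemma tauThird_eq_timeThird {a y : ℝ} (ha : 0 < a) (hy : y ≤ 0) :
    tauThird a y = timeThird (√a) (√(-y)) := by
  have h1 : √(-a * y) = √a * √(-y) := by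
    rw [← Real.sqrt_mul ha.le]
    ring_nf
  have h2 : √(-y) ^ 2 = -y := Real.sq_sqrt (by linarith)
  have h3 : √a ^ 2 = a := Real.sq_sqrt ha.le
  have h4 : √(3 * a) = √3 * √a := Real.sqrt_mul (by norm_num) _
  unfold tauThird timeThird
  rw [h1, h4, h2, h3, ← sub_eq_add_neg]

lemma quad_pos {c w : ℝ} (hc : 0 < c) : 0 < c ^ 2 + c * w + w ^ 2 := by
  nlinarith [sq_nonneg (c + 2 * w), mul_pos hc hc]

/-- In the signed variable `f = -w |w|` the exact solution satisfies `w' = -(c³ - w³) / 3`, and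
`timeThird` is the inverse function. It stays smooth across `w = 0`, so it also describes the motion
after the profile reaches zero. -/
lemma hasDerivAt_timeThird {c w : ℝ} (hc : 0 < c) (hw : w < c) :
    HasDerivAt (timeThird c) (-3 / (c ^ 3 - w ^ 3)) w := by
  have hq := quad_pos (w := w) hc
  have hcw : 0 < c - w := by linarith
  have h3 : (√3) ^ 2 = 3 := Real.sq_sqrt (by norm_num)
  have h3' : 0 < √3 := by positivity
  have d1 : HasDerivAt (fun w : ℝ => c ^ 2 + c * w + w ^ 2) (c + 2 * w) w := by
    refine ((((hasDerivAt_id w).const_mul c).const_add (c ^ 2)).add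
      ((hasDerivAt_id w).pow 2)).congr_deriv ?_
    simp
  have d2 : HasDerivAt (fun w : ℝ => (c - w) ^ 2) (-2 * (c - w)) w := by
    refine (((hasDerivAt_id w).const_sub c).pow 2).congr_deriv ?_
    simp only [id]
    push_cast
    ring
  have d3 := (d1.div d2 (by positivity)).log (by
    simp only [Pi.div_apply]
    positivity)
  have d4 : HasDerivAt (fun w : ℝ => (c + 2 * w) / (√3 * c)) (2 / (√3 * c)) w := by
    refine ((((hasDerivAt_id w).const_mul 2).const_add c).div_const (√3 * c)).congr_deriv ?_
    simp
  have hcube : c ^ 3 - w ^ 3 = (c - w) * (c ^ 2 + c * w + w ^ 2) := by ring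
  have hkey : 1 + ((c + 2 * w) / (√3 * c)) ^ 2 = 4 * (c ^ 2 + c * w + w ^ 2) / (3 * c ^ 2) := by
    rw [div_pow, mul_pow, h3]
    field_simp
    ring
  refine (((hasDerivAt_const w (√3 * Real.pi / (6 * c ^ 2))).sub (d3.const_mul (1 / (2 * c ^ 2)))).sub
    (d4.arctan.const_mul (√3 / c ^ 2))).congr_deriv ?_
  simp only [Pi.div_apply]
  rw [hcube, hkey]
  generalize hqq : c ^ 2 + c * w + w ^ 2 = q at hq
  field_simp
  rw [← hqq]
  ring

lemma timeThird_zero {c : ℝ} (hc : 0 < c) : timeThird c 0 = 0 := by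
  have h := tauThird_eq_timeThird (a := c ^ 2) (y := 0) (by positivity) le_rfl
  rw [tauThird_zero (by positivity), neg_zero, Real.sqrt_zero, Real.sqrt_sq hc.le] at h
  exact h.symm

/-- The blow-up `f → -∞` after the zero corresponds to `w → -∞`, so this limit is the blow-up time.
-/
lemma tendsto_timeThird_atBot {c : ℝ} (hc : 0 < c) :
    Tendsto (timeThird c) atBot (𝓝 (2 * Real.pi * √3 / (3 * c ^ 2))) := by
  have h3' : 0 < √3 := by positivity
  have hinv : Tendsto (fun w : ℝ => c * w⁻¹) atBot (𝓝 0) := by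
    simpa using tendsto_inv_atBot_zero.const_mul c
  have hlog : Tendsto (fun w => Real.log ((c ^ 2 + c * w + w ^ 2) / (c - w) ^ 2)) atBot (𝓝 0) := by
    have hq : Tendsto (fun w : ℝ => ((c * w⁻¹) ^ 2 + c * w⁻¹ + 1) / (c * w⁻¹ - 1) ^ 2) atBot
        (𝓝 1) := by
      have := (((hinv.pow 2).add hinv).add_const 1).div ((hinv.sub_const 1).pow 2) (by norm_num)
      rwa [show ((0 : ℝ) ^ 2 + 0 + 1) / (0 - 1) ^ 2 = 1 by norm_num] at this
    have hq2 := (Real.continuousAt_log one_ne_zero).tendsto.comp hq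
    rw [Real.log_one] at hq2
    refine hq2.congr' ?_
    filter_upwards [eventually_lt_atBot 0] with w hw
    have : c - w ≠ 0 := by linarith
    have h2 : c * w⁻¹ - 1 ≠ 0 := by
      have := mul_neg_of_pos_of_neg hc (inv_lt_zero.2 hw)
      linarith
    have hw0 := hw.ne
    simp only [Function.comp]
    congr 1
    rw [div_eq_div_iff (by positivity) (by positivity)]
    field_simp
  have harc : Tendsto (fun w => Real.arctan ((c + 2 * w) / (√3 * c))) atBot (𝓝 (-(Real.pi / 2))) := by
    refine (tendsto_nhds_of_tendsto_nhdsWithin Real.tendsto_arctan_atBot).comp ?_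
    exact (tendsto_atBot_add_const_left _ _ (tendsto_id.const_mul_atBot two_pos)).atBot_div_const
      (by positivity)
  have := (hlog.const_mul (1 / (2 * c ^ 2))).const_sub (√3 * Real.pi / (6 * c ^ 2)) |>.sub
    (harc.const_mul (√3 / c ^ 2))
  rw [show √3 * Real.pi / (6 * c ^ 2) - 1 / (2 * c ^ 2) * 0 - √3 / c ^ 2 * -(Real.pi / 2) =
    2 * Real.pi * √3 / (3 * c ^ 2) by field_simp; ring] at this
  exact this

namespace IsTraj

variable {α T a l : ℝ} {f p r : ℝ → ℝ}

lemma G_eq_zero (h : IsTraj 2 T f p r) (hd : ExpDecay a l f p r) {t : ℝ} (ht : t < T) :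
    f t * r t - p t ^ 2 / 2 + f t ^ 2 * p t = 0 :=
  eq_of_hasDerivAt_zero_of_tendsto (fun _ ht => h.hasDerivAt_G ht) (fun _ _ => by ring)
    hd.tendsto_G ht

/-- A second first integral for `α = 2`. -/
lemma J_eq (h : IsTraj 2 T f p r) (hd : ExpDecay a l f p r) {t : ℝ} (ht : t < T) :
    -(9 / 2) * r t - 15 / 2 * (f t * p t) - f t ^ 3 = a ^ 3 := by
  refine eq_of_hasDerivAt_zero_of_tendsto
    (h := fun t => -(9 / 2) * r t - 15 / 2 * (f t * p t) - f t ^ 3) (fun t ht =>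
    (((h.hr t ht).const_mul (-(9 / 2))).sub (((h.hf t ht).mul (h.hp t ht)).const_mul (15 / 2))).sub
    ((h.hf t ht).pow 3)) (fun t ht => ?_) ?_ ht
  · have := h.G_eq_zero hd ht
    push_cast
    linear_combination (-3) * this
  · have := ((hd.tendsto_r.const_mul (-(9 / 2))).sub
      ((hd.tendsto_f.mul hd.tendsto_p).const_mul (15 / 2))).sub (hd.tendsto_f.pow 3)
    convert this using 2
    ring

/-- Eliminating `r` between the two first integrals `G` and `J`. No sign of `f` is needed, so this
holds beyond the zero; at `f = 0` it forces `p = 0`. -/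
lemma sq_eq (h : IsTraj 2 T f p r) (hd : ExpDecay a l f p r) {t : ℝ} (ht : t < T) :
    (3 / 2 * p t + f t ^ 2) ^ 2 = -(a ^ 3 * f t) := by
  have h1 := h.G_eq_zero hd ht
  have h2 := h.J_eq hd ht
  linear_combination (-f t) * h2 - 9 / 2 * h1

lemma p_eq_of_f_neg (h : IsTraj 2 T f p r) (hd : ExpDecay a l f p r) (ha : 0 < a) {s : ℝ}
    (hs : s ≤ T) (hf : ∀ t < s, f t < 0) {t : ℝ} (ht : t < s) :
    p t = 2 * √(-f t) / 3 * (√a ^ 3 - √(-f t) ^ 3) := by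
  have hw0 : 0 < √(-f t) := Real.sqrt_pos.2 (by linarith [hf t ht])
  have := eq_of_hasDerivAt_zero_of_tendsto
    (fun t ht => h.hasDerivAt_X (ht.trans_le hs) (hf t ht))
    (fun t ht => by rw [h.G_eq_zero hd (ht.trans_le hs)]; simp) (tendsto_X hd ha) ht
  field_simp at this ⊢
  linarith

/-- The derivative of the time function along a trajectory below zero. -/
lemma hasDerivAt_timeThird_sqrt (h : IsTraj α T f p r) {c t : ℝ} (hc : 0 < c) (ht : t < T)
    (hf : f t < 0) (hfc : √(-f t) < c) :
    HasDerivAt (fun t => timeThird c (√(-f t)))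
      (3 * p t / (2 * √(-f t) * (c ^ 3 - √(-f t) ^ 3))) t := by
  have hw0 : 0 < √(-f t) := Real.sqrt_pos.2 (by linarith)
  have h3 : 0 < c ^ 3 - √(-f t) ^ 3 := by
    have := pow_lt_pow_left₀ hfc hw0.le (n := 3) (by norm_num)
    linarith
  refine ((hasDerivAt_timeThird hc hfc).comp t (h.hasDerivAt_sqrt_neg ht hf)).congr_deriv ?_
  field_simp

lemma continuousOn_timeThird_sqrt (h : IsTraj α T f p r) {c : ℝ} (hc : 0 < c) (hT : 0 < T)
    (hfc : ∀ t ≤ 0, √(-f t) < c) :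
    ContinuousOn (fun t => timeThird c (√(-f t))) (Iic 0) := fun t ht =>
  ((hasDerivAt_timeThird hc (hfc t ht)).continuousAt.comp_of_eq
    ((h.continuousAt (lt_of_le_of_lt ht hT)).1.neg.sqrt) rfl).continuousWithinAt

lemma sqrt_neg_lt (h : IsTraj α T f p r) (hd : ExpDecay a l f p r) (hT : 0 < T)
    (h0 : f 0 = 0) (hf : ∀ t < 0, f t < 0) (hp : ∀ t < 0, 0 < p t)
    {t : ℝ} (ht : t ≤ 0) : √(-f t) < √a := by
  have := h.neg_lt_of_p_pos hd hT hp ht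
  exact Real.sqrt_lt_sqrt (by rcases ht.lt_or_eq with h1 | rfl <;> [linarith [hf t h1]; linarith])
    (by linarith)

/-- The clock of the exact solution, read along `f`, advances at least as fast as `t` because of
`p_ge`. Both clocks show `0` at `t = 0`, so earlier the exact one is behind. -/
lemma tauThird_le (h : IsTraj α T f p r) (hd : ExpDecay a l f p r) (ha : 0 < a) (hT : 0 < T)
    (h0 : f 0 = 0) (hf : ∀ t < 0, f t < 0) (hp : ∀ t < 0, 0 < p t)
    (hα : α ≤ 2) {t : ℝ} (ht : t ≤ 0) : tauThird a (f t) ≤ t := by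
  have hf0 : ∀ t ≤ 0, f t ≤ 0 := fun t ht => by
    rcases ht.lt_or_eq with h1 | rfl <;> [exact (hf t h1).le; exact h0.le]
  have hsa : 0 < √a := Real.sqrt_pos.2 ha
  have hlt := fun t (ht : t ≤ 0) => h.sqrt_neg_lt hd hT h0 hf hp ht
  have hmono : MonotoneOn (fun t => timeThird (√a) (√(-f t)) - t) (Iic 0) := by
    have hder : ∀ t < 0, HasDerivAt (fun t => timeThird (√a) (√(-f t)) - t)
        (3 * p t / (2 * √(-f t) * (√a ^ 3 - √(-f t) ^ 3)) - 1) t := fun t ht =>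
      (h.hasDerivAt_timeThird_sqrt hsa (ht.trans hT) (hf t ht) (hlt t ht.le)).sub (hasDerivAt_id t)
    refine monotoneOn_of_deriv_nonneg (convex_Iic 0)
      ((h.continuousOn_timeThird_sqrt hsa hT hlt).sub continuousOn_id) ?_ ?_
    · rw [interior_Iic]
      exact fun t ht => (hder t ht).differentiableAt.differentiableWithinAt
    · rw [interior_Iic]
      intro t ht
      rw [(hder t ht).deriv, sub_nonneg]
      have hw0 : 0 < √(-f t) := Real.sqrt_pos.2 (by linarith [hf t ht])
      have h3 := pow_lt_pow_left₀ (hlt t (mem_Iio.1 ht).le) hw0.le (n := 3) (by norm_num)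
      rw [le_div_iff₀ (mul_pos (by positivity) (by linarith))]
      have := h.p_ge hd ha hα hT.le hf ht
      linarith
  have := hmono ht self_mem_Iic ht
  simp only [h0, neg_zero, Real.sqrt_zero, timeThird_zero hsa] at this
  rw [tauThird_eq_timeThird ha (hf0 t ht)]
  linarith

lemma le_phiThird (h : IsTraj α T f p r) (hd : ExpDecay a l f p r) (ha : 0 < a) (hT : 0 < T)
    (h0 : f 0 = 0) (hf : ∀ t < 0, f t < 0) (hp : ∀ t < 0, 0 < p t)
    (hα : α ≤ 2) {t : ℝ} (ht : t ≤ 0) : f t ≤ phiThird a t := by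
  have hmem : f t ∈ Ioc (-a) 0 := ⟨h.neg_lt_of_p_pos hd hT hp ht, by
    rcases ht.lt_or_eq with h1 | rfl <;> [exact (hf t h1).le; exact h0.le]⟩
  rw [← (tauThird_strictMonoOn ha).le_iff_le hmem (phiThird_mem ha ht), tauThird_phiThird ha ht]
  exact h.tauThird_le hd ha hT h0 hf hp hα ht

lemma eq_phiThird (h : IsTraj α T f p r) (hd : ExpDecay a l f p r) (ha : 0 < a) (hT : 0 < T)
    (h0 : f 0 = 0) (hf : ∀ t < 0, f t < 0) (hp : ∀ t < 0, 0 < p t)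
    (hα : α = 2) {t : ℝ} (ht : t ≤ 0) : f t = phiThird a t := by
  subst hα
  have hmem : ∀ t ≤ 0, f t ∈ Ioc (-a) 0 := fun t ht => ⟨h.neg_lt_of_p_pos hd hT hp ht, by
    rcases ht.lt_or_eq with h1 | rfl <;> [exact (hf t h1).le; exact h0.le]⟩
  refine (tauThird_strictMonoOn ha).injOn (hmem t ht) (phiThird_mem ha ht) ?_
  rw [tauThird_phiThird ha ht]
  refine le_antisymm (h.tauThird_le hd ha hT h0 hf hp le_rfl ht) ?_
  have hsa : 0 < √a := Real.sqrt_pos.2 ha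
  have hlt := fun t (ht : t ≤ 0) => h.sqrt_neg_lt hd hT h0 hf hp ht
  have hanti : AntitoneOn (fun t => timeThird (√a) (√(-f t)) - t) (Iic 0) := by
    have hder : ∀ t < 0, HasDerivAt (fun t => timeThird (√a) (√(-f t)) - t)
        (3 * p t / (2 * √(-f t) * (√a ^ 3 - √(-f t) ^ 3)) - 1) t := fun t ht =>
      (h.hasDerivAt_timeThird_sqrt hsa (ht.trans hT) (hf t ht) (hlt t ht.le)).sub (hasDerivAt_id t)
    refine antitoneOn_of_deriv_nonpos (convex_Iic 0)
      ((h.continuousOn_timeThird_sqrt hsa hT hlt).sub continuousOn_id) ?_ ?_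
    · rw [interior_Iic]
      exact fun t ht => (hder t ht).differentiableAt.differentiableWithinAt
    · rw [interior_Iic]
      intro t ht
      rw [(hder t ht).deriv, sub_nonpos]
      have hw0 : 0 < √(-f t) := Real.sqrt_pos.2 (by linarith [hf t ht])
      have h3 := pow_lt_pow_left₀ (hlt t (mem_Iio.1 ht).le) hw0.le (n := 3) (by norm_num)
      rw [div_le_iff₀ (mul_pos (by positivity) (by linarith))]
      have := h.p_eq_of_f_neg hd ha hT.le hf ht
      linarith
  have := hanti ht self_mem_Iic ht
  simp only [h0, neg_zero, Real.sqrt_zero, timeThird_zero hsa] at this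
  rw [tauThird_eq_timeThird ha (hmem t ht).2]
  linarith

/-! ### The tanh solution for `α = 1` and the lower comparison -/

lemma phiHalf_eq (a t : ℝ) :
    phiHalf a t = a * ((Real.exp (a * t) - 1) / (Real.exp (a * t) + 1)) := by
  have h1 : Real.exp (a * t) = Real.exp (a * t / 2) * Real.exp (a * t / 2) := by
    rw [← Real.exp_add]
    ring_nf
  have h2 := Real.exp_pos (a * t / 2)
  unfold phiHalf
  rw [Real.tanh_eq_sinh_div_cosh, Real.sinh_eq, Real.cosh_eq, Real.exp_neg, h1]
  congr 1
  field_simp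

/-- This Möbius expression linearises the Riccati equation `2f' = a² - f²`, so its derivative is a
positive multiple of the defect `2p - (a² - f²)`. -/
lemma hasDerivAt_mobius (h : IsTraj α T f p r) {t : ℝ} (ht : t < T) (hfa : f t < a) :
    HasDerivAt (fun t => (a + f t) / (a - f t) * Real.exp (-a * t))
      ((2 * p t - (a ^ 2 - f t ^ 2)) * (a / (a - f t) ^ 2 * Real.exp (-a * t))) t := by
  have hne : a - f t ≠ 0 := by linarith
  refine ((((h.hf t ht).const_add a).div ((h.hf t ht).const_sub a) hne).mul
    (((hasDerivAt_id t).const_mul (-a)).exp)).congr_deriv ?_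
  simp only [id, Pi.div_apply]
  field_simp
  ring

lemma phiHalf_le (h : IsTraj α T f p r) (hd : ExpDecay a l f p r) (ha : 0 < a) (hα : 1 ≤ α)
    (hT : 0 < T) (h0 : f 0 = 0) (hf : ∀ t < 0, f t < 0) {t : ℝ} (ht : t ≤ 0) :
    phiHalf a t ≤ f t := by
  have hf0 : ∀ t ≤ 0, f t < a := fun t ht => by
    rcases ht.lt_or_eq with h1 | rfl <;> [linarith [hf t h1]; linarith]
  have hanti : AntitoneOn (fun t => (a + f t) / (a - f t) * Real.exp (-a * t)) (Iic 0) := by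
    have hder := fun t (ht : t ≤ 0) => h.hasDerivAt_mobius (ht.trans_lt hT) (hf0 t ht)
    have hsub : interior (Iic (0 : ℝ)) ⊆ Iic 0 := interior_subset
    refine antitoneOn_of_deriv_nonpos (convex_Iic 0)
      (fun t ht => (hder t ht).continuousAt.continuousWithinAt)
      (fun t ht => (hder t (hsub ht)).differentiableAt.differentiableWithinAt)
      (fun t ht => ?_)
    have ht' : t ≤ 0 := hsub ht
    rw [(hder t ht').deriv]
    have h1 := h.p_le hd hα (ht'.trans_lt hT)
    exact mul_nonpos_of_nonpos_of_nonneg (by linarith) (by positivity)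
  have h1 := hanti ht self_mem_Iic ht
  have hne : 0 < a - f t := by linarith [hf0 t ht]
  have he : Real.exp (-a * t) = (Real.exp (a * t))⁻¹ := by rw [← Real.exp_neg]; ring_nf
  have hx := Real.exp_pos (a * t)
  simp only [h0, add_zero, sub_zero, mul_zero, Real.exp_zero, mul_one, div_self ha.ne', he] at h1
  rw [← div_eq_mul_inv, le_div_iff₀ hx, one_mul, le_div_iff₀ hne] at h1
  rw [phiHalf_eq, ← mul_div_assoc, div_le_iff₀ (by positivity)]
  linarith

lemma eq_phiHalf (h : IsTraj α T f p r) (hd : ExpDecay a l f p r) (ha : 0 < a) (hα : α = 1)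
    (hT : 0 < T) (h0 : f 0 = 0) (hf : ∀ t < 0, f t < 0) {t : ℝ} (ht : t ≤ 0) :
    f t = phiHalf a t := by
  subst hα
  refine le_antisymm ?_ (h.phiHalf_le hd ha le_rfl hT h0 hf ht)
  have hf0 : ∀ t ≤ 0, f t < a := fun t ht => by
    rcases ht.lt_or_eq with h1 | rfl <;> [linarith [hf t h1]; linarith]
  have hmono : MonotoneOn (fun t => (a + f t) / (a - f t) * Real.exp (-a * t)) (Iic 0) := by
    have hder := fun t (ht : t ≤ 0) => h.hasDerivAt_mobius (ht.trans_lt hT) (hf0 t ht)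
    have hsub : interior (Iic (0 : ℝ)) ⊆ Iic 0 := interior_subset
    refine monotoneOn_of_deriv_nonneg (convex_Iic 0)
      (fun t ht => (hder t ht).continuousAt.continuousWithinAt)
      (fun t ht => (hder t (hsub ht)).differentiableAt.differentiableWithinAt)
      (fun t ht => ?_)
    have ht' : t ≤ 0 := hsub ht
    rw [(hder t ht').deriv]
    have h1 := h.p_eq hd (ht'.trans_lt hT)
    exact mul_nonneg (by linarith) (by positivity)
  have h1 := hmono ht self_mem_Iic ht
  have hne : 0 < a - f t := by linarith [hf0 t ht]
  have he : Real.exp (-a * t) = (Real.exp (a * t))⁻¹ := by rw [← Real.exp_neg]; ring_nf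
  have hx := Real.exp_pos (a * t)
  simp only [h0, add_zero, sub_zero, mul_zero, Real.exp_zero, mul_one, div_self ha.ne', he] at h1
  rw [← div_eq_mul_inv, div_le_iff₀ hx, one_mul, div_le_iff₀ hne] at h1
  rw [phiHalf_eq, ← mul_div_assoc, le_div_iff₀ (by positivity)]
  linarith

/-! ### Blow-up time for `α = 2` -/

/-- The blow-up time of the exact solution for `α = 2`. -/
lemma blowUp_time_third (h : IsTraj 2 T f p r) (hd : ExpDecay a l f p r) (ha : 0 < a) (hT : 0 < T)
    (h0 : f 0 = 0) (hlim : Tendsto f (𝓝[<] T) atBot) : T = 2 * Real.pi * √3 / (3 * a) := by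
  have hsa : 0 < √a := Real.sqrt_pos.2 ha
  have hsa2 : √a ^ 2 = a := Real.sq_sqrt ha.le
  have hp0 : p 0 = 0 := by
    have := h.sq_eq hd hT
    rw [h0] at this
    have h1 : p 0 ^ 2 = 0 := by linarith
    exact pow_eq_zero_iff two_ne_zero |>.1 h1
  have hne : f 0 ≠ -a := by rw [h0]; linarith
  have hp : ∀ t, 0 < t → t < T → p t < 0 := fun t h1 h2 =>
    h.p_neg_of_nonpos hd one_lt_two hT hne h2 hp0.le h1
  have hanti : ∀ t, 0 < t → t < T → f t < 0 := by
    intro t h1 h2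
    have : StrictAntiOn f (Icc 0 t) := by
      refine strictAntiOn_of_deriv_neg (convex_Icc 0 t)
        (fun s hs => (h.continuousAt (hs.2.trans_lt h2)).1.continuousWithinAt) (fun s hs => ?_)
      rw [interior_Icc] at hs
      rw [(h.hf s (hs.2.trans h2)).deriv]
      exact hp s hs.1 (hs.2.trans h2)
    have := this ⟨le_rfl, h1.le⟩ ⟨h1.le, le_rfl⟩ h1
    linarith
  have hq0 : ∀ t, 0 < t → t < T → 3 / 2 * p t + f t ^ 2 ≠ 0 := by
    intro t h1 h2 h3
    have h4 := h.sq_eq hd h2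
    rw [h3] at h4
    have := mul_pos (pow_pos ha 3) (neg_pos.2 (hanti t h1 h2))
    linarith
  -- The squared relation leaves two branches for `3p/2 + f²`. The nonnegative one requires `f <
  -- -a`, which fails just after `0`; as the expression has no zero for `t > 0`, the negative branch
  -- persists up to `T`.
  have hqabs : ∀ t, 0 < t → t < T → 0 ≤ 3 / 2 * p t + f t ^ 2 → f t < -a := by
    intro t h1 h2 h3
    have h4 := h.sq_eq hd h2
    by_contra! hcon
    have h5 := hp t h1 h2
    have h6 := hanti t h1 h2
    have h7 : (3 / 2 * p t + f t ^ 2) ^ 2 < (f t ^ 2) ^ 2 :=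
      pow_lt_pow_left₀ (by linarith) h3 two_ne_zero
    have h8 : (-f t) ^ 3 ≤ a ^ 3 := pow_le_pow_left₀ (by linarith) (by linarith) 3
    nlinarith
  have hq : ∀ t, 0 < t → t < T → 3 / 2 * p t + f t ^ 2 < 0 := by
    intro t h1 h2
    have hcont : ∀ᶠ s in 𝓝[>] 0, -a < f s :=
      ((h.continuousAt hT).1.tendsto.mono_left nhdsWithin_le_nhds).eventually_const_lt (by linarith)
    obtain ⟨s, hs1, hs2⟩ := (hcont.and (Ioo_mem_nhdsGT h1)).exists
    have hs3 : 3 / 2 * p s + f s ^ 2 < 0 := by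
      by_contra! hcon
      linarith [hqabs s hs2.1 (hs2.2.trans h2) hcon]
    by_contra! hcon
    obtain ⟨x, hx1, hx2, hx3, -⟩ := exists_first_zero hs2.2.le
      (h := fun t => 3 / 2 * p t + f t ^ 2) (fun x hx => by
        obtain ⟨c1, c2, -⟩ := h.continuousAt (hx.2.trans_lt h2)
        exact ((continuousAt_const.mul c2).add (c1.pow 2)).continuousWithinAt) hs3 hcon
    exact hq0 x (hs2.1.trans hx1) (hx2.trans_lt h2) hx3
  have hpz : ∀ t, 0 < t → t < T → 3 * p t = -(2 * √(-f t) * (√a ^ 3 + √(-f t) ^ 3)) := by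
    intro t h1 h2
    have hf := hanti t h1 h2
    set z := √(-f t) with hz
    have hz0 : 0 < z := Real.sqrt_pos.2 (by linarith)
    have hz2 : f t = -z ^ 2 := by rw [hz, Real.sq_sqrt (by linarith)]; ring
    have h4 := h.sq_eq hd h2
    have h5 : (√a ^ 3 * z) ^ 2 = a ^ 3 * z ^ 2 := by
      rw [mul_pow, ← pow_mul, mul_comm 3 2, pow_mul, hsa2]
    have h6 : (3 / 2 * p t + f t ^ 2) ^ 2 = (√a ^ 3 * z) ^ 2 := by
      rw [h4, h5, hz2]
      ring
    have hpos : 0 < √a ^ 3 * z := by positivity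
    have h7 := hq t h1 h2
    have h8 : 3 / 2 * p t + f t ^ 2 = -(√a ^ 3 * z) := by
      rcases sq_eq_sq_iff_eq_or_eq_neg.1 h6 with h9 | h9
      · linarith
      · exact h9
    rw [hz2] at h8
    linarith
  -- After the zero the signed variable is `w = -√(-f)`, and the negative branch is exactly the
  -- equation whose clock is `timeThird`.
  have htime : ∀ t, 0 ≤ t → t < T → timeThird (√a) (-√(-f t)) = t := by
    have hlt : ∀ t, -√(-f t) < √a := fun t => by linarith [Real.sqrt_nonneg (-f t)]
    have hcont : ∀ t < T, ContinuousAt (fun t => timeThird (√a) (-√(-f t)) - t) t := fun t ht =>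
      ((hasDerivAt_timeThird hsa (hlt t)).continuousAt.comp_of_eq
        ((h.continuousAt ht).1.neg.sqrt.neg) rfl).sub continuousAt_id
    have hder : ∀ t, 0 < t → t < T →
        HasDerivAt (fun t => timeThird (√a) (-√(-f t)) - t) 0 t := by
      intro t h1 h2
      have hf := hanti t h1 h2
      have hz0 : 0 < √(-f t) := Real.sqrt_pos.2 (by linarith)
      refine (((hasDerivAt_timeThird hsa (hlt t)).comp t
        (h.hasDerivAt_sqrt_neg h2 hf).neg).sub (hasDerivAt_id t)).congr_deriv ?_
      have h3 := hpz t h1 h2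
      have h4 : √a ^ 3 - (-√(-f t)) ^ 3 = √a ^ 3 + √(-f t) ^ 3 := by ring
      rw [h4]
      field_simp
      linarith
    intro t h1 h2
    rcases h1.lt_or_eq with h1 | rfl
    · have hm : ∀ x ∈ Icc 0 t, timeThird (√a) (-√(-f x)) - x =
          timeThird (√a) (-√(-f 0)) - 0 := by
        have hdiff : ∀ x ∈ interior (Icc 0 t),
            HasDerivAt (fun t => timeThird (√a) (-√(-f t)) - t) 0 x := fun x hx => by
          rw [interior_Icc] at hx
          exact hder x hx.1 (hx.2.trans h2)
        have hc : ContinuousOn (fun t => timeThird (√a) (-√(-f t)) - t) (Icc 0 t) :=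
          fun x hx => (hcont x (hx.2.trans_lt h2)).continuousWithinAt
        have hm1 := monotoneOn_of_deriv_nonneg (convex_Icc 0 t) hc
          (fun x hx => (hdiff x hx).differentiableAt.differentiableWithinAt)
          (fun x hx => (hdiff x hx).deriv.ge)
        have hm2 := antitoneOn_of_deriv_nonpos (convex_Icc 0 t) hc
          (fun x hx => (hdiff x hx).differentiableAt.differentiableWithinAt)
          (fun x hx => (hdiff x hx).deriv.le)
        exact fun x hx => le_antisymm (hm2 ⟨le_rfl, h1.le⟩ hx hx.1) (hm1 ⟨le_rfl, h1.le⟩ hx hx.1)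
      have := hm t ⟨h1.le, le_rfl⟩
      rw [h0, neg_zero, Real.sqrt_zero, neg_zero, timeThird_zero hsa] at this
      linarith
    · rw [h0, neg_zero, Real.sqrt_zero, neg_zero, timeThird_zero hsa]
  have hz : Tendsto (fun t => -√(-f t)) (𝓝[<] T) atBot :=
    tendsto_neg_atTop_atBot.comp (Real.tendsto_sqrt_atTop.comp (tendsto_neg_atBot_atTop.comp hlim))
  have hl1 := (tendsto_timeThird_atBot hsa).comp hz
  rw [hsa2] at hl1
  have hl2 : Tendsto (fun t : ℝ => t) (𝓝[<] T) (𝓝 T) := tendsto_id.mono_left nhdsWithin_le_nhds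
  refine tendsto_nhds_unique (hl2.congr' ?_) hl1
  filter_upwards [Ioo_mem_nhdsLT hT] with t ht using (htime t ht.1.le ht.2).symm

end IsTraj

/-! ### Lower bound of the blow-up time for `1 < α < 2` -/

lemma le_of_forall_lt_of_continuousAt {h : ℝ → ℝ} {c s : ℝ} (hc : ContinuousAt h s)
    (hle : ∀ t < s, c ≤ h t) : c ≤ h s :=
  ge_of_tendsto (hc.tendsto.mono_left (nhdsWithin_le_nhds (s := Iio s)))
    (eventually_of_mem self_mem_nhdsWithin hle)

lemma le_of_hasDerivAt_nonneg_Icc {h h' : ℝ → ℝ} {x y : ℝ} (hxy : x ≤ y)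
    (hd : ∀ t ∈ Icc x y, HasDerivAt h (h' t) t) (hn : ∀ t ∈ Ioo x y, 0 ≤ h' t) : h x ≤ h y := by
  refine monotoneOn_of_deriv_nonneg (convex_Icc x y)
    (fun t ht => (hd t ht).continuousAt.continuousWithinAt) ?_ ?_ ⟨le_rfl, hxy⟩ ⟨hxy, le_rfl⟩ hxy
  · rw [interior_Icc]
    exact fun t ht => (hd t (Ioo_subset_Icc_self ht)).differentiableAt.differentiableWithinAt
  · rw [interior_Icc]
    intro t ht
    rw [(hd t (Ioo_subset_Icc_self ht)).deriv]
    exact hn t ht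

lemma ExpDecay.scale {a l : ℝ} {f p r : ℝ → ℝ} (h : ExpDecay a l f p r) {c : ℝ} (hc : 0 < c) :
    ExpDecay (c * a) (c * l) (fun t => c * f (c * t)) (fun t => c ^ 2 * p (c * t))
      (fun t => c ^ 3 * r (c * t)) := by
  have ht : Tendsto (fun t : ℝ => c * t) atBot atBot := tendsto_id.const_mul_atBot hc
  have he : (fun t : ℝ => Real.exp (c * l * t)) = (fun t => Real.exp (l * t)) ∘ (fun t => c * t) := by
    ext t
    simp only [Function.comp]
    ring_nf
  refine ⟨mul_pos hc h.pos, ?_, ?_, ?_⟩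
  · rw [he]
    have := (h.hf.comp_tendsto ht).const_mul_left c
    refine this.congr_left fun t => ?_
    simp only [Function.comp]
    ring
  · rw [he]
    exact (h.hp.comp_tendsto ht).const_mul_left (c ^ 2)
  · rw [he]
    exact (h.hr.comp_tendsto ht).const_mul_left (c ^ 3)

namespace IsTraj

variable {α T a l : ℝ} {f p r : ℝ → ℝ}

/-- For `f < 0` the bound `p ≤ (1 - f²) / 2` gives `G' ≥ (2 - α) f p (1 - f²) / 2`, an exact
derivative in `t`. -/
lemma G_ge (h : IsTraj α T f p r) (hd : ExpDecay 1 l f p r) (hα : 1 ≤ α) (hα2 : α ≤ 2) (hT : 0 < T)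
    (hf : ∀ t < 0, f t < 0) (hp : ∀ t < 0, 0 < p t) {t : ℝ} (ht : t < 0) :
    -((2 - α) * (1 - f t ^ 2) ^ 2 / 8) ≤ f t * r t - p t ^ 2 / 2 + f t ^ 2 * p t := by
  have := le_of_hasDerivAt_nonneg_of_tendsto (T := 0) (c := 0)
    (h := fun t => f t * r t - p t ^ 2 / 2 + f t ^ 2 * p t + (2 - α) / 8 * (1 - f t ^ 2) ^ 2)
    (fun t ht => (h.hasDerivAt_G (ht.trans hT)).add
      (((((h.hf t (ht.trans hT)).pow 2).const_sub 1).pow 2).const_mul ((2 - α) / 8)))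
    (fun t ht => ?_) ?_ ht
  · linarith
  · have h1 := h.p_le hd hα (ht.trans hT)
    have h2 : 0 ≤ (2 - α) * (-f t) * p t :=
      mul_nonneg (mul_nonneg (by linarith) (by linarith [hf t ht])) (hp t ht).le
    have h3 := mul_nonneg h2 (sub_nonneg.2 h1)
    push_cast
    simp only [Pi.pow_apply]
    linarith
  · have := hd.tendsto_G.add ((((hd.tendsto_f.pow 2).const_sub 1).pow 2).const_mul ((2 - α) / 8))
    norm_num at this
    exact this

/-- Bounds for the slope at the zero of the profile. -/
lemma p_zero_bounds (h : IsTraj α T f p r) (hd : ExpDecay 1 l f p r) (hα : 1 ≤ α) (hα2 : α ≤ 2)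
    (hT : 0 < T) (h0 : f 0 = 0) (hf : ∀ t < 0, f t < 0) (hp : ∀ t < 0, 0 < p t) :
    (2 - α) / 5 ≤ p 0 ^ 2 ∧ p 0 ^ 2 ≤ (2 - α) / 4 := by
  obtain ⟨c1, c2, c3⟩ := h.continuousAt hT
  have cG : ContinuousAt (fun t => f t * r t - p t ^ 2 / 2 + f t ^ 2 * p t) 0 :=
    (h.hasDerivAt_G hT).continuousAt
  constructor
  · have hlim : Tendsto (fun t => √(-f t)) atBot (𝓝 1) := by
      have := hd.tendsto_f.neg.sqrt
      rwa [neg_neg, Real.sqrt_one] at this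
    -- At zero `G = -p² / 2`. Replacing one factor `p` in `G'` by its lower bound gives an exact
    -- derivative in `w`; the total between `w = 1` and `w = 0` is `(4/3)(1/5 - 1/8) = 1/10`.
    have key : ∀ t < 0, (2 - α) / 10 ≤ 4 * (2 - α) / 3 * (√(-f t) ^ 5 / 5 - √(-f t) ^ 8 / 8)
        - (f t * r t - p t ^ 2 / 2 + f t ^ 2 * p t) := by
      intro t ht
      refine le_of_hasDerivAt_nonneg_of_tendsto (T := 0) (h := fun t =>
        4 * (2 - α) / 3 * (√(-f t) ^ 5 / 5 - √(-f t) ^ 8 / 8)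
        - (f t * r t - p t ^ 2 / 2 + f t ^ 2 * p t)) (fun t ht =>
        (((((h.hasDerivAt_sqrt_neg (ht.trans hT) (hf t ht)).pow 5).div_const 5).sub
        (((h.hasDerivAt_sqrt_neg (ht.trans hT) (hf t ht)).pow 8).div_const 8)).const_mul
        (4 * (2 - α) / 3)).sub (h.hasDerivAt_G (ht.trans hT))) (fun t ht => ?_) ?_ ht
      · have hft := hf t ht
        have h1 := h.p_ge hd one_pos hα2 hT.le hf ht
        rw [Real.sqrt_one, one_pow] at h1
        set w := √(-f t) with hw
        have hw0 : 0 < w := Real.sqrt_pos.2 (by linarith)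
        have hw2 : f t = -w ^ 2 := by rw [hw, Real.sq_sqrt (by linarith)]; ring
        have h2 : 0 ≤ (2 - α) * w ^ 2 * p t :=
          mul_nonneg (mul_nonneg (by linarith) (by positivity)) (hp t ht).le
        have h3 := mul_nonneg h2 (sub_nonneg.2 h1)
        rw [hw2]
        push_cast
        have e : 4 * (2 - α) / 3 * (5 * w ^ (5 - 1) * (-p t / (2 * w)) / 5 -
            8 * w ^ (8 - 1) * (-p t / (2 * w)) / 8) = -(2 / 3) * (2 - α) * w ^ 3 * (1 - w ^ 3) * p t := by
          field_simp
          ring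
        rw [e]
        linarith
      · have := ((((hlim.pow 5).div_const 5).sub ((hlim.pow 8).div_const 8)).const_mul
          (4 * (2 - α) / 3)).sub hd.tendsto_G
        rwa [show 4 * (2 - α) / 3 * ((1 : ℝ) ^ 5 / 5 - 1 ^ 8 / 8) - 0 = (2 - α) / 10 by ring] at this
    have := le_of_forall_lt_of_continuousAt ((continuousAt_const.mul (((c1.neg.sqrt.pow 5).div_const 5).sub
      ((c1.neg.sqrt.pow 8).div_const 8))).sub cG) key
    simp [h0] at this
    linarith
  · have key : ∀ t < 0, 0 ≤ f t * r t - p t ^ 2 / 2 + f t ^ 2 * p t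
        + (2 - α) / 8 * (1 - f t ^ 2) ^ 2 := fun t ht => by
      have := h.G_ge hd hα hα2 hT hf hp ht
      linarith
    have := le_of_forall_lt_of_continuousAt
      (cG.add (continuousAt_const.mul ((continuousAt_const.sub (c1.pow 2)).pow 2))) key
    simp [h0] at this
    linarith

/-- A converse to `p_ge` with an error that vanishes at `α = 2`. The excess `σ = p / (2w) + w³/3 -
1/3` has derivative `-G / (2w³)`, and `σ ≤ p / (2w)`; so `(σ²)'` is bounded through `G_ge` by the
derivative of `(2 - α) (1/w - w)² / 16`. -/
lemma p_upper (h : IsTraj α T f p r) (hd : ExpDecay 1 l f p r) (hα : 1 ≤ α) (hα2 : α ≤ 2)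
    (hT : 0 < T) (h0 : f 0 = 0) (hf : ∀ t < 0, f t < 0) (hp : ∀ t < 0, 0 < p t) {t : ℝ} (ht : t < 0) :
    p t ≤ 2 * √(-f t) / 3 * (1 - √(-f t) ^ 3) + √(2 - α) / 2 * (1 + f t) := by
  have hlim : Tendsto (fun t => √(-f t)) atBot (𝓝 1) := by
    have := hd.tendsto_f.neg.sqrt
    rwa [neg_neg, Real.sqrt_one] at this
  have hw0 : ∀ t < 0, 0 < √(-f t) := fun t ht => Real.sqrt_pos.2 (by linarith [hf t ht])
  have hw2 : ∀ t < 0, f t = -√(-f t) ^ 2 := fun t ht => by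
    rw [Real.sq_sqrt (by linarith [hf t ht])]; ring
  have hw1 : ∀ t < 0, √(-f t) < 1 := fun t ht => by
    have := h.sqrt_neg_lt hd hT h0 hf hp ht.le
    rwa [Real.sqrt_one] at this
  have hX := tendsto_X hd one_pos
  rw [Real.sqrt_one] at hX
  have hX0 : ∀ t < 0, 0 ≤ p t / (2 * √(-f t)) + √(-f t) ^ 3 / 3 - 1 / 3 := fun t ht => by
    have := h.le_X hd one_pos hα2 hT.le hf ht
    rw [Real.sqrt_one, one_pow] at this
    linarith
  have key := le_of_hasDerivAt_nonneg_of_tendsto (T := 0) (c := 0) (h := fun t =>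
      (2 - α) / 16 * ((√(-f t))⁻¹ - √(-f t)) ^ 2
        - (p t / (2 * √(-f t)) + √(-f t) ^ 3 / 3 - 1 / 3) ^ 2) (fun t ht =>
      ((((h.hasDerivAt_sqrt_neg (ht.trans hT) (hf t ht)).inv (hw0 t ht).ne').sub
        (h.hasDerivAt_sqrt_neg (ht.trans hT) (hf t ht))).pow 2 |>.const_mul ((2 - α) / 16)).sub
      (((h.hasDerivAt_X (ht.trans hT) (hf t ht)).sub_const (1 / 3)).pow 2)) (fun t ht => ?_) ?_ ht
  · have hσ := hX0 t ht
    have hw := hw0 t ht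
    have hf2 := hw2 t ht
    have hlt := hw1 t ht
    have e1 : (√(-f t))⁻¹ - √(-f t) = (1 - √(-f t) ^ 2) / √(-f t) := by field_simp
    have e2 : (2 - α) / 16 * ((√(-f t))⁻¹ - √(-f t)) ^ 2 =
        (√(2 - α) / 4 * ((1 - √(-f t) ^ 2) / √(-f t))) ^ 2 := by
      have : √(2 - α) ^ 2 = 2 - α := Real.sq_sqrt (by linarith)
      rw [e1, mul_pow, div_pow √(2 - α), this]
      norm_num
    have h1 : 0 ≤ √(2 - α) / 4 * ((1 - √(-f t) ^ 2) / √(-f t)) :=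
      mul_nonneg (by positivity) (div_nonneg (by nlinarith) hw.le)
    have h2 : p t / (2 * √(-f t)) + √(-f t) ^ 3 / 3 - 1 / 3
        ≤ √(2 - α) / 4 * ((1 - √(-f t) ^ 2) / √(-f t)) := by
      refine le_of_sq_le_sq ?_ h1
      linarith
    generalize √(-f t) = w at *
    rw [hf2]
    have h3 := mul_le_mul_of_nonneg_left h2 (show 0 ≤ 2 * w by positivity)
    have e3 : 2 * w * (p t / (2 * w) + w ^ 3 / 3 - 1 / 3) = p t + 2 * w * (w ^ 3 / 3 - 1 / 3) := by
      field_simp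
      ring
    have e4 : 2 * w * (√(2 - α) / 4 * ((1 - w ^ 2) / w)) = √(2 - α) / 2 * (1 - w ^ 2) := by
      field_simp
      ring
    linarith
  · have hσ := hX0 t ht
    have hG := h.G_ge hd hα hα2 hT hf hp ht
    have hG' := h.G_nonpos hd hα2 hT.le hf ht
    have hw := hw0 t ht
    have hf2 := hw2 t ht
    have hlt := hw1 t ht
    have hpt := hp t ht
    simp only [Pi.sub_apply, Pi.inv_apply]
    generalize f t * r t - p t ^ 2 / 2 + f t ^ 2 * p t = G at *
    generalize √(-f t) = w at *
    rw [hf2] at hG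
    have hw4 : w ^ 4 < 1 := pow_lt_one₀ hw.le hlt (by norm_num)
    have hw3 : w ^ 3 < 1 := pow_lt_one₀ hw.le hlt (by norm_num)
    have e1 : (2 - α) / 16 * (((2 : ℕ) : ℝ) * (w⁻¹ - w) ^ (2 - 1) * (-(-p t / (2 * w)) / w ^ 2 - -p t / (2 * w)))
        = (2 - α) / 16 * (1 - w ^ 4) * (p t / w ^ 4) := by
      push_cast
      field_simp
      ring
    have h1 : ((2 : ℕ) : ℝ) * (p t / (2 * w) + w ^ 3 / 3 - 1 / 3) ^ (2 - 1) * (-G / (2 * w ^ 3))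
        ≤ (-G / 2) * (p t / w ^ 4) := by
      have e2 : (-G / 2) * (p t / w ^ 4) = 2 * (p t / (2 * w)) * (-G / (2 * w ^ 3)) := by
        field_simp
      rw [e2]
      push_cast
      refine mul_le_mul_of_nonneg_right ?_ (div_nonneg (by linarith) (by positivity))
      norm_num
      linarith
    have h2 : -G / 2 ≤ (2 - α) / 16 * (1 - w ^ 4) := by
      have : (2 - α) * (1 - w ^ 4) ^ 2 ≤ (2 - α) * (1 - w ^ 4) :=
        mul_le_mul_of_nonneg_left (by nlinarith [pow_pos hw 4]) (by linarith)
      have e : (2 - α) * (1 - (-w ^ 2) ^ 2) ^ 2 = (2 - α) * (1 - w ^ 4) ^ 2 := by ring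
      rw [e] at hG
      linarith
    have h3 := mul_le_mul_of_nonneg_right h2 (show 0 ≤ p t / w ^ 4 by positivity)
    have := h1.trans h3
    rw [← e1] at this
    simpa using this
  · have h1 := (((hlim.inv₀ one_ne_zero).sub hlim).pow 2).const_mul ((2 - α) / 16)
    have h2 := (hX.sub_const (1 / 3)).pow 2
    have h3 := h1.sub h2
    norm_num at h3
    simpa using h3

/-- A bound for the curvature at the zero of the profile. -/
lemma r_zero_ge (h : IsTraj α T f p r) (hd : ExpDecay 1 l f p r) (hα : 1 ≤ α) (hα2 : α ≤ 2)
    (hT : 0 < T) (h0 : f 0 = 0) (hf : ∀ t < 0, f t < 0) (hp : ∀ t < 0, 0 < p t) :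
    -((α - 1) * (2 / 9 + √(2 - α) / 4)) ≤ r 0 := by
  have hlim : Tendsto (fun t => √(-f t)) atBot (𝓝 1) := by
    have := hd.tendsto_f.neg.sqrt
    rwa [neg_neg, Real.sqrt_one] at this
  obtain ⟨c1, c2, c3⟩ := h.continuousAt hT
  -- One factor `p` of `E' = -(α - 1) p²` is replaced by its upper bound and the rest integrated in
  -- `f` over `(-1, 0)`: the exact slope contributes `2/9` and the error `√(2 - α) / 4`.
  have key : ∀ t < 0, -((α - 1) * (2 / 9 + √(2 - α) / 4)) ≤ r t + f t * p t
      + (α - 1) * (4 / 3 * (√(-f t) ^ 6 / 6 - √(-f t) ^ 3 / 3)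
        + √(2 - α) / 2 * (f t + f t ^ 2 / 2)) := by
    intro t ht
    refine le_of_hasDerivAt_nonneg_of_tendsto (T := 0) (h := fun t => r t + f t * p t
      + (α - 1) * (4 / 3 * (√(-f t) ^ 6 / 6 - √(-f t) ^ 3 / 3)
        + √(2 - α) / 2 * (f t + f t ^ 2 / 2))) (fun t ht => (h.hasDerivAt_E (ht.trans hT)).add
      ((((((h.hasDerivAt_sqrt_neg (ht.trans hT) (hf t ht)).pow 6).div_const 6).sub
        (((h.hasDerivAt_sqrt_neg (ht.trans hT) (hf t ht)).pow 3).div_const 3)).const_mul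
        (4 / 3)).add (((h.hf t (ht.trans hT)).add
        (((h.hf t (ht.trans hT)).pow 2).div_const 2)).const_mul (√(2 - α) / 2))
        |>.const_mul (α - 1))) (fun t ht => ?_) ?_ ht
    · have hup := h.p_upper hd hα hα2 hT h0 hf hp ht
      have hw : 0 < √(-f t) := Real.sqrt_pos.2 (by linarith [hf t ht])
      have h1 := mul_nonneg (mul_nonneg (sub_nonneg.2 hα) (hp t ht).le) (sub_nonneg.2 hup)
      generalize √(-f t) = w at *
      push_cast
      have e : 4 / 3 * (6 * w ^ (6 - 1) * (-p t / (2 * w)) / 6 - 3 * w ^ (3 - 1) * (-p t / (2 * w)) / 3)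
          = 2 * w / 3 * (1 - w ^ 3) * p t := by
        field_simp
        ring
      rw [e]
      norm_num
      linarith
    · have := hd.tendsto_E.add (((((hlim.pow 6).div_const 6).sub
        ((hlim.pow 3).div_const 3)).const_mul (4 / 3)).add ((hd.tendsto_f.add
        ((hd.tendsto_f.pow 2).div_const 2)).const_mul (√(2 - α) / 2)) |>.const_mul (α - 1))
      refine this.trans_eq ?_
      congr 1
      ring
  have := le_of_forall_lt_of_continuousAt ((c3.add (c1.mul c2)).add (continuousAt_const.mul
    ((continuousAt_const.mul (((c1.neg.sqrt.pow 6).div_const 6).sub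
      ((c1.neg.sqrt.pow 3).div_const 3))).add
    (continuousAt_const.mul (c1.add ((c1.pow 2).div_const 2)))))) key
  simp [h0] at this
  linarith

end IsTraj

/-- The numerical inequality behind the lower bound of the blow-up time. -/
lemma blowUp_numerics {e q k M c P : ℝ} (he : 0 < e) (he1 : e < 1) (hq : 0 < q)
    (hq1 : e ^ 2 / 5 ≤ q ^ 2) (hq2 : q ^ 2 ≤ e ^ 2 / 4) (hM : 0 < M) (hc : 0 < c) (hk : 0 < k)
    (hMk : M * k ≤ q ^ 2 / 2) (hkM : k ≤ (1 - e ^ 2) * (2 / 9 + e / 4) + (1 - e ^ 2) * q * M)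
    (hck : q - M ^ 2 / 2 ≤ c * k) (hP : P < 3.63) (hP0 : 0 < P)
    (hcP : c ≤ P * (3 / 2 * k - 1 / 3)) :
    False := by
  -- Otherwise the last hypothesis would force `c ≤ 0`. With this bound `M` is of order `q²`, hence
  -- all quantities are controlled by `e = √(2 - α)`; the constant `0.447` below is just under `1 /
  -- √5`.
  have hk29 : 2 / 9 < k := by
    by_contra! hcon
    nlinarith
  have hqe : q ≤ e / 2 := abs_le_of_sq_le_sq' (by linarith [show (e / 2) ^ 2 = e ^ 2 / 4 by ring])
    (by linarith) |>.2
  have hqe' : 0.447 * e ≤ q := by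
    refine le_of_sq_le_sq ?_ hq.le
    nlinarith
  have hM2 : M ≤ 9 / 4 * q ^ 2 := by nlinarith
  have hqM : q * M ≤ 9 / 32 * e ^ 3 := by
    have h1 : q * M ≤ q * (9 / 4 * q ^ 2) := mul_le_mul_of_nonneg_left hM2 hq.le
    have h2 : q ^ 3 ≤ (e / 2) ^ 3 := pow_le_pow_left₀ hq.le hqe 3
    nlinarith
  have hκ : k ≤ (1 - e ^ 2) * (2 / 9 + e / 4 + 9 / 32 * e ^ 3) := by
    have := mul_le_mul_of_nonneg_left hqM (show 0 ≤ 1 - e ^ 2 by nlinarith)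
    linarith
  have he5 : 0 < e ^ 5 := by positivity
  have hy : 3 / 2 * k - 1 / 3 ≤ e * (0.375 - 0.286 * e) := by
    have : e ^ 3 ≤ e ^ 2 := pow_le_pow_of_le_one he.le he1.le (by norm_num)
    nlinarith
  have hk3 : k ≤ 0.305 := by nlinarith [sq_nonneg (e - 0.656)]
  have hy0 : 0 < 3 / 2 * k - 1 / 3 := by linarith
  have h1 : c * k ≤ 3.63 * (e * (0.375 - 0.286 * e)) * 0.305 :=
    mul_le_mul (hcP.trans (mul_le_mul hP.le hy hy0.le (by norm_num))) hk3 hk.le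
      (by linarith)
  have h2 : q - 81 / 32 * q ^ 4 ≤ c * k := by
    have : M ^ 2 ≤ (9 / 4 * q ^ 2) ^ 2 := pow_le_pow_left₀ hM.le hM2 2
    linarith
  have hq3 : q ^ 3 ≤ (e / 2) ^ 3 := pow_le_pow_left₀ hq.le hqe 3
  have he3 : e ^ 3 ≤ e := by
    simpa using pow_le_pow_of_le_one he.le he1.le (show 1 ≤ 3 by norm_num)
  have h3 : 0.447 * e * (1 - 81 / 256 * e ^ 3) ≤ q * (1 - 81 / 32 * q ^ 3) := by
    refine mul_le_mul hqe' ?_ ?_ hq.le <;> linarith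
  have h4 : e * (0.447 * (1 - 81 / 256 * e ^ 3)) ≤ e * (3.63 * (0.375 - 0.286 * e) * 0.305) := by
    linarith
  have h5 := le_of_mul_le_mul_left h4 he
  linarith

namespace IsTraj

variable {α T T₂ a l : ℝ} {f p r φ π ρ : ℝ → ℝ}

/-- Comparison of a trajectory starting at a positive maximum with a trajectory for `α = 2` starting
at zero with zero slope and larger curvature. -/
lemma lt_of_critical (h : IsTraj α T f p r) (h₂ : IsTraj 2 T₂ φ π ρ) (hα2 : α ≤ 2)
    (hf0 : 0 < f 0) (hp0 : p 0 = 0) (hφ0 : φ 0 = 0) (hπ0 : π 0 = 0) (hρ : ρ 0 < r 0)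
    (hp : ∀ t, 0 < t → t < T → p t < 0) {t : ℝ} (ht0 : 0 ≤ t) (ht : t < T) (ht₂ : t < T₂) :
    φ t < f t := by
  obtain ⟨A, hA⟩ := h.exists_antideriv
  obtain ⟨B, hB⟩ := h₂.exists_antideriv
  -- the conclusion from nonnegativity of the difference of the slopes
  have step : ∀ s, 0 < s → s < T → s < T₂ → (∀ x, 0 ≤ x → x ≤ s → π x ≤ p x) →
      0 < p s - π s := by
    intro s hs0 hs hs₂ hx
    have hD : ∀ x ∈ Icc 0 s, f 0 ≤ f x - φ x := by
      intro x hx'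
      have := le_of_hasDerivAt_nonneg_Icc (x := 0) (y := x) (h := fun t => f t - φ t) hx'.1
        (fun t ht => (h.hf t (ht.2.trans_lt (hx'.2.trans_lt hs))).sub
          (h₂.hf t (ht.2.trans_lt (hx'.2.trans_lt hs₂))))
        (fun t ht => sub_nonneg.2 (hx t ht.1.le (ht.2.le.trans hx'.2)))
      simpa [hφ0] using this
    have hps : ∀ x ∈ Icc 0 s, p x ≤ 0 := by
      intro x hx'
      rcases hx'.1.lt_or_eq with h1 | rfl
      · exact (hp x h1 (hx'.2.trans_lt hs)).le
      · exact hp0.le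
    have hE : ∀ x ∈ Icc 0 s, r 0 - ρ 0 ≤ (r x + f x * p x) - (ρ x + φ x * π x) := by
      intro x hx'
      have := le_of_hasDerivAt_nonneg_Icc (x := 0) (y := x)
        (h := fun t => (r t + f t * p t) - (ρ t + φ t * π t)) hx'.1
        (fun t ht => (h.hasDerivAt_E (ht.2.trans_lt (hx'.2.trans_lt hs))).sub
          (h₂.hasDerivAt_E (ht.2.trans_lt (hx'.2.trans_lt hs₂))))
        (fun t ht => by
          have h1 := hx t ht.1.le (ht.2.le.trans hx'.2)
          have h2 := hps t ⟨ht.1.le, ht.2.le.trans hx'.2⟩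
          have h3 : p t ^ 2 ≤ π t ^ 2 := by nlinarith
          nlinarith [sq_nonneg (p t)])
      simpa [hφ0, hp0] using this
    -- As long as `π ≤ p ≤ 0` the difference of the `E`'s does not decrease. Splitting `f p - φ π`
    -- into `(p + π)/2 · (f - φ)` and `(f + φ)/2 · (p - π)`, the second part is absorbed by the
    -- integrating factor and the first has the favourable sign.
    have hmono : StrictMonoOn (fun t => (p t - π t) * Real.exp ((A t + B t) / 2)) (Icc 0 s) := by
      have hder : ∀ x ∈ Icc 0 s, HasDerivAt (fun t => (p t - π t) * Real.exp ((A t + B t) / 2))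
          (((r x + f x * p x) - (ρ x + φ x * π x) - (p x + π x) / 2 * (f x - φ x)) *
            Real.exp ((A x + B x) / 2)) x := by
        intro x hx'
        have h1 := hx'.2.trans_lt hs
        have h2 := hx'.2.trans_lt hs₂
        refine (((h.hp x h1).sub (h₂.hp x h2)).mul
          (((hA x h1).add (hB x h2)).div_const 2).exp).congr_deriv ?_
        simp only [Pi.sub_apply, Pi.add_apply]
        ring
      refine strictMonoOn_of_deriv_pos (convex_Icc 0 s)
        (fun x hx => (hder x hx).continuousAt.continuousWithinAt) (fun x hx' => ?_)
      have hx' := interior_subset hx'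
      rw [(hder x hx').deriv]
      have h1 := hE x hx'
      have h2 := hD x hx'
      have h3 := hps x hx'
      have h4 := hx x hx'.1 hx'.2
      have h5 : (p x + π x) / 2 * (f x - φ x) ≤ 0 :=
        mul_nonpos_of_nonpos_of_nonneg (by linarith) (by linarith)
      exact mul_pos (by linarith) (Real.exp_pos _)
    have := hmono ⟨le_rfl, hs0.le⟩ ⟨hs0.le, le_rfl⟩ hs0
    simp only [hp0, hπ0, sub_self, zero_mul] at this
    exact (mul_pos_iff_of_pos_right (Real.exp_pos _)).1 this
  rcases ht0.lt_or_eq with ht0 | rfl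
  swap
  · rw [hφ0]; exact hf0
  have hge : ∀ s, 0 ≤ s → s ≤ t → π s ≤ p s := by
    by_contra! hcon
    obtain ⟨s, hs0, hst, hs⟩ := hcon
    have hTm : (0 : ℝ) < T := ht0.trans ht
    have hTm₂ : (0 : ℝ) < T₂ := ht0.trans ht₂
    -- the difference of slopes is positive immediately after zero
    have hev : ∀ᶠ x in 𝓝[>] (0 : ℝ), 0 < p x - π x := by
      have hd := (h.hp 0 hTm).sub (h₂.hp 0 hTm₂)
      have := hd.hasDerivWithinAt (s := Ioi 0)
      rw [hasDerivWithinAt_iff_tendsto_slope' (by simp)] at this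
      filter_upwards [this.eventually_const_lt (sub_pos.2 hρ), self_mem_nhdsWithin] with x hx hx0
      rw [slope_def_field] at hx
      simp only [Pi.sub_apply, hp0, hπ0, sub_self, sub_zero] at hx
      exact (div_pos_iff_of_pos_right hx0).1 hx
    have hs0 : 0 < s := by
      refine hs0.lt_of_ne ?_
      rintro rfl
      rw [hp0, hπ0] at hs
      exact lt_irrefl _ hs
    obtain ⟨δ, hδ, hδp⟩ := mem_nhdsGT_iff_exists_Ioo_subset.1 hev
    obtain ⟨u, hu0, hu⟩ := exists_between (lt_min (mem_Ioi.1 hδ) hs0)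
    have hus := hu.trans_le (min_le_right _ _)
    have hup : ∀ x, 0 < x → x ≤ u → 0 < p x - π x := fun x h1 h2 =>
      hδp ⟨h1, h2.trans_lt (hu.trans_le (min_le_left _ _))⟩
    obtain ⟨x, hux, hxs, hx0, hx⟩ := exists_first_zero hus.le (h := fun t => π t - p t)
      (fun x hx => ((h₂.continuousAt (hx.2.trans_lt (hst.trans_lt ht₂))).2.1.sub
        (h.continuousAt (hx.2.trans_lt (hst.trans_lt ht))).2.1).continuousWithinAt)
      (by linarith [hup u hu0 le_rfl]) (by linarith)
    have := step x (hu0.trans hux) (hxs.trans_lt (hst.trans_lt ht)) (hxs.trans_lt (hst.trans_lt ht₂))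
      (fun y hy0 hyx => by
        rcases hyx.lt_or_eq with hyx | rfl
        · rcases hy0.lt_or_eq with hy0 | rfl
          · rcases le_or_gt y u with hyu | hyu
            · linarith [hup y hy0 hyu]
            · linarith [hx y hyu.le hyx]
          · rw [hp0, hπ0]
        · linarith)
    linarith
  have := le_of_hasDerivAt_nonneg_Icc (x := 0) (y := t) (h := fun t => f t - φ t) ht0.le
    (fun x hx => (h.hf x (hx.2.trans_lt ht)).sub (h₂.hf x (hx.2.trans_lt ht₂)))
    (fun x hx => sub_nonneg.2 (hge x hx.1.le hx.2.le))
  simp only [hφ0] at this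
  linarith

/-- A lower bound for the time from a positive maximum to the blow-up. -/
lemma blowUp_time_ge (h : IsTraj α T f p r) (hα2 : α ≤ 2) (hT : 0 < T)
    (hf0 : 0 < f 0) (hp0 : p 0 = 0) (hp : ∀ t, 0 < t → t < T → p t < 0)
    (hlim : Tendsto f (𝓝[<] T) atBot) {k : ℝ} (hk : 0 < k) (hkr : -k < r 0) :
    2 * Real.pi * √3 / 3 * (4 / 3 - 3 / 2 * k) ≤ T := by
  -- The first integral `J` at the zero reads `-(9/2) ρ(0) = b³`, so this `b` makes the comparison
  -- solution start with curvature exactly `-k`.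
  set b := (9 / 2 * k) ^ (1 / 3 : ℝ) with hb
  have hb0 : 0 < b := by positivity
  have hb3 : b ^ 3 = 9 / 2 * k := by
    rw [hb, ← Real.rpow_natCast, ← Real.rpow_mul (by positivity)]
    norm_num
  obtain ⟨S, d, φ, π, ρ, hS, h₂, hd₂, hφ0, -, -, -, -, -, hmax⟩ :=
    exists_profile (m := 1 / 3) hb0 (by norm_num) (by norm_num)
  have hα₂ : -((1 / 3 - 1) / (1 / 3) : ℝ) = 2 := by norm_num
  rw [hα₂] at h₂ hmax
  have hne : φ 0 ≠ -b := by rw [hφ0]; linarith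
  have hlim₂ := (h₂.tendsto_atBot_of_maximal hd₂ hb0 one_lt_two hS hne (hmax one_lt_two)).2
  have hSb := h₂.blowUp_time_third hd₂ hb0 hS hφ0 hlim₂
  have hπ0 : π 0 = 0 := by
    have := h₂.sq_eq hd₂ hS
    rw [hφ0] at this
    have h1 : π 0 ^ 2 = 0 := by linarith
    exact pow_eq_zero_iff two_ne_zero |>.1 h1
  have hρ0 : ρ 0 = -k := by
    have := h₂.J_eq hd₂ hS
    rw [hφ0, hb3] at this
    linarith
  have hST : S ≤ T := by
    by_contra! hcon
    have h1 : ∀ᶠ t in 𝓝[<] T, φ T - 1 < φ t :=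
      ((h₂.continuousAt hcon).1.tendsto.mono_left nhdsWithin_le_nhds).eventually_const_lt
        (by linarith)
    obtain ⟨t, ⟨h2, h3⟩, h4⟩ := ((h1.and (hlim.eventually_le_atBot (φ T - 1))).and
      (Ioo_mem_nhdsLT hT)).exists
    have := h.lt_of_critical h₂ hα2 hf0 hp0 hφ0 hπ0 (by rw [hρ0]; exact hkr) hp h4.1.le h4.2
      (h4.2.trans hcon)
    linarith
  refine le_trans ?_ hST
  rw [hSb, mul_comm 3 b, ← div_div, div_right_comm]
  rw [div_eq_mul_inv _ b]
  refine mul_le_mul_of_nonneg_left ?_ (by positivity)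
  -- Tangent-line bounds at `b = 1` replace `1 / b` by an expression linear in `k`.
  have h1 : b ≤ (b ^ 3 + 2) / 3 := by nlinarith [sq_nonneg (b - 1)]
  have h2 : 2 - b ≤ b⁻¹ := by
    have : (2 - b) * b ≤ 1 := by nlinarith [sq_nonneg (b - 1)]
    rwa [← le_div_iff₀ hb0, one_div] at this
  linarith

/-- For `1 < α < 2` the blow-up comes later than for `α = 2`, in the normalisation `a = 1`. -/
lemma blowUp_time_gt_of_scaled (h : IsTraj α T f p r) (hd : ExpDecay 1 l f p r) (hα : 1 < α) (hα2 : α < 2)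
    (hT : 0 < T) (h0 : f 0 = 0) (hf : ∀ t < 0, f t < 0) (hp : ∀ t < 0, 0 < p t) (hp0 : 0 ≤ p 0)
    (hev : ∃ t₂ < T, p t₂ < 0) (hlim : Tendsto f (𝓝[<] T) atBot) :
    2 * Real.pi * √3 / 3 < T := by
  set P := 2 * Real.pi * √3 / 3 with hP
  have hP0 : 0 < P := by positivity
  have hP3 : P < 3.63 := by
    have h1 := Real.pi_lt_d4
    have h2 : √3 < 1.7321 := by
      rw [Real.sqrt_lt' (by norm_num)]
      norm_num
    have h3 : Real.pi * √3 < 3.1416 * 1.7321 :=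
      mul_lt_mul h1 h2.le (by positivity) (by norm_num)
    rw [hP]
    norm_num at h3 ⊢
    linarith
  have hne : f 0 ≠ -1 := by rw [h0]; norm_num
  obtain ⟨hq1, hq2⟩ := h.p_zero_bounds hd hα.le hα2.le hT h0 hf hp
  have hr0 := h.r_zero_ge hd hα.le hα2.le hT h0 hf hp
  have hq : 0 < p 0 := hp0.lt_of_ne fun h1 => by
    rw [← h1] at hq1
    linarith
  obtain ⟨t₂, ht₂, hpt₂⟩ := hev
  have h02 : 0 ≤ t₂ := by
    by_contra! hcon
    exact lt_asymm (hp t₂ hcon) hpt₂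
  obtain ⟨τ, hτ0, hτ2, hτ, -⟩ := exists_first_zero h02 (h := fun t => -p t)
    (fun x hx => (h.continuousAt (hx.2.trans_lt ht₂)).2.1.neg.continuousWithinAt)
    (by linarith) (by linarith)
  have hτp : p τ = 0 := by linarith
  have hτT : τ < T := hτ2.trans_lt ht₂
  have hpos : ∀ t < τ, 0 < p t := fun t ht => h.p_pos_of_nonneg hd hα hT hne hτT hτp.ge ht
  have hE := fun t (ht : t < T) => h.E_neg hd hα hT hne ht
  have hfτ : ∀ t, 0 ≤ t → t ≤ τ → 0 ≤ f t := by
    intro t h1 h2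
    have := (h.strictMonoOn_of_p_pos hτT hpos).monotoneOn (mem_Iic.2 hτ0.le) (mem_Iic.2 h2) h1
    rwa [h0] at this
  have hM : 0 < f τ := by
    have := h.strictMonoOn_of_p_pos hτT hpos (mem_Iic.2 hτ0.le) self_mem_Iic hτ0
    rwa [h0] at this
  have hlt : ∀ {t}, t ∈ Icc 0 τ → t < T := fun ht => ht.2.trans_lt hτT
  have hple : ∀ t ∈ Icc 0 τ, p t ≤ p 0 := by
    intro t ht
    have := le_of_hasDerivAt_nonneg_Icc (h := fun t => -p t) ht.1
      (fun s hs => (h.hp s (hs.2.trans_lt (hlt ht))).neg) (fun s hs => by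
        have h1 := hE s (hs.2.trans (hlt ht))
        have h2 := mul_nonneg (hfτ s hs.1.le (hs.2.le.trans ht.2)) (hpos s (hs.2.trans_le ht.2)).le
        linarith)
    linarith
  have hpn : ∀ t ∈ Icc 0 τ, 0 ≤ p t := fun t ht => by
    rcases ht.2.lt_or_eq with h1 | rfl
    · exact (hpos t h1).le
    · exact hτp.ge
  have hk : 0 < -r τ := by
    have := hE τ hτT
    rw [hτp] at this
    linarith
  -- The three estimates at the maximum come from `G` (increasing while `f ≥ 0`), from `E` with `p ≤
  -- p 0`, and from `F` with `E` decreasing down to `r τ`.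
  have hMk : f τ * -r τ ≤ p 0 ^ 2 / 2 := by
    have := le_of_hasDerivAt_nonneg_Icc hτ0.le (fun s hs => h.hasDerivAt_G (hlt hs)) (fun s hs =>
      mul_nonneg (mul_nonneg (by linarith) (hfτ s hs.1.le hs.2.le)) (sq_nonneg _))
    simp only [h0, hτp] at this
    linarith
  have hkM : -r τ ≤ -r 0 + (α - 1) * p 0 * f τ := by
    have := le_of_hasDerivAt_nonneg_Icc hτ0.le (fun s hs => (h.hasDerivAt_E (hlt hs)).add
      ((h.hf s (hlt hs)).const_mul ((α - 1) * p 0))) (fun s hs => by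
        have hs' := Ioo_subset_Icc_self hs
        have := mul_nonneg (mul_nonneg (sub_nonneg.2 hα.le) (hpn s hs')) (sub_nonneg.2 (hple s hs'))
        linarith)
    simp only [Pi.add_apply, h0, hτp] at this
    linarith
  have hck : p 0 - f τ ^ 2 / 2 ≤ τ * -r τ := by
    have := le_of_hasDerivAt_nonneg_Icc hτ0.le (fun s hs => (h.hasDerivAt_F (hlt hs)).add
      ((hasDerivAt_id s).const_mul (-r τ))) (fun s hs => by
        have := h.E_antitone hα.le (hlt (Ioo_subset_Icc_self hs)) hτT hs.2.le
        simp only [hτp] at this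
        linarith)
    simp only [Pi.add_apply, h0, hτp, id] at this
    linarith
  have hs := h.shift τ
  have hTτ : 0 < T - τ := by linarith
  have hlims : Tendsto (fun t => f (t + τ)) (𝓝[<] (T - τ)) atBot := by
    refine hlim.comp (tendsto_nhdsWithin_iff.2 ⟨?_, ?_⟩)
    · have : Tendsto (fun t : ℝ => t + τ) (𝓝 (T - τ)) (𝓝 (T - τ + τ)) :=
        (continuous_id.add continuous_const).tendsto _
      rw [sub_add_cancel] at this
      exact this.mono_left nhdsWithin_le_nhds
    · filter_upwards [self_mem_nhdsWithin] with t ht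
      have := mem_Iio.1 ht
      exact mem_Iio.2 (by linarith)
  by_contra! hcon
  -- The comparison needs a strictly larger curvature bound, so it is used for every `k > -r τ` and
  -- the limit is taken. Assuming `T ≤ P` turns the bound for `T - τ` into an upper bound for `τ`.
  have hcP : ∀ k > -r τ, τ ≤ P * (3 / 2 * k - 1 / 3) := by
    intro k hk'
    have := hs.blowUp_time_ge hα2.le hTτ (by rwa [zero_add]) (by rwa [zero_add])
      (fun t h1 h2 => h.p_neg_of_nonpos hd hα hT hne (by linarith) hτp.le (by linarith)) hlims
      (hk.trans hk') (by rw [zero_add]; linarith)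
    rw [← hP] at this
    linarith
  have hcP' : τ ≤ P * (3 / 2 * -r τ - 1 / 3) := by
    have hc : Continuous fun k : ℝ => P * (3 / 2 * k - 1 / 3) := by fun_prop
    exact ge_of_tendsto ((hc.tendsto (-r τ)).mono_left nhdsWithin_le_nhds)
      (eventually_of_mem (self_mem_nhdsWithin (s := Ioi (-r τ))) hcP)
  have he2 : √(2 - α) ^ 2 = 2 - α := Real.sq_sqrt (by linarith)
  have he : 0 < √(2 - α) := Real.sqrt_pos.2 (by linarith)
  refine blowUp_numerics he ?_ hq (by rw [he2]; exact hq1) (by rw [he2]; exact hq2) hM hτ0 hk hMk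
    ?_ hck hP3 hP0 hcP'
  · rw [Real.sqrt_lt' one_pos]
    linarith
  · rw [he2]
    linarith

/-- For `1 < α < 2` the blow-up comes later than for `α = 2`. -/
lemma blowUp_time_gt (h : IsTraj α T f p r) (hd : ExpDecay a l f p r) (ha : 0 < a) (hα : 1 < α)
    (hα2 : α < 2) (hT : 0 < T) (h0 : f 0 = 0) (hf : ∀ t < 0, f t < 0) (hp : ∀ t < 0, 0 < p t)
    (hp0 : 0 ≤ p 0) (hev : ∃ t₂ < T, p t₂ < 0) (hlim : Tendsto f (𝓝[<] T) atBot) :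
    2 * Real.pi * √3 / (3 * a) < T := by
  have hc : 0 < a⁻¹ := inv_pos.2 ha
  have hs := h.scale hc
  have hds := hd.scale hc
  rw [inv_mul_cancel₀ ha.ne'] at hds
  rw [div_inv_eq_mul] at hs
  have key := hs.blowUp_time_gt_of_scaled hds hα hα2 (mul_pos hT ha) (by simp [h0])
    (fun t ht => mul_neg_of_pos_of_neg hc (hf _ (mul_neg_of_pos_of_neg hc ht)))
    (fun t ht => mul_pos (by positivity) (hp _ (mul_neg_of_pos_of_neg hc ht)))
    (by rw [mul_zero]; positivity) ?_ ?_
  · rw [← div_div, div_lt_iff₀ ha]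
    exact key
  · obtain ⟨t, ht, hpt⟩ := hev
    refine ⟨a * t, by rw [mul_comm]; exact mul_lt_mul_of_pos_right ht ha, ?_⟩
    rw [inv_mul_cancel_left₀ ha.ne']
    exact mul_neg_of_pos_of_neg (by positivity) hpt
  · refine (hlim.comp (tendsto_nhdsWithin_iff.2 ⟨?_, ?_⟩)).const_mul_atBot hc
    · have : Tendsto (fun t : ℝ => a⁻¹ * t) (𝓝 (T * a)) (𝓝 (a⁻¹ * (T * a))) :=
        (continuous_const.mul continuous_id).tendsto _
      rw [mul_comm T, inv_mul_cancel_left₀ ha.ne'] at this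
      rw [mul_comm T]
      exact this.mono_left nhdsWithin_le_nhds
    · filter_upwards [self_mem_nhdsWithin] with t ht
      rw [mem_Iio, ← div_eq_inv_mul, div_lt_iff₀ ha]
      exact ht

end IsTraj

/-! ### Passing between trajectories and solutions of the boundary value problem -/

lemma SolvesODE.isTraj {m T : ℝ} {I : Set ℝ} {Φ : ℝ → ℝ} (h : SolvesODE m I Φ)
    (hI : UniqueDiffOn ℝ I) (hT : Iio T ⊆ I) :
    IsTraj (-((m - 1) / m)) T Φ (derivWithin Φ I) (iteratedDerivWithin 2 Φ I) := by
  have hD : ∀ n : ℕ, n < 3 → ∀ t < T,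
      HasDerivAt (iteratedDerivWithin n Φ I) (iteratedDerivWithin (n + 1) Φ I t) t := by
    intro n hn t ht
    have hmem : I ∈ 𝓝 t := mem_of_superset (Iio_mem_nhds ht) hT
    have := h.1.differentiableOn_iteratedDerivWithin (m := n) (by exact_mod_cast hn) hI t (hT ht)
    rw [iteratedDerivWithin_succ]
    exact this.hasDerivWithinAt.hasDerivAt hmem
  refine ⟨fun t ht => ?_, fun t ht => ?_, fun t ht => ?_⟩
  · simpa only [iteratedDerivWithin_zero, zero_add, iteratedDerivWithin_one] using
      hD 0 (by norm_num) t ht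
  · simpa only [iteratedDerivWithin_one] using hD 1 (by norm_num) t ht
  · refine (hD 2 (by norm_num) t ht).congr_deriv ?_
    have := h.2 t (hT ht)
    linarith

namespace IsTraj

variable {α T m : ℝ} {f p r f₂ p₂ r₂ : ℝ → ℝ} {I : Set ℝ}

lemma eqOn_derivWithin (h : IsTraj α T f p r) (hI : UniqueDiffOn ℝ I) (hT : I ⊆ Iio T) :
    EqOn (derivWithin f I) p I := fun t ht =>
  (h.hf t (hT ht)).hasDerivWithinAt.derivWithin (hI t ht)

lemma eqOn_iteratedDerivWithin_two (h : IsTraj α T f p r) (hI : UniqueDiffOn ℝ I) (hT : I ⊆ Iio T) :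
    EqOn (iteratedDerivWithin 2 f I) r I := fun t ht => by
  rw [iteratedDerivWithin_succ, iteratedDerivWithin_one,
    derivWithin_congr (h.eqOn_derivWithin hI hT) (h.eqOn_derivWithin hI hT ht)]
  exact (h.hp t (hT ht)).hasDerivWithinAt.derivWithin (hI t ht)

lemma eqOn_iteratedDerivWithin_three (h : IsTraj α T f p r) (hI : UniqueDiffOn ℝ I)
    (hT : I ⊆ Iio T) :
    EqOn (iteratedDerivWithin 3 f I) (fun t => -(f t * r t) - α * p t ^ 2) I := fun t ht => by
  rw [iteratedDerivWithin_succ, derivWithin_congr (h.eqOn_iteratedDerivWithin_two hI hT)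
    (h.eqOn_iteratedDerivWithin_two hI hT ht)]
  exact (h.hr t (hT ht)).hasDerivWithinAt.derivWithin (hI t ht)

/-- Derivatives within `I` agree with `p`, `r` and the right side of the system, so regularity
follows from differentiability of each component; `I` may contain an end point interior to the
trajectory's domain. -/
lemma solvesODE (h : IsTraj (-((m - 1) / m)) T f p r) (hI : UniqueDiffOn ℝ I) (hT : I ⊆ Iio T) :
    SolvesODE m I f := by
  have e1 := h.eqOn_derivWithin hI hT
  have e2 := h.eqOn_iteratedDerivWithin_two hI hT
  have e3 := h.eqOn_iteratedDerivWithin_three hI hT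
  have df : DifferentiableOn ℝ f I := fun t ht =>
    (h.hf t (hT ht)).differentiableAt.differentiableWithinAt
  have dp : DifferentiableOn ℝ p I := fun t ht =>
    (h.hp t (hT ht)).differentiableAt.differentiableWithinAt
  have dr : DifferentiableOn ℝ r I := fun t ht =>
    (h.hr t (hT ht)).differentiableAt.differentiableWithinAt
  constructor
  · refine contDiffOn_of_differentiableOn_deriv (n := 3) fun n hn => ?_
    have hn : n ≤ 3 := by exact_mod_cast hn
    interval_cases n
    · rwa [iteratedDerivWithin_zero]
    · rw [iteratedDerivWithin_one]
      exact dp.congr e1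
    · exact dr.congr e2
    · exact (((df.mul dr).neg).sub ((dp.pow 2).const_mul (-((m - 1) / m)))).congr e3
  · intro t ht
    rw [e1 ht, e2 ht, e3 ht]
    ring

/-- Trajectories with the same first component on a half-line agree. -/
lemma eqOn_of_eqOn_left (h : IsTraj α T f p r) (h₂ : IsTraj α T f₂ p₂ r₂) {s : ℝ} (hs : s ≤ T)
    (he : EqOn f f₂ (Iio s)) {t : ℝ} (ht : t < T) : f t = f₂ t ∧ p t = p₂ t ∧ r t = r₂ t := by
  have hp : EqOn p p₂ (Iio s) := fun t ht =>
    ((h.hf t (ht.trans_le hs)).congr_of_eventuallyEq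
      (eventuallyEq_of_mem (Iio_mem_nhds ht) he.symm)).unique (h₂.hf t (ht.trans_le hs))
  have hr : EqOn r r₂ (Iio s) := fun t ht =>
    ((h.hp t (ht.trans_le hs)).congr_of_eventuallyEq
      (eventuallyEq_of_mem (Iio_mem_nhds ht) hp.symm)).unique (h₂.hp t (ht.trans_le hs))
  obtain ⟨t₀, ht₀⟩ := exists_lt s
  exact h.eqOn h₂ (ht₀.trans_le hs) (he ht₀) (hp ht₀) (hr ht₀) ht

/-- Two profiles, strictly increasing before their common zero, coincide. -/
lemma eq_of_p_pos {a l T₂ : ℝ} (h : IsTraj α T f p r) (h₂ : IsTraj α T₂ f₂ p₂ r₂) (ha : 0 < a)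
    (hd : ExpDecay a l f p r) (hd₂ : ExpDecay a l f₂ p₂ r₂) (hl : a < 2 * l)
    (hT : 0 < T) (hT₂ : 0 < T₂) (h0 : f 0 = 0) (h0₂ : f₂ 0 = 0) (hp : ∀ t < 0, 0 < p t)
    (hp₂ : ∀ t < 0, 0 < p₂ t) {t : ℝ} (ht : t ≤ 0) : f t = f₂ t := by
  -- the leading coefficient is positive
  have coeff : ∀ {T : ℝ} {f p r : ℝ → ℝ}, IsTraj α T f p r → ExpDecay a l f p r → 0 < T → f 0 = 0 →
      (∀ t < 0, 0 < p t) →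
      ∃ d, 0 < d ∧ Tendsto (fun t => Real.exp (-a * t) * (f t + a)) atBot (𝓝 d) := by
    intro T f p r h hd hT h0 hp
    obtain ⟨d, hlim⟩ := h.exists_tendsto_exp_neg_mul hd hl
    refine ⟨d, lt_of_le_of_ne ?_ ?_, hlim⟩
    · refine ge_of_tendsto hlim ?_
      filter_upwards [eventually_le_atBot 0] with t ht
      have := h.neg_lt_of_p_pos hd hT hp ht
      exact mul_nonneg (Real.exp_pos _).le (by linarith)
    -- The equilibrium `-a` has leading coefficient `0`, so `d = 0` would make the profile constant
    -- and contradict `f 0 = 0`.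
    · rintro rfl
      have hc : IsTraj α T (fun _ => -a) (fun _ => 0) (fun _ => 0) :=
        ⟨fun t _ => hasDerivAt_const _ _, fun t _ => hasDerivAt_const _ _,
          fun t _ => (hasDerivAt_const _ _).congr_deriv (by ring)⟩
      have hz : (fun _ : ℝ => (0 : ℝ)) =O[atBot] fun t => Real.exp (l * t) := isBigO_zero _ _
      have hdc : ExpDecay a l (fun _ => -a) (fun _ => 0) (fun _ => 0) :=
        ⟨hd.pos, by simpa using hz, hz, hz⟩
      have := (h.eq_of_tendsto_exp_neg_mul hc ha hd hdc hl hlim (by simp) hT).1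
      rw [h0] at this
      linarith
  -- the statement for ordered leading coefficients
  have main : ∀ {T T₂ : ℝ} {f p r f₂ p₂ r₂ : ℝ → ℝ} {d d₂ : ℝ}, IsTraj α T f p r →
      IsTraj α T₂ f₂ p₂ r₂ → ExpDecay a l f p r → ExpDecay a l f₂ p₂ r₂ → 0 < T → 0 < T₂ →
      f 0 = 0 → f₂ 0 = 0 → (∀ t < 0, 0 < p₂ t) → 0 < d → d ≤ d₂ →
      Tendsto (fun t => Real.exp (-a * t) * (f t + a)) atBot (𝓝 d) →
      Tendsto (fun t => Real.exp (-a * t) * (f₂ t + a)) atBot (𝓝 d₂) →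
      ∀ t ≤ 0, f t = f₂ t := by
    intro T T₂ f p r f₂ p₂ r₂ d d₂ h h₂ hd hd₂ hT hT₂ h0 h0₂ hp₂ hdp hdd l1 l2
    -- Translation by `s` multiplies the leading coefficient by `e^{as}`. Ordering `d ≤ d₂` makes `s
    -- ≥ 0`, so `-s` lies where the second profile is strictly increasing; both `-s` and `0` are
    -- zeros of it.
    set s := Real.log (d₂ / d) / a with hs
    have hs0 : 0 ≤ s := div_nonneg (Real.log_nonneg ((one_le_div hdp).2 hdd)) ha.le
    have hes : Real.exp (a * s) * d = d₂ := by
      rw [hs, mul_div_cancel₀ _ ha.ne', Real.exp_log (div_pos (hdp.trans_le hdd) hdp),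
        div_mul_cancel₀ _ hdp.ne']
    have l1s : Tendsto (fun t => Real.exp (-a * t) * (f (t + s) + a)) atBot (𝓝 d₂) := by
      have := (l1.comp (tendsto_atBot_add_const_right _ s tendsto_id)).const_mul (Real.exp (a * s))
      rw [hes] at this
      refine this.congr fun t => ?_
      simp only [Function.comp, id]
      rw [← mul_assoc, ← Real.exp_add]
      ring_nf
    have key := fun {t} ht => (((h.shift s).mono (min_le_left _ T₂)).eq_of_tendsto_exp_neg_mul
      (h₂.mono (min_le_right (T - s) _)) ha (hd.shift s) hd₂ hl l1s l2 (t := t) ht).1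
    have hz := key (t := -s) (lt_min (by linarith) (by linarith))
    rw [neg_add_cancel, h0] at hz
    have hs00 : s = 0 := by
      have := (h₂.strictMonoOn_of_p_pos hT₂ hp₂).injOn (mem_Iic.2 (neg_nonpos.2 hs0)) self_mem_Iic
        (hz.symm.trans h0₂.symm)
      linarith
    intro t ht
    have := key (t := t) (lt_min (by linarith) (by linarith))
    rwa [hs00, add_zero] at this
  obtain ⟨d, hdp, l1⟩ := coeff h hd hT h0 hp
  obtain ⟨d₂, hdp₂, l2⟩ := coeff h₂ hd₂ hT₂ h0₂ hp₂
  rcases le_total d d₂ with hle | hle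
  · exact main h h₂ hd hd₂ hT hT₂ h0 h0₂ hp₂ hdp hle l1 l2 t ht
  · exact (main h₂ h hd₂ hd hT₂ hT h0₂ h0 hp hdp₂ hle l2 l1 t ht).symm

/-- `r · exp (∫ f)` is strictly decreasing, so `r` changes sign at most once. It is negative at
zero, where it equals `E`, and cannot be nonpositive throughout because `p` rises from `0`. -/
lemma exists_inflection {a l : ℝ} (h : IsTraj α T f p r) (hd : ExpDecay a l f p r) (ha : 0 < a)
    (hα : 1 < α) (hT : 0 < T) (h0 : f 0 = 0) (hp : ∀ t < 0, 0 < p t) :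
    ∃ s < 0, r s = 0 ∧ (∀ t < s, 0 < r t) ∧ ∀ t, s < t → t ≤ 0 → r t < 0 := by
  obtain ⟨A, hA⟩ := h.exists_antideriv
  have hanti : StrictAntiOn (fun t => r t * Real.exp (A t)) (Iic 0) := by
    have hder := fun t (ht : t ≤ 0) => (h.hasDerivAt_mul_exp (ht.trans_lt hT) (hA t (ht.trans_lt hT))).2
    refine strictAntiOn_of_deriv_neg (convex_Iic 0)
      (fun t ht => (hder t ht).continuousAt.continuousWithinAt) (fun t ht => ?_)
    rw [interior_Iic] at ht
    rw [(hder t (mem_Iio.1 ht).le).deriv, neg_lt_zero]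
    have := hp t ht
    have : 0 < α := by linarith
    positivity
  have hr0 : r 0 < 0 := by
    have := h.E_neg hd hα hT (by rw [h0]; linarith) hT
    rwa [h0, zero_mul, add_zero] at this
  obtain ⟨t₀, ht₀, hrt₀⟩ : ∃ t < 0, 0 < r t := by
    by_contra! hcon
    have := le_of_hasDerivAt_nonpos_of_tendsto (fun t ht => h.hp t (ht.trans hT)) hcon
      hd.tendsto_p (t := -1) (by norm_num)
    linarith [hp (-1) (by norm_num)]
  obtain ⟨s, hs1, hs2, hs3, -⟩ := exists_first_zero ht₀.le (h := fun t => -r t)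
    (fun x hx => (h.continuousAt (hx.2.trans_lt hT)).2.2.neg.continuousWithinAt) (by linarith)
    (by linarith)
  have hrs : r s = 0 := by linarith
  refine ⟨s, hs2.lt_of_ne (by rintro rfl; linarith), hrs, fun t ht => ?_, fun t h1 h2 => ?_⟩
  · have := hanti (mem_Iic.2 (ht.le.trans hs2)) hs2 ht
    simp only [hrs, zero_mul] at this
    exact (mul_pos_iff_of_pos_right (Real.exp_pos _)).1 this
  · have := hanti hs2 (mem_Iic.2 h2) h1
    simp only [hrs, zero_mul] at this
    by_contra! hcon
    exact absurd (mul_nonneg hcon (Real.exp_pos (A t)).le) (not_le.2 this)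

lemma integrableOn_p_sq {a l : ℝ} (h : IsTraj α T f p r) (hd : ExpDecay a l f p r) (hT : 0 < T) :
    IntegrableOn (fun t => p t ^ 2) (Iic 0) := by
  have hO : (fun t => p t ^ 2) =O[atBot] fun t => Real.exp (l * t) := by
    have := hd.hp.mul (hd.tendsto_p.isBigO_one ℝ)
    simpa [pow_two] using this
  refine LocallyIntegrableOn.integrableOn_of_isBigO_atBot (ContinuousOn.locallyIntegrableOn
    (fun t ht => ((h.continuousAt (lt_of_le_of_lt ht hT)).2.1.pow 2).continuousWithinAt)
    measurableSet_Iic) hO ⟨Iic 0, Iic_mem_atBot 0, integrableOn_exp_mul_Iic hd.pos 0⟩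

/-- Since `E = r + f p`, the integral condition on the inflection point is just `r = 0`, with `(2m -
1) / m = 1 - α`. -/
lemma E_eq_integral {a l : ℝ} (h : IsTraj α T f p r) (hd : ExpDecay a l f p r) (hT : 0 < T) {t : ℝ}
    (ht : t ≤ 0) : r t + f t * p t = (1 - α) * ∫ s in Iic t, p s ^ 2 := by
  have := integral_Iic_of_hasDerivAt_of_tendsto'
    (fun s hs => h.hasDerivAt_E ((mem_Iic.1 hs).trans_lt (ht.trans_lt hT)))
    (((h.integrableOn_p_sq hd hT).mono_set (Iic_subset_Iic.2 ht)).const_mul (1 - α)) hd.tendsto_E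
  rw [integral_const_mul] at this
  linarith

/-- For `α > 2` there is no profile. -/
lemma false_of_two_lt {a l : ℝ} (h : IsTraj α T f p r) (hd : ExpDecay a l f p r) (ha : 0 < a)
    (hα : 2 < α) (hT : 0 < T) (h0 : f 0 = 0) : False := by
  obtain ⟨t₀, ht₀⟩ := eventually_atBot.1
    (hd.tendsto_f.eventually_lt_const (show -a < 0 by linarith))
  have h00 : t₀ < 0 := by
    by_contra! hcon
    have := ht₀ 0 hcon
    linarith
  obtain ⟨s, hs1, hs2, hs3, hs4⟩ := exists_first_zero h00.le
    (fun x hx => (h.continuousAt (hx.2.trans_lt hT)).1.continuousWithinAt) (ht₀ t₀ le_rfl) h0.ge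
  have hsT : s < T := hs2.trans_lt hT
  have hneg : ∀ t < s, f t < 0 := fun t ht => by
    rcases le_total t t₀ with h1 | h1
    · exact ht₀ t h1
    · exact hs4 t h1 ht
  have hG' : ∀ t < s, 0 ≤ (2 - α) * f t * p t ^ 2 := fun t ht =>
    mul_nonneg (mul_nonneg_of_nonpos_of_nonpos (by linarith) (hneg t ht).le) (sq_nonneg _)
  -- `G` is nondecreasing from `0`, but at the first zero of `f` it is `-p² / 2`; hence it vanishes
  -- identically before `s`.
  have hG : ∀ t < s, f t * r t - p t ^ 2 / 2 + f t ^ 2 * p t = 0 := by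
    intro t ht
    refine le_antisymm ?_ (le_of_hasDerivAt_nonneg_of_tendsto
      (fun t ht => h.hasDerivAt_G (ht.trans hsT)) hG' hd.tendsto_G ht)
    have := le_of_hasDerivAt_nonneg_Icc ht.le (fun x hx => h.hasDerivAt_G (hx.2.trans_lt hsT))
      (fun x hx => hG' x hx.2)
    simp only [hs3] at this
    linarith [sq_nonneg (p s)]
  have hp : ∀ t < s, p t = 0 := by
    intro t ht
    have h1 : HasDerivAt (fun t => f t * r t - p t ^ 2 / 2 + f t ^ 2 * p t) 0 t :=
      (hasDerivAt_const t (0 : ℝ)).congr_of_eventuallyEq (eventuallyEq_of_mem (Iio_mem_nhds ht) hG)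
    have h2 := (h.hasDerivAt_G (ht.trans hsT)).unique h1
    have h3 : (2 - α) * f t ≠ 0 := mul_ne_zero (by linarith) (hneg t ht).ne
    exact pow_eq_zero_iff two_ne_zero |>.1 ((mul_eq_zero.1 h2).resolve_left h3)
  have := h.const_of_p_eq_zero hd hsT.le hp hT
  linarith

end IsTraj

lemma isBigO_exp_of_tendsto_exp_neg_mul {l : ℝ} {g : ℝ → ℝ}
    (h : Tendsto (fun t => Real.exp (-l * t) * g t) atBot (𝓝 0)) :
    g =O[atBot] fun t => Real.exp (l * t) := by
  have := (isBigO_refl (fun t => Real.exp (l * t)) atBot).mul (h.isBigO_one ℝ)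
  refine this.congr (fun t => ?_) (fun t => mul_one _)
  rw [← mul_assoc, ← Real.exp_add]
  simp

lemma tendsto_exp_neg_mul_of_isBigO {a ε : ℝ} (hε : ε < a) {g : ℝ → ℝ}
    (h : g =O[atBot] fun t => Real.exp (a * t)) :
    Tendsto (fun t => Real.exp (-ε * t) * g t) atBot (𝓝 0) := by
  have := (isBigO_refl (fun t => Real.exp (-ε * t)) atBot).mul h
  refine this.trans_tendsto ((tendsto_exp_mul_atBot (sub_pos.2 hε)).congr fun t => ?_)
  rw [← Real.exp_add]
  ring_nf

/-- Solutions of the boundary value problem continue beyond zero. -/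
lemma IsBVPSolution.exists_isTraj {m a : ℝ} {Φ : ℝ → ℝ} (h : IsBVPSolution m a Φ) (ha : 0 < a) :
    ∃ T > 0, ∃ f p r : ℝ → ℝ, IsTraj (-((m - 1) / m)) T f p r ∧ ExpDecay a (3 / 4 * a) f p r ∧
      f 0 = 0 ∧ EqOn f Φ (Iic 0) ∧ p 0 = derivWithin Φ (Iic 0) 0 := by
  have hI : UniqueDiffOn ℝ (Iic (0 : ℝ)) := uniqueDiffOn_Iic 0
  have hT := h.ode.isTraj hI Iio_subset_Iic_self
  have c0 : ContinuousOn Φ (Iic 0) := h.ode.1.continuousOn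
  have c1 : ContinuousOn (derivWithin Φ (Iic 0)) (Iic 0) := by
    rw [← iteratedDerivWithin_one]
    exact h.ode.1.continuousOn_iteratedDerivWithin (by norm_num) hI
  have c2 : ContinuousOn (iteratedDerivWithin 2 Φ (Iic 0)) (Iic 0) :=
    h.ode.1.continuousOn_iteratedDerivWithin (by norm_num) hI
  have hsub : Icc (-1 : ℝ) 0 ⊆ Iic 0 := fun x hx => hx.2
  obtain ⟨B0, hB0⟩ := isCompact_Icc.exists_bound_of_continuousOn (c0.mono hsub)
  obtain ⟨B1, hB1⟩ := isCompact_Icc.exists_bound_of_continuousOn (c1.mono hsub)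
  obtain ⟨B2, hB2⟩ := isCompact_Icc.exists_bound_of_continuousOn (c2.mono hsub)
  -- The `C³` regularity up to the end point bounds the state on `[-1, 0]`, so the trajectory
  -- extends past `0` and its values at `0` become two-sided.
  obtain ⟨T, hT0, f, p, r, htr, ef, ep, er⟩ := hT.exists_extension (t₀ := -1)
    (B := max B0 (max B1 B2)) (by norm_num) (fun t h1 h2 =>
      ⟨(hB0 t ⟨h1, h2.le⟩).trans (le_max_left _ _),
        (hB1 t ⟨h1, h2.le⟩).trans ((le_max_left _ _).trans (le_max_right _ _)),
        (hB2 t ⟨h1, h2.le⟩).trans ((le_max_right _ _).trans (le_max_right _ _))⟩)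
  have at0 : ∀ {u v : ℝ → ℝ}, ContinuousAt u 0 → ContinuousOn v (Iic 0) → EqOn u v (Iio 0) →
      u 0 = v 0 := by
    intro u v hu hv he
    refine tendsto_nhds_unique ((hu.tendsto.mono_left nhdsWithin_le_nhds).congr' ?_)
      ((hv 0 self_mem_Iic).mono_left (nhdsWithin_mono 0 Iio_subset_Iic_self))
    exact eventually_of_mem self_mem_nhdsWithin he
  have hf0 := at0 (htr.continuousAt hT0).1 c0 ef
  -- The decay condition gives every rate below `a`; the uniqueness argument needs a rate above `a /
  -- 2`, and `3a / 4` is such a choice.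
  obtain ⟨d1, d2, d3⟩ := h.decay (3 / 4 * a) (by linarith) (by linarith)
  have hd : ExpDecay a (3 / 4 * a) Φ (derivWithin Φ (Iic 0)) (iteratedDerivWithin 2 Φ (Iic 0)) :=
    ⟨by linarith, isBigO_exp_of_tendsto_exp_neg_mul d1, isBigO_exp_of_tendsto_exp_neg_mul d2,
      isBigO_exp_of_tendsto_exp_neg_mul d3⟩
  refine ⟨T, hT0, f, p, r, htr, hd.congr (eventuallyEq_of_mem (Iio_mem_atBot 0) ef)
    (eventuallyEq_of_mem (Iio_mem_atBot 0) ep) (eventuallyEq_of_mem (Iio_mem_atBot 0) er),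
    hf0.trans h.zero, fun t ht => ?_, at0 (htr.continuousAt hT0).2.1 c1 ep⟩
  rcases (mem_Iic.1 ht).lt_or_eq with h1 | rfl
  · exact ef h1
  · exact hf0

lemma IsTraj.isBVPSolution {m a T : ℝ} {f p r : ℝ → ℝ} (h : IsTraj (-((m - 1) / m)) T f p r)
    (hd : ExpDecay a a f p r) (hT : 0 < T) (h0 : f 0 = 0) : IsBVPSolution m a f := by
  have hI : UniqueDiffOn ℝ (Iic (0 : ℝ)) := uniqueDiffOn_Iic 0
  have hsub : Iic 0 ⊆ Iio T := Iic_subset_Iio.2 hT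
  refine ⟨h.solvesODE hI hsub, fun ε _ hε => ⟨tendsto_exp_neg_mul_of_isBigO hε hd.hf, ?_, ?_⟩, h0⟩
  · refine (tendsto_exp_neg_mul_of_isBigO hε hd.hp).congr' ?_
    filter_upwards [Iic_mem_atBot 0] with t ht
    rw [h.eqOn_derivWithin hI hsub ht]
  · refine (tendsto_exp_neg_mul_of_isBigO hε hd.hr).congr' ?_
    filter_upwards [Iic_mem_atBot 0] with t ht
    rw [h.eqOn_iteratedDerivWithin_two hI hsub ht]

namespace IsTraj

variable {T m a : ℝ} {f p r : ℝ → ℝ}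

lemma isInflectionOfBVP {l : ℝ} (h : IsTraj (-((m - 1) / m)) T f p r) (hd : ExpDecay a l f p r)
    (ha : 0 < a) (hm : 0 < m) (hα : 1 < -((m - 1) / m)) (hT : 0 < T) (h0 : f 0 = 0)
    (hp : ∀ t < 0, 0 < p t) : ∃ s, IsInflectionOfBVP m f s := by
  obtain ⟨s, hs, hrs, hpos, hneg⟩ := h.exists_inflection hd ha hα hT h0 hp
  have hI : UniqueDiffOn ℝ (Iic (0 : ℝ)) := uniqueDiffOn_Iic 0
  have hsub : Iic 0 ⊆ Iio T := Iic_subset_Iio.2 hT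
  have e1 := h.eqOn_derivWithin hI hsub
  have e2 := h.eqOn_iteratedDerivWithin_two hI hsub
  have hcoef : (2 * m - 1) / m = 1 - -((m - 1) / m) := by
    field_simp
    ring
  refine ⟨s, hs, (e2 hs.le).trans hrs, fun t ht => ?_, fun t h1 h2 => ?_, ?_, fun t ht => ?_⟩
  · rw [e2 (ht.trans hs).le]
    exact hpos t ht
  · rw [e2 h2]
    exact hneg t h1 h2
  · exact (h.integrableOn_p_sq hd hT).congr_fun (fun t ht => by simp only [e1 ht]) measurableSet_Iic
  · have hint : ∫ s in Iic t, derivWithin f (Iic 0) s ^ 2 = ∫ s in Iic t, p s ^ 2 :=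
      setIntegral_congr_fun measurableSet_Iic fun x hx => by
        simp only [e1 (mem_Iic.2 (le_trans hx ht))]
    rw [e1 ht, hint, hcoef, ← h.E_eq_integral hd hT ht]
    constructor
    · intro he
      have hr0 : r t = 0 := by linarith
      rcases lt_trichotomy t s with h1 | h1 | h1
      · exact absurd hr0 (hpos t h1).ne'
      · exact h1
      · exact absurd hr0 (hneg t h1 ht).ne
    · rintro rfl
      rw [hrs, zero_add]

/-- A global continuation would coincide with `f` before `T` and yet be continuous at `T`. -/
lemma not_exists_global (h : IsTraj (-((m - 1) / m)) T f p r) (hT : 0 < T)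
    (hlim : Tendsto f (𝓝[<] T) atBot) : ¬ ∃ Ψ : ℝ → ℝ, SolvesODE m univ Ψ ∧ EqOn Ψ f (Iic 0) := by
  rintro ⟨Ψ, hΨ, he⟩
  have h₂ := hΨ.isTraj uniqueDiffOn_univ (T := T + 1) (subset_univ _)
  have hcont := (h₂.continuousAt (lt_add_one T)).1.tendsto.mono_left
    (nhdsWithin_le_nhds (s := Iio T))
  refine not_tendsto_nhds_of_tendsto_atBot hlim _ (hcont.congr' ?_)
  filter_upwards [self_mem_nhdsWithin] with t ht
  exact ((h₂.mono (by linarith)).eqOn_of_eqOn_left h hT.le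
    (fun x hx => he (mem_Iic.2 (mem_Iio.1 hx).le)) ht).1

lemma blowsUpAt {l : ℝ} (h : IsTraj (-((m - 1) / m)) T f p r) (hd : ExpDecay a l f p r) (hm : 0 < m)
    (h1 : 1 ≤ -((m - 1) / m)) (h2 : -((m - 1) / m) ≤ 2) (hT : 0 < T)
    (hlim : Tendsto f (𝓝[<] T) atBot) : BlowsUpAt m f T := by
  refine ⟨hT, f, h.solvesODE isOpen_Iio.uniqueDiffOn Subset.rfl, fun t _ => rfl,
    -- `Y` is obtained by solving the required form for it; it tends to `0` because `6 / (2 + α) =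
    -- 6m / (m + 1)`.
    fun x => f (x + T) * x * ((m + 1) / (6 * m)) - 1, ?_, fun t ht => ?_⟩
  · have hx : Tendsto (fun x : ℝ => x + T) (𝓝[<] 0) (𝓝[<] T) := by
      refine tendsto_nhdsWithin_iff.2 ⟨?_, ?_⟩
      · have : Tendsto (fun x : ℝ => x + T) (𝓝 0) (𝓝 (0 + T)) :=
          (continuous_id.add continuous_const).tendsto _
        rw [zero_add] at this
        exact this.mono_left nhdsWithin_le_nhds
      · filter_upwards [self_mem_nhdsWithin] with x hx
        have := mem_Iio.1 hx
        exact mem_Iio.2 (by linarith)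
    have key := (((h.tendsto_mul_sub_of_tendsto_atBot hd h1 h2 hlim).comp hx).mul_const
      ((m + 1) / (6 * m))).sub_const 1
    have e : 6 / (2 + -((m - 1) / m)) * ((m + 1) / (6 * m)) - 1 = 0 := by
      have : 2 + -((m - 1) / m) = (m + 1) / m := by
        field_simp
        ring
      rw [this]
      field_simp
      ring
    rw [e] at key
    refine key.congr fun x => ?_
    simp only [Function.comp, add_sub_cancel_right]
  · have : t - T ≠ 0 := by linarith
    simp only [sub_add_cancel]
    field_simp
    ring

end IsTraj

/-! ### The main theorem -/

theorem theorem2 (a : ℝ) (ha : 0 < a) :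
    (∀ m : ℝ, 1 / 3 ≤ m → m ≤ 1 / 2 →
      ∃ Φ : ℝ → ℝ, IsBVPSolution m a Φ ∧ StrictMonoOn Φ (Iic 0) ∧
        -- uniqueness among the strictly increasing solutions
        (∀ Ψ : ℝ → ℝ, IsBVPSolution m a Ψ → StrictMonoOn Ψ (Iic 0) → EqOn Ψ Φ (Iic 0)) ∧
        -- more generally, uniqueness among the solutions with nonnegative slope at zero
        (∀ Ψ : ℝ → ℝ, IsBVPSolution m a Ψ → 0 ≤ derivWithin Ψ (Iic 0) 0 → EqOn Ψ Φ (Iic 0)) ∧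
        -- for the two extreme exponents, uniqueness among all solutions
        (m = 1 / 3 ∨ m = 1 / 2 → ∀ Ψ : ℝ → ℝ, IsBVPSolution m a Ψ → EqOn Ψ Φ (Iic 0)) ∧
        (∃ d : ℝ, 0 < d ∧ HasLyapunovSeries m a d Φ) ∧
        (∀ τ ≤ (0 : ℝ), phiHalf a τ ≤ Φ τ ∧ Φ τ ≤ phiThird a τ) ∧
        (m = 1 / 3 → EqOn Φ (phiThird a) (Iic 0)) ∧
        (m = 1 / 2 → EqOn Φ (phiHalf a) (Iic 0)) ∧
        (m < 1 / 2 →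
          (∃ τᵢ : ℝ, IsInflectionOfBVP m Φ τᵢ) ∧
          (¬ ∃ Ψ : ℝ → ℝ, SolvesODE m univ Ψ ∧ EqOn Ψ Φ (Iic 0)) ∧
          ∃ τₚ : ℝ, BlowsUpAt m Φ τₚ ∧
            (m = 1 / 3 → τₚ = 2 * Real.pi * √3 / (3 * a)) ∧
            (1 / 3 < m → 2 * Real.pi * √3 / (3 * a) < τₚ))) ∧
    (∀ m : ℝ, 0 < m → m < 1 / 3 → ¬ ∃ Φ : ℝ → ℝ, IsBVPSolution m a Φ) := by
  constructor
  · intro m hm1 hm2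
    have hm0 : 0 < m := by linarith
    have hα : -((m - 1) / m) = (1 - m) / m := by ring
    have h1 : 1 ≤ -((m - 1) / m) := by
      rw [hα, le_div_iff₀ hm0]
      linarith
    have h2 : -((m - 1) / m) ≤ 2 := by
      rw [hα, div_le_iff₀ hm0]
      linarith
    have h1' : m < 1 / 2 → 1 < -((m - 1) / m) := fun h => by
      rw [hα, lt_div_iff₀ hm0]
      linarith
    have h2' : 1 / 3 < m → -((m - 1) / m) < 2 := fun h => by
      rw [hα, div_lt_iff₀ hm0]
      linarith
    have e1 : m = 1 / 2 → -((m - 1) / m) = 1 := by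
      rintro rfl
      norm_num
    have e2 : m = 1 / 3 → -((m - 1) / m) = 2 := by
      rintro rfl
      norm_num
    obtain ⟨T, d, f, p, r, hT, h, hd, h0, hf, hp, hp0, hd0, hser, hmax⟩ := exists_profile ha h1 h2
    have hne : f 0 ≠ -a := by rw [h0]; linarith
    have hd' : ExpDecay a (3 / 4 * a) f p r := hd.mono (by linarith) (by linarith)
    have huniq : ∀ Ψ : ℝ → ℝ, IsBVPSolution m a Ψ → 0 ≤ derivWithin Ψ (Iic 0) 0 →
        EqOn Ψ f (Iic 0) := by
      intro Ψ hΨ hder t ht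
      obtain ⟨S, hS, g, q, s, hg, hgd, hg0, hgΨ, hq0⟩ := hΨ.exists_isTraj ha
      rw [← hq0] at hder
      have hne' : g 0 ≠ -a := by rw [hg0]; linarith
      -- For `α > 1` a nonnegative final slope forces strictly positive earlier slopes. For `α = 1`
      -- that strictness is missing, but the first integral gives the final slope `a² / 2 > 0`.
      have hq : ∀ t < 0, 0 < q t := by
        intro t ht
        rcases hm2.lt_or_eq with hm | hm
        · exact hg.p_pos_of_nonneg hgd (h1' hm) hS hne' hS hder ht
        · have : 0 < q 0 := by
            rw [e1 hm] at hg
            rw [hg.p_eq hgd hS, hg0]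
            have := pow_pos ha 2
            linarith
          exact hg.p_pos_of_pos hgd h1 hS this ht.le
      rw [← hgΨ ht]
      exact hg.eq_of_p_pos h ha hgd hd' (by linarith) hS hT hg0 h0 hq hp ht
    refine ⟨f, h.isBVPSolution hd hT h0, h.strictMonoOn_of_p_pos hT hp,
      fun Ψ hΨ hmono => huniq Ψ hΨ hmono.monotoneOn.derivWithin_nonneg, huniq, ?_,
      ⟨d, hd0, hser⟩, fun τ hτ => ⟨h.phiHalf_le hd ha h1 hT h0 hf hτ,
        h.le_phiThird hd ha hT h0 hf hp h2 hτ⟩,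
      fun hm τ hτ => h.eq_phiThird hd ha hT h0 hf hp (e2 hm) hτ,
      fun hm τ hτ => h.eq_phiHalf hd ha (e1 hm) hT h0 hf hτ, ?_⟩
    -- At the two extreme exponents a first integral determines the slope at zero of any solution:
    -- `0` for `m = 1/3` and `a² / 2` for `m = 1/2`, so the previous uniqueness applies.
    · intro hm Ψ hΨ
      refine huniq Ψ hΨ ?_
      obtain ⟨S, hS, g, q, s, hg, hgd, hg0, -, hq0⟩ := hΨ.exists_isTraj ha
      rw [← hq0]
      rcases hm with hm | hm
      · rw [e2 hm] at hg
        have := hg.sq_eq hgd hS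
        rw [hg0] at this
        have h3 : q 0 ^ 2 = 0 := by linarith
        exact (pow_eq_zero_iff two_ne_zero |>.1 h3).ge
      · rw [e1 hm] at hg
        rw [hg.p_eq hgd hS, hg0]
        have := pow_pos ha 2
        linarith
    · intro hm
      have hα1 := h1' hm
      obtain ⟨⟨t₂, ht₂, hpt₂⟩, hlim⟩ := h.tendsto_atBot_of_maximal hd ha hα1 hT hne (hmax hα1)
      refine ⟨h.isInflectionOfBVP hd ha hm0 hα1 hT h0 hp, h.not_exists_global hT hlim,
        T, h.blowsUpAt hd hm0 h1 h2 hT hlim, fun hm3 => ?_, fun hm3 => ?_⟩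
      · rw [e2 hm3] at h
        exact h.blowUp_time_third hd ha hT h0 hlim
      · exact h.blowUp_time_gt hd ha hα1 (h2' hm3) hT h0 hf hp hp0
          ⟨t₂, ht₂, hpt₂ t₂ le_rfl ht₂⟩ hlim
  · rintro m hm0 hm ⟨Φ, hΦ⟩
    obtain ⟨T, hT, f, p, r, h, hd, h0, -, -⟩ := hΦ.exists_isTraj ha
    refine h.false_of_two_lt hd ha ?_ hT h0
    rw [show -((m - 1) / m) = (1 - m) / m by ring, lt_div_iff₀ hm0]
    linarith
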